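/- **Setting.** Let $d\in\{1,2,3\}$, $\Omega=(0,1)^d$, and let $\mathcal K$ be a finite regular periodic partition of $\Omega$: the elements $\kappa\in\mathcal K$ are pairwise disjoint nonempty open convex polytopes contained in $\Omega$, $\bigcup_\kappa\overline\kappa=\overline\Omega$, and any closed element meets any $\mathbb Z^d$-translate of a closed element in a common face of any dimension (possibly empty). Let $V:\Omega\to\mathbb R$ be smooth, bounded and nonnegative, $\theta\in\mathbb R$, and $\gamma_\kappa\ge 0$ for $\kappa\in\mathcal K$. Write $(\cdot,\cdot)_\kappa,\|\cdot\|_\kappa$ and $(\cdot,\cdot)_{\partial\kappa},\|\cdot\|_{\partial\kappa}$ for the $L^2$ scalar products and norms on $\kappa$ and on $\partial\kappa$, $n_\kappa$ for the exterior unit normal, and $H^1_\#(\Omega)$ for the $\mathbb Z^d$-periodic functions in $H^1_{\rm loc}(\mathbb R^d)$. On a face shared (periodically) by $\kappa$ and $\kappa'$ put $$[\![v]\!]=v|_\kappa n_\kappa+v|_{\kappa'}n_{\kappa'},\qquad [\![\nabla v]\!]=\nabla v|_\kappa\cdot n_\kappa+\nabla v|_{\kappa'}\cdot n_{\kappa'},\qquad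 \{\gamma\}=\tfrac12(\gamma_\kappa+\gamma_{\kappa'}),$$ and let $\widehat\gamma_\kappa$ be the maximum of $\{\gamma\}$ over the $(d-1)$-dimensional faces of $\kappa$. For each $\kappa$ let $\mathbb V_N(\kappa)$ be a finite-dimensional space that contains the constants and consists of functions $v\in H^1(\kappa)$ with $\Delta v\in L^2(\kappa)$ and normal derivative $\nabla v\cdot n_\kappa\in L^2(\partial\kappa)$; let $\mathbb V_N=\bigoplus_\kappa\mathbb V_N(\kappa)$. With $\Pi_0^\kappa$ the mean value over $\kappa$, put $\langle v,w\rangle_\kappa=(\Pi^\kappa_0v,\Pi^\kappa_0w)_\kappa+(\nabla v,\nabla w)_\kappa$, $|v|_{*,\kappa}=\langle v,v\rangle_\kappa^{1/2}$ and $$a_\kappa=\sup_{v\in H^1(\kappa),\,v\perp\mathbb V_N(\kappa)}\frac{\|v\|_\kappa}{|v|_{*,\kappa}},\qquad b_\kappa=\sup_{v\in H^1(\kappa),\,v\perp\mathbb V_N(\kappa)}\frac{\|v\|_{\partial\kappa}}{|v|_{*,\kappa}},\qquad d_\kappa=\sup_{v\in\mathbb V_N(\kappa)}\frac{\|\nabla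 v\cdot n_\kappa\|_{\partial\kappa}}{|v|_{*,\kappa}},$$ where $\perp$ refers to $\langle\cdot,\cdot\rangle_\kappa$ and $0/0:=0$. Let $u\in H^1_\#(\Omega)$ with $u|_\kappa\in H^2(\kappa)$ for all $\kappa$, $\|u\|_\Omega=1$, and $\lambda\in\mathbb R$ satisfy $-\Delta u+Vu=\lambda u$ in $\Omega$ with periodic boundary conditions (weakly in $H^1_\#(\Omega)$). Let $\lambda_N\in\mathbb R$ and $u_N\in\mathbb V_N$ with $\|u_N\|_\Omega=1$ satisfy $a(u_N,v)=\lambda_N(u_N,v)_\Omega$ for all $v\in\mathbb V_N$, where $$a(w,v)=\sum_\kappa\big[(\nabla w,\nabla v)_\kappa+(Vw,v)_\kappa\big]+\tfrac12\sum_\kappa\big[-(\nabla w,[\![v]\!])_{\partial\kappa}-\theta([\![w]\!],\nabla v)_{\partial\kappa}+\gamma_\kappa([\![w]\!],[\![v]\!])_{\partial\kappa}\big].$$ (In particular, $\lambda$ and $\lambda_N$ may be the smallest eigenvalues.) Put $$|||v|||^2=\sum_\kappa\big[\|\nabla v\|_\kappa^2+\tfrac{\gamma_\kappa}2\|[\![v]\!]\|_{\partial\kappa}^2+\|V^{1/2}v\|_\kappa^2\big],\qquad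 c_\kappa=\frac{\|\nabla(u-u_N)\cdot n_\kappa\|_{\partial\kappa}}{\|\nabla(u-u_N)\|_\kappa}+d_\kappa|\theta|,$$ $$\eta_{R,\kappa}=a_\kappa\|\lambda_Nu_N+\Delta u_N-Vu_N\|_\kappa,\quad \eta_{F,\kappa}=\tfrac{b_\kappa}2\|[\![\nabla u_N]\!]\|_{\partial\kappa},\quad \eta_{J,\kappa}=\big(b_\kappa\widehat\gamma_\kappa+\tfrac{c_\kappa}2\big)\|[\![u_N]\!]\|_{\partial\kappa},$$ and $\mathrm{hot}^{ub}=(\lambda u-\lambda_Nu_N,\varphi)_\Omega$ with $\varphi=(u-u_N)/|||u-u_N|||$ ($\varphi:=0$ if $|||u-u_N|||=0$; a quotient $0/0$ in $c_\kappa$ is $0$). **Theorem.** The suprema $a_\kappa,b_\kappa,d_\kappa$ are finite, and $$|||u-u_N|||\le\Big(\sum_{\kappa\in\mathcal K}\big[\eta_{R,\kappa}+\eta_{F,\kappa}+\eta_{J,\kappa}\big]^2\Big)^{1/2}+\mathrm{hot}^{ub}.$$ -/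

import Mathlib

open MeasureTheory Filter Topology
open scoped ContDiff

noncomputable section

namespace DGEig

/-- Euclidean space of dimension `d`. -/
abbrev E (d : ℕ) : Type := EuclideanSpace ℝ (Fin d)

variable {d : ℕ}

/-! ### Sobolev spaces through weak derivatives -/

/-- `G` is the weak gradient of `v` on the open set `U`. -/
def IsWeakGrad (U : Set (E d)) (v : E d → ℝ) (G : E d → E d) : Prop :=
  LocallyIntegrableOn v U volume ∧ LocallyIntegrableOn G U volume ∧
    ∀ φ : E d → ℝ, ContDiff ℝ ∞ φ → HasCompactSupport φ → tsupport φ ⊆ U →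
      ∫ x in U, v x • gradient φ x = - ∫ x in U, φ x • G x

open Classical in
/-- The weak gradient of `v` on `U` (almost everywhere unique on `U`; `0` if there is none). -/
def wgrad (U : Set (E d)) (v : E d → ℝ) : E d → E d :=
  if h : ∃ G, IsWeakGrad U v G then h.choose else 0

/-- `v|_U ∈ H¹(U)`. -/
def MemH1 (U : Set (E d)) (v : E d → ℝ) : Prop :=
  MemLp v 2 (volume.restrict U) ∧
    ∃ G, IsWeakGrad U v G ∧ MemLp G 2 (volume.restrict U)

/-- `v|_U ∈ H²(U)`. -/
def MemH2 (U : Set (E d)) (v : E d → ℝ) : Prop :=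
  MemH1 U v ∧ ∀ j : Fin d, MemH1 U (fun x => wgrad U v x j)

/-- `f ∈ L²(U)` is the weak Laplacian of `v ∈ H¹(U)`. -/
def IsWeakLap (U : Set (E d)) (v f : E d → ℝ) : Prop :=
  MemLp f 2 (volume.restrict U) ∧
    ∀ φ : E d → ℝ, ContDiff ℝ ∞ φ → HasCompactSupport φ → tsupport φ ⊆ U →
      ∫ x in U, inner ℝ (wgrad U v x) (gradient φ x) = - ∫ x in U, f x * φ x

open Classical in
/-- The weak Laplacian of `v` on `U` (almost everywhere unique on `U`; `0` if there is none). -/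
def wlap (U : Set (E d)) (v : E d → ℝ) : E d → ℝ :=
  if h : ∃ f, IsWeakLap U v f then h.choose else 0

/-! ### Traces -/

/-- The surface measure of `∂U`: the `(d-1)`-dimensional Hausdorff measure, normalised so that it
is the usual area on hyperplanes (and the counting measure if `d = 1`). -/
def surf (U : Set (E d)) : Measure (E d) :=
  (μHE[d - 1] : Measure (E d)).restrict (frontier U)

/-- `T ∈ L²(∂U)` is the trace of `v ∈ H¹(U)`: the limit in `L²(∂U)` of the restrictions of smooth
functions on `ℝ^d` that converge to `v` in `H¹(U)`. -/
def IsTrace (U : Set (E d)) (v T : E d → ℝ) : Prop :=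
  MemLp T 2 (surf U) ∧
    ∃ φ : ℕ → E d → ℝ, (∀ n, ContDiff ℝ ∞ (φ n)) ∧
      Tendsto (fun n => eLpNorm (fun x => φ n x - v x) 2 (volume.restrict U)) atTop (𝓝 0) ∧
      Tendsto (fun n => eLpNorm (fun x => gradient (φ n) x - wgrad U v x) 2
        (volume.restrict U)) atTop (𝓝 0) ∧
      Tendsto (fun n => eLpNorm (fun x => φ n x - T x) 2 (surf U)) atTop (𝓝 0)

open Classical in
/-- The trace of `v` on `∂U`. -/
def trace (U : Set (E d)) (v : E d → ℝ) : E d → ℝ :=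
  if h : ∃ T, IsTrace U v T then h.choose else 0

/-- `g ∈ L²(∂U)` is the exterior normal derivative `∇v · n_U` on `∂U` of a function `v ∈ H¹(U)`
with `Δv ∈ L²(U)`, i.e. the normal trace of the vector field `∇v ∈ H(div, U)`. -/
def IsNormalDeriv (U : Set (E d)) (v g : E d → ℝ) : Prop :=
  MemLp g 2 (surf U) ∧
    ∀ φ : E d → ℝ, ContDiff ℝ ∞ φ →
      ∫ x in U, (wlap U v x * φ x + inner ℝ (wgrad U v x) (gradient φ x))
        = ∫ x, g x * φ x ∂(surf U)

open Classical in
/-- The exterior normal derivative `∇v · n_U` on `∂U`. -/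
def normalDeriv (U : Set (E d)) (v : E d → ℝ) : E d → ℝ :=
  if h : ∃ g, IsNormalDeriv U v g then h.choose else 0

/-- The functions `v ∈ H¹(U)` with `Δv ∈ L²(U)` and `∇v · n_U ∈ L²(∂U)`. -/
def MemH1Normal (U : Set (E d)) (v : E d → ℝ) : Prop :=
  MemH1 U v ∧ (∃ f, IsWeakLap U v f) ∧ ∃ g, IsNormalDeriv U v g

/-! ### The domain, periodic functions and the mesh -/

/-- The domain `Ω = (0,1)^d`. -/
def cube (d : ℕ) : Set (E d) := {x | ∀ j, 0 < x j ∧ x j < 1}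

/-- The vector of `ℝ^d` with the integer coordinates `k`. -/
def latt (k : Fin d → ℤ) : E d := WithLp.toLp 2 fun j => (k j : ℝ)

/-- `u ∈ H¹_#(Ω)`: `u` is a `ℤ^d`-periodic function on `ℝ^d`, weakly differentiable on `ℝ^d`,
and `u` and its gradient are square integrable over a period. -/
def MemH1Per (u : E d → ℝ) : Prop :=
  (∀ (k : Fin d → ℤ) (x : E d), u (x + latt k) = u x) ∧
    MemLp u 2 (volume.restrict (cube d)) ∧
    ∃ G, IsWeakGrad Set.univ u G ∧ MemLp G 2 (volume.restrict (cube d))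

/-- Nonempty open convex polytopes. -/
def IsOpenPolytope (U : Set (E d)) : Prop :=
  U.Nonempty ∧ ∃ s : Finset (E d), U = interior (convexHull ℝ (s : Set (E d)))

/-- A regular periodic partition of `Ω = (0,1)^d` into open convex polytopes. -/
structure Mesh (d : ℕ) (ι : Type*) where
  /-- the elements -/
  elem : ι → Set (E d)
  polytope : ∀ i, IsOpenPolytope (elem i)
  subset : ∀ i, elem i ⊆ cube d
  disjoint : ∀ i j, i ≠ j → Disjoint (elem i) (elem j)
  cover : ⋃ i, closure (elem i) = closure (cube d)
  /-- A closed element and a periodic translate of a closed element meet in a common face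
  (of any dimension, possibly empty). -/
  regular : ∀ i j (k : Fin d → ℤ),
    IsExposed ℝ (closure (elem i)) (closure (elem i) ∩ {x | x - latt k ∈ closure (elem j)})

/-! ### Scalar products and norms -/

/-- The norm `‖v‖_U` of `L²(U)`. -/
def l2 (U : Set (E d)) (v : E d → ℝ) : ℝ := Real.sqrt (∫ x in U, v x ^ 2)

/-- The norm `‖∇v‖_U`. -/
def l2grad (U : Set (E d)) (v : E d → ℝ) : ℝ := Real.sqrt (∫ x in U, ‖wgrad U v x‖ ^ 2)

/-- The scalar product `(v, w)_{∂U}` of `L²(∂U)`. -/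
def bdInner (U : Set (E d)) (v w : E d → ℝ) : ℝ := ∫ x, v x * w x ∂(surf U)

/-- The norm `‖v‖_{∂U}` of `L²(∂U)`. -/
def bdNorm (U : Set (E d)) (v : E d → ℝ) : ℝ := Real.sqrt (∫ x, v x ^ 2 ∂(surf U))

/-- The mean value of `v` over `U`, i.e. the `L²(U)`-projection of `v` onto the constants. -/
def mean (U : Set (E d)) (v : E d → ℝ) : ℝ := (volume.real U)⁻¹ * ∫ x in U, v x

/-- The scalar product `(Π₀ v, Π₀ w)_U + (∇v, ∇w)_U` on `H¹(U)`. -/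
def sinner (U : Set (E d)) (v w : E d → ℝ) : ℝ :=
  (∫ _x in U, mean U v * mean U w) + ∫ x in U, inner ℝ (wgrad U v x) (wgrad U w x)

/-- The norm on `H¹(U)` that belongs to `sinner`. -/
def snorm (U : Set (E d)) (v : E d → ℝ) : ℝ := Real.sqrt (sinner U v v)

/-! ### Local constants

`W` is the local approximation space on the element `U`. A quotient `0 / 0` is `0`. -/

/-- The quotients whose supremum is `a_κ`. -/
def setA (U : Set (E d)) (W : Submodule ℝ (E d → ℝ)) : Set ℝ :=
  {r | ∃ v, MemH1 U v ∧ (∀ w ∈ W, sinner U v w = 0) ∧ r = l2 U v / snorm U v}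

/-- The quotients whose supremum is `b_κ`. -/
def setB (U : Set (E d)) (W : Submodule ℝ (E d → ℝ)) : Set ℝ :=
  {r | ∃ v, MemH1 U v ∧ (∀ w ∈ W, sinner U v w = 0) ∧ r = bdNorm U (trace U v) / snorm U v}

/-- The quotients whose supremum is `d_κ`. -/
def setD (U : Set (E d)) (W : Submodule ℝ (E d → ℝ)) : Set ℝ :=
  {r | ∃ v ∈ W, r = bdNorm U (normalDeriv U v) / snorm U v}

/-- `a_κ`. -/
def cA (U : Set (E d)) (W : Submodule ℝ (E d → ℝ)) : ℝ := sSup (setA U W)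

/-- `b_κ`. -/
def cB (U : Set (E d)) (W : Submodule ℝ (E d → ℝ)) : ℝ := sSup (setB U W)

/-- `d_κ`. -/
def cD (U : Set (E d)) (W : Submodule ℝ (E d → ℝ)) : ℝ := sSup (setD U W)

/-- `d_κ^u(u_N)`, as a function of the error `e = u - u_N` on the element. -/
def cDu (U : Set (E d)) (e : E d → ℝ) : ℝ := bdNorm U (normalDeriv U e) / l2grad U e

/-- `c_κ = d_κ^u(u_N) + d_κ |θ|`. -/
def cC (U : Set (E d)) (W : Submodule ℝ (E d → ℝ)) (θ : ℝ) (e : E d → ℝ) : ℝ :=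
  cDu U e + cD U W * |θ|

/-! ### Jumps

A broken function is a family `v : ι → E d → ℝ`; `v i` is its restriction to the element `i`
(the values of `v i` off the element do not matter). -/

section Broken

variable {ι : Type*} (M : Mesh d ι)

/-- The translate by `p.2` of the element `p.1` is another element of the periodic mesh whose
closure contains the boundary point `x` of the element `i`. -/
def IsNbr (i : ι) (x : E d) (p : ι × (Fin d → ℤ)) : Prop :=
  p ≠ (i, 0) ∧ x - latt p.2 ∈ closure (M.elem p.1)

open Classical in
/-- The value at the boundary point `x` of the element `i` of boundary data `f`, taken from the
element on the other side. Almost every `x ∈ ∂κ_i` has exactly one element on the other side. -/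
def nbrVal (f : ι → E d → ℝ) (i : ι) (x : E d) : ℝ :=
  if h : ∃! p, IsNbr M i x p then f h.choose.1 (x - latt h.choose.2) else 0

/-- The jump of `v` on `∂κ_i`, as the coefficient of `n_{κ_i}`:
`⟦v⟧ = v|_κ n_κ + v|_κ' n_κ' = (v|_κ - v|_κ') n_κ`. -/
def jump (v : ι → E d → ℝ) (i : ι) (x : E d) : ℝ :=
  trace (M.elem i) (v i) x - nbrVal M (fun j => trace (M.elem j) (v j)) i x

/-- The jump of `∇v` on `∂κ_i`: `⟦∇v⟧ = ∇v|_κ · n_κ + ∇v|_κ' · n_κ'`. -/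
def jumpGrad (v : ι → E d → ℝ) (i : ι) (x : E d) : ℝ :=
  normalDeriv (M.elem i) (v i) x + nbrVal M (fun j => normalDeriv (M.elem j) (v j)) i x

/-- `γ̂_κ`: the maximum over the `(d-1)`-dimensional faces of `κ_i` of the average of `γ`. -/
def gammaHat (γ : ι → ℝ) (i : ι) : ℝ :=
  sSup {r | ∃ p : ι × (Fin d → ℤ), p ≠ (i, 0) ∧
    surf (M.elem i) {x | x - latt p.2 ∈ closure (M.elem p.1)} ≠ 0 ∧ r = (γ i + γ p.1) / 2}

variable [Fintype ι]

/-- The interior penalty bilinear form. Since `⟦v⟧` is parallel to `n_κ`, the products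
`(∇w, ⟦v⟧)_{∂κ}` involve the normal derivative of `w` only. -/
def bilin (V : E d → ℝ) (θ : ℝ) (γ : ι → ℝ) (w v : ι → E d → ℝ) : ℝ :=
  ∑ i, ((∫ x in M.elem i, inner ℝ (wgrad (M.elem i) (w i) x) (wgrad (M.elem i) (v i) x))
      + ∫ x in M.elem i, V x * w i x * v i x)
  + (1 / 2) * ∑ i,
      (- bdInner (M.elem i) (normalDeriv (M.elem i) (w i)) (jump M v i)
        - θ * bdInner (M.elem i) (jump M w i) (normalDeriv (M.elem i) (v i))
        + γ i * bdInner (M.elem i) (jump M w i) (jump M v i))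

/-- The scalar product of `L²(Ω)` for broken functions. -/
def brInner (v w : ι → E d → ℝ) : ℝ := ∑ i, ∫ x in M.elem i, v i x * w i x

/-- The broken energy norm. -/
def tnorm (V : E d → ℝ) (γ : ι → ℝ) (v : ι → E d → ℝ) : ℝ :=
  Real.sqrt (∑ i, (l2grad (M.elem i) (v i) ^ 2
    + γ i / 2 * bdNorm (M.elem i) (jump M v i) ^ 2
    + l2 (M.elem i) (fun x => Real.sqrt (V x) * v i x) ^ 2))

/-! ### The eigenvalue problems -/

/-- `(lam, u)` is a normalised eigenpair of `-Δ + V` on `Ω` with periodic boundary conditions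
(weak formulation in `H¹_#(Ω)`). -/
def IsEigenpair (V : E d → ℝ) (lam : ℝ) (u : E d → ℝ) : Prop :=
  MemH1Per u ∧ l2 (cube d) u = 1 ∧
    ∀ w, MemH1Per w →
      (∫ x in cube d, inner ℝ (wgrad (cube d) u x) (wgrad (cube d) w x))
        + (∫ x in cube d, V x * u x * w x) = lam * ∫ x in cube d, u x * w x

/-- `(lamN, uN)` is a normalised DG eigenpair for the approximation space `⨁_i W i`. -/
def IsDGEigenpair (V : E d → ℝ) (θ : ℝ) (γ : ι → ℝ) (W : ι → Submodule ℝ (E d → ℝ))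
    (lamN : ℝ) (uN : ι → E d → ℝ) : Prop :=
  (∀ i, uN i ∈ W i) ∧ Real.sqrt (brInner M uN uN) = 1 ∧
    ∀ v : ι → E d → ℝ, (∀ i, v i ∈ W i) → bilin M V θ γ uN v = lamN * brInner M uN v

/-! ### Estimators -/

/-- The broken error function `u - u_N`. -/
def err (u : E d → ℝ) (uN : ι → E d → ℝ) : ι → E d → ℝ := fun i x => u x - uN i x

/-- `η_{R,κ}`. -/
def etaR (V : E d → ℝ) (W : ι → Submodule ℝ (E d → ℝ)) (lamN : ℝ) (uN : ι → E d → ℝ)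
    (i : ι) : ℝ :=
  cA (M.elem i) (W i) *
    l2 (M.elem i) (fun x => lamN * uN i x + wlap (M.elem i) (uN i) x - V x * uN i x)

/-- `η_{F,κ}`. -/
def etaF (W : ι → Submodule ℝ (E d → ℝ)) (uN : ι → E d → ℝ) (i : ι) : ℝ :=
  cB (M.elem i) (W i) / 2 * bdNorm (M.elem i) (jumpGrad M uN i)

/-- `η_{J,κ}`. -/
def etaJ (W : ι → Submodule ℝ (E d → ℝ)) (θ : ℝ) (γ : ι → ℝ) (u : E d → ℝ)
    (uN : ι → E d → ℝ) (i : ι) : ℝ :=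
  (cB (M.elem i) (W i) * gammaHat M γ i + cC (M.elem i) (W i) θ (err u uN i) / 2)
    * bdNorm (M.elem i) (jump M uN i)

/-- The normalised error function `φ = (u - u_N) / |||u - u_N|||` (`0` if the error has norm
`0`). -/
def phi (V : E d → ℝ) (γ : ι → ℝ) (u : E d → ℝ) (uN : ι → E d → ℝ) : ι → E d → ℝ :=
  fun i x => err u uN i x / tnorm M V γ (err u uN)

/-- `hot^ub = (lam u - lamN u_N, φ)_Ω`. -/
def hotUb (V : E d → ℝ) (γ : ι → ℝ) (lam lamN : ℝ) (u : E d → ℝ) (uN : ι → E d → ℝ) : ℝ :=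
  brInner M (fun i x => lam * u x - lamN * uN i x) (phi M V γ u uN)

end Broken

end DGEig

end

/-! Write `e = u - u_N`. On each element let `z` be the projection of `e` onto the local space with
respect to `⟨·,·⟩_κ`. The constants belong to the local space, so `e - z` has mean zero. Hence `|e -
z|_* = ‖∇(e - z)‖`, and Pythagoras bounds both `‖∇(e - z)‖` and `‖∇z‖` by `‖∇e‖`
(`exists_projection`).

The function `u` satisfies the equation almost everywhere on every element, and neither `u` nor its
normal derivative jumps across faces. Elementwise integration by parts then expresses the energy of
`e` through `(λu - λ_N u_N, e)`, the residual of `u_N`, the jump of `∇u_N` and the jump of `u_N`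
(`IsEigenpair.error_identity`). The discrete equation tested with `z` is subtracted
(`IsDGEigenpair.residual_identity`), so the residual, the gradient jump and the penalty term are
tested with `e - z` only. The other two terms pair the jump of `u_N` with the normal derivatives of
`e` and `z`. Cauchy-Schwarz with `a_κ`, `b_κ`, `d_κ` bounds each local contribution by `(η_R + η_F +
η_J) ‖∇e‖_κ` (`localError_le`). A discrete Cauchy-Schwarz inequality and division by `|||e|||`
finish the proof (`tnorm_err_le`).

In the penalty term the average `{γ}` appears because a sum over all element boundaries visits each
face twice: moving the trace from the neighbour to the element itself replaces `γ_κ` by `γ_κ + γ_κ'`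
(`sum_mul_bdInner_jump`).

The analysis behind this rests on convexity of the elements. Averaging over the points `(1 - ε)x +
εz` with `z` near an interior point gives smooth approximations in `H¹` without any extension
operator (`exists_contDiff_tendsto`). Integration along segments gives the Poincaré inequality
(`exists_poincare`). A polytope is a finite intersection of half-spaces, and a product of
one-dimensional cutoffs yields the divergence theorem (`IsOpenPolytope.exists_normal`). From it
follow the trace inequality and the Gauss formula, which makes normal derivatives of `H²` functions
square integrable. Poincaré and trace inequalities make `a_κ` and `b_κ` finite; finite dimension
makes `d_κ` finite, since functions with zero gradient have zero normal derivative.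

That `u` has no jump follows by approximating it with the same smooth functions on both sides of a
face (`MemH1Per.trace_eq_nbr`). The strong equation and the absence of gradient jumps follow by
testing with periodized bump functions (`IsEigenpair.eigenResidual_eq_zero`,
`IsEigenpair.jumpGrad_eq_zero`). -/

noncomputable section

namespace DGEig

variable {d : ℕ}

/-! ### Square integrable functions -/

section L2

variable {α F : Type*} [MeasurableSpace α] {μ : Measure α} [NormedAddCommGroup F]

theorem eLpNorm_two_eq_ofReal_sqrt {f : α → F} (hf : MemLp f 2 μ) :
    eLpNorm f 2 μ = ENNReal.ofReal (Real.sqrt (∫ x, ‖f x‖ ^ 2 ∂μ)) := by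
  rw [hf.eLpNorm_eq_integral_rpow_norm (by norm_num) (by norm_num)]
  simp [Real.sqrt_eq_rpow]

theorem toReal_eLpNorm_two {f : α → F} (hf : MemLp f 2 μ) :
    (eLpNorm f 2 μ).toReal = Real.sqrt (∫ x, ‖f x‖ ^ 2 ∂μ) := by
  rw [eLpNorm_two_eq_ofReal_sqrt hf, ENNReal.toReal_ofReal (Real.sqrt_nonneg _)]

theorem norm_toLp_two {f : α → F} (hf : MemLp f 2 μ) :
    ‖hf.toLp f‖ = Real.sqrt (∫ x, ‖f x‖ ^ 2 ∂μ) := by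
  rw [Lp.norm_toLp, toReal_eLpNorm_two hf]

theorem tendsto_eLpNorm_of_sub {f : ℕ → α → F} {f' : α → F}
    (hf : ∀ n, MemLp (f n) 2 μ) (hf' : MemLp f' 2 μ)
    (hfl : Tendsto (fun n => eLpNorm (fun x => f n x - f' x) 2 μ) atTop (𝓝 0)) :
    Tendsto (fun n => eLpNorm (f n) 2 μ) atTop (𝓝 (eLpNorm f' 2 μ)) := by
  have h1 : Tendsto (fun n => (hf n).toLp (f n)) atTop (𝓝 (hf'.toLp f')) :=
    (Lp.tendsto_Lp_iff_tendsto_eLpNorm'' f hf f' hf').2 hfl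
  have h2 := (ENNReal.continuous_ofReal.tendsto _).comp h1.norm
  simpa [Function.comp_def, Lp.norm_toLp, ENNReal.ofReal_toReal (hf _).2.ne,
    ENNReal.ofReal_toReal hf'.2.ne] using h2

theorem ae_eq_of_tendsto_eLpNorm {f : ℕ → α → F} {f' f'' : α → F}
    (hf : ∀ n, AEStronglyMeasurable (f n) μ) (hf' : AEStronglyMeasurable f' μ)
    (hf'' : AEStronglyMeasurable f'' μ)
    (h1 : Tendsto (fun n => eLpNorm (fun x => f n x - f' x) 2 μ) atTop (𝓝 0))
    (h2 : Tendsto (fun n => eLpNorm (fun x => f n x - f'' x) 2 μ) atTop (𝓝 0)) :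
    f' =ᵐ[μ] f'' := by
  have h3 : eLpNorm (f' - f'') 2 μ ≤ 0 := by
    have h := h1.add h2
    rw [add_zero] at h
    refine ge_of_tendsto' h fun n => ?_
    have : f' - f'' = (fun x => f n x - f'' x) - (fun x => f n x - f' x) := by
      ext x; simp
    rw [this, add_comm]
    exact eLpNorm_sub_le ((hf n).sub hf'') ((hf n).sub hf') (by norm_num)
  have h4 := (eLpNorm_eq_zero_iff (hf'.sub hf'') (by norm_num)).1 (le_antisymm h3 bot_le)
  filter_upwards [h4] with x hx
  simpa [sub_eq_zero] using hx

variable [InnerProductSpace ℝ F]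

theorem inner_toLp_two {f g : α → F} (hf : MemLp f 2 μ) (hg : MemLp g 2 μ) :
    inner ℝ (hf.toLp f) (hg.toLp g) = ∫ x, inner ℝ (f x) (g x) ∂μ := by
  rw [L2.inner_def]
  refine integral_congr_ae ?_
  filter_upwards [hf.coeFn_toLp, hg.coeFn_toLp] with x h1 h2
  rw [h1, h2]

theorem integrable_inner_of_memLp {f g : α → F} (hf : MemLp f 2 μ) (hg : MemLp g 2 μ) :
    Integrable (fun x => inner ℝ (f x) (g x)) μ := by
  refine (L2.integrable_inner (𝕜 := ℝ) (hf.toLp f) (hg.toLp g)).congr ?_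
  filter_upwards [hf.coeFn_toLp, hg.coeFn_toLp] with x h1 h2
  rw [h1, h2]

theorem integrable_mul_of_memLp {f g : α → ℝ} (hf : MemLp f 2 μ) (hg : MemLp g 2 μ) :
    Integrable (fun x => f x * g x) μ :=
  hf.integrable_mul hg

theorem abs_integral_inner_le {f g : α → F} (hf : MemLp f 2 μ) (hg : MemLp g 2 μ) :
    |∫ x, inner ℝ (f x) (g x) ∂μ| ≤
      Real.sqrt (∫ x, ‖f x‖ ^ 2 ∂μ) * Real.sqrt (∫ x, ‖g x‖ ^ 2 ∂μ) := by
  rw [← inner_toLp_two hf hg, ← norm_toLp_two hf, ← norm_toLp_two hg]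
  exact abs_real_inner_le_norm _ _

theorem abs_integral_mul_le {f g : α → ℝ} (hf : MemLp f 2 μ) (hg : MemLp g 2 μ) :
    |∫ x, f x * g x ∂μ| ≤
      Real.sqrt (∫ x, f x ^ 2 ∂μ) * Real.sqrt (∫ x, g x ^ 2 ∂μ) := by
  have := abs_integral_inner_le hg hf
  simpa [mul_comm] using this

theorem tendsto_integral_inner_of_eLpNorm {f g : ℕ → α → F} {f' g' : α → F}
    (hf : ∀ n, MemLp (f n) 2 μ) (hg : ∀ n, MemLp (g n) 2 μ) (hf' : MemLp f' 2 μ)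
    (hg' : MemLp g' 2 μ)
    (hfl : Tendsto (fun n => eLpNorm (fun x => f n x - f' x) 2 μ) atTop (𝓝 0))
    (hgl : Tendsto (fun n => eLpNorm (fun x => g n x - g' x) 2 μ) atTop (𝓝 0)) :
    Tendsto (fun n => ∫ x, inner ℝ (f n x) (g n x) ∂μ) atTop
      (𝓝 (∫ x, inner ℝ (f' x) (g' x) ∂μ)) := by
  have h1 : Tendsto (fun n => (hf n).toLp (f n)) atTop (𝓝 (hf'.toLp f')) :=
    (Lp.tendsto_Lp_iff_tendsto_eLpNorm'' f hf f' hf').2 hfl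
  have h2 : Tendsto (fun n => (hg n).toLp (g n)) atTop (𝓝 (hg'.toLp g')) :=
    (Lp.tendsto_Lp_iff_tendsto_eLpNorm'' g hg g' hg').2 hgl
  have := h1.inner (𝕜 := ℝ) h2
  simpa only [inner_toLp_two] using this

theorem tendsto_integral_mul_of_eLpNorm {f g : ℕ → α → ℝ} {f' g' : α → ℝ}
    (hf : ∀ n, MemLp (f n) 2 μ) (hg : ∀ n, MemLp (g n) 2 μ) (hf' : MemLp f' 2 μ)
    (hg' : MemLp g' 2 μ)
    (hfl : Tendsto (fun n => eLpNorm (fun x => f n x - f' x) 2 μ) atTop (𝓝 0))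
    (hgl : Tendsto (fun n => eLpNorm (fun x => g n x - g' x) 2 μ) atTop (𝓝 0)) :
    Tendsto (fun n => ∫ x, f n x * g n x ∂μ) atTop (𝓝 (∫ x, f' x * g' x ∂μ)) := by
  simpa [mul_comm] using tendsto_integral_inner_of_eLpNorm hf hg hf' hg' hfl hgl

end L2

/-! ### Weak gradients -/

theorem gradient_add_apply {f g : E d → ℝ} {x : E d} (hf : DifferentiableAt ℝ f x)
    (hg : DifferentiableAt ℝ g x) :
    gradient (fun y => f y + g y) x = gradient f x + gradient g x := by
  simp only [gradient]
  rw [show (fun y => f y + g y) = f + g from rfl, fderiv_add hf hg, map_add]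

theorem inner_gradient_right {f : E d → ℝ} {x v : E d} :
    inner ℝ v (gradient f x) = fderiv ℝ f x v := by
  rw [real_inner_comm, gradient, InnerProductSpace.toDual_symm_apply]

theorem inner_gradient_left {f : E d → ℝ} {x v : E d} :
    inner ℝ (gradient f x) v = fderiv ℝ f x v := by
  rw [gradient, InnerProductSpace.toDual_symm_apply]

theorem continuous_gradient {φ : E d → ℝ} (hφ : ContDiff ℝ ∞ φ) : Continuous (gradient φ) :=
  (InnerProductSpace.toDual ℝ (E d)).symm.continuous.comp (hφ.continuous_fderiv (by simp))

theorem gradient_eq_zero_of_notMem_tsupport {φ : E d → ℝ} {x : E d} (hx : x ∉ tsupport φ) :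
    gradient φ x = 0 := by
  rw [gradient, fderiv_of_notMem_tsupport ℝ hx, map_zero]

theorem hasCompactSupport_gradient {φ : E d → ℝ} (hφ : HasCompactSupport φ) :
    HasCompactSupport (gradient φ) :=
  HasCompactSupport.intro hφ fun _ hx => gradient_eq_zero_of_notMem_tsupport hx

section WeakGrad

variable {U U' : Set (E d)} {v w : E d → ℝ} {G G' : E d → E d}

theorem integrableOn_smul_of_tsupport_subset {F : Type*} [NormedAddCommGroup F] [NormedSpace ℝ F]
    {f : E d → F} {g : E d → ℝ} (hU : IsOpen U) (hf : LocallyIntegrableOn f U volume)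
    (hg : Continuous g) (hgc : HasCompactSupport g) (hgU : tsupport g ⊆ U) :
    IntegrableOn (fun x => g x • f x) U := by
  have h1 : IntegrableOn (fun x => g x • f x) (tsupport g) :=
    (hf.integrableOn_compact_subset hgU hgc).continuousOn_smul hg.continuousOn hgc
  refine h1.of_forall_sdiff_eq_zero hU.measurableSet fun x hx => ?_
  rw [image_eq_zero_of_notMem_tsupport hx.2, zero_smul]

theorem integrableOn_smul_gradient {φ : E d → ℝ} (hU : IsOpen U)
    (hv : LocallyIntegrableOn v U volume) (hφ : ContDiff ℝ ∞ φ) (hc : HasCompactSupport φ)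
    (hs : tsupport φ ⊆ U) : IntegrableOn (fun x => v x • gradient φ x) U := by
  have h1 : IntegrableOn (fun x => v x • gradient φ x) (tsupport φ) :=
    (hv.integrableOn_compact_subset hs hc).smul_continuousOn
      (continuous_gradient hφ).continuousOn hc
  refine h1.of_forall_sdiff_eq_zero hU.measurableSet fun x hx => ?_
  rw [gradient_eq_zero_of_notMem_tsupport hx.2, smul_zero]

theorem IsWeakGrad.ae_eq (hU : IsOpen U) (h : IsWeakGrad U v G) (h' : IsWeakGrad U v G') :
    G =ᵐ[volume.restrict U] G' := by
  have hloc : LocallyIntegrableOn (fun x => G x - G' x) U volume := h.2.1.sub h'.2.1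
  have := hU.ae_eq_zero_of_integral_contDiff_smul_eq_zero hloc ?_
  · rw [Filter.EventuallyEq, ae_restrict_iff' hU.measurableSet]
    filter_upwards [this] with x hx hxU
    exact sub_eq_zero.1 (hx hxU)
  · intro g hg hgc hgU
    have e1 := h.2.2 g hg hgc hgU
    have e2 := h'.2.2 g hg hgc hgU
    have e3 : ∫ x in U, g x • G x = ∫ x in U, g x • G' x := by
      rw [e1] at e2
      exact neg_injective e2
    rw [← setIntegral_eq_integral_of_forall_compl_eq_zero (s := U)]
    · simp only [smul_sub]
      rw [integral_sub (integrableOn_smul_of_tsupport_subset hU h.2.1 hg.continuous hgc hgU)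
        (integrableOn_smul_of_tsupport_subset hU h'.2.1 hg.continuous hgc hgU), e3, sub_self]
    · intro x hx
      rw [image_eq_zero_of_notMem_tsupport (fun h => hx (hgU h)), zero_smul]

theorem wgrad_ae_eq (hU : IsOpen U) (h : IsWeakGrad U v G) :
    wgrad U v =ᵐ[volume.restrict U] G := by
  have hex : ∃ G, IsWeakGrad U v G := ⟨G, h⟩
  rw [wgrad, dif_pos hex]
  exact hex.choose_spec.ae_eq hU h

theorem MemH1.isWeakGrad (h : MemH1 U v) : IsWeakGrad U v (wgrad U v) := by
  obtain ⟨_, G, hG, _⟩ := h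
  have hex : ∃ G, IsWeakGrad U v G := ⟨G, hG⟩
  rw [wgrad, dif_pos hex]
  exact hex.choose_spec

theorem MemH1.memLp_wgrad (hU : IsOpen U) (h : MemH1 U v) :
    MemLp (wgrad U v) 2 (volume.restrict U) := by
  obtain ⟨_, G, hG, hG2⟩ := h
  exact hG2.ae_eq (wgrad_ae_eq hU hG).symm

theorem IsWeakGrad.add (hU : IsOpen U) (h : IsWeakGrad U v G) (h' : IsWeakGrad U w G') :
    IsWeakGrad U (fun x => v x + w x) (fun x => G x + G' x) := by
  refine ⟨h.1.add h'.1, h.2.1.add h'.2.1, fun φ hφ hc hs => ?_⟩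
  simp only [add_smul, smul_add]
  rw [integral_add (integrableOn_smul_gradient hU h.1 hφ hc hs)
    (integrableOn_smul_gradient hU h'.1 hφ hc hs), h.2.2 φ hφ hc hs, h'.2.2 φ hφ hc hs,
    integral_add (integrableOn_smul_of_tsupport_subset hU h.2.1 hφ.continuous hc hs)
        (integrableOn_smul_of_tsupport_subset hU h'.2.1 hφ.continuous hc hs), neg_add]

theorem IsWeakGrad.const_mul (c : ℝ) (h : IsWeakGrad U v G) :
    IsWeakGrad U (fun x => c * v x) (fun x => c • G x) := by
  refine ⟨h.1.smul c, h.2.1.smul c, fun φ hφ hc hs => ?_⟩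
  simp only [mul_smul, smul_comm _ c]
  rw [integral_smul, integral_smul, h.2.2 φ hφ hc hs, smul_neg]

theorem IsWeakGrad.mono (h : IsWeakGrad U v G) (hU : IsOpen U) (hUU : U' ⊆ U) :
    IsWeakGrad U' v G := by
  refine ⟨h.1.mono_set hUU, h.2.1.mono_set hUU, fun φ hφ hc hs => ?_⟩
  have := h.2.2 φ hφ hc (hs.trans hUU)
  rwa [setIntegral_eq_of_subset_of_forall_sdiff_eq_zero hU.measurableSet hUU,
    setIntegral_eq_of_subset_of_forall_sdiff_eq_zero hU.measurableSet hUU] at this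
  · intro x hx
    rw [image_eq_zero_of_notMem_tsupport (fun h => hx.2 (hs h)), zero_smul]
  · intro x hx
    rw [gradient_eq_zero_of_notMem_tsupport (fun h => hx.2 (hs h)), smul_zero]

theorem isWeakGrad_gradient (U : Set (E d)) {ψ : E d → ℝ} (hψ : ContDiff ℝ ∞ ψ) :
    IsWeakGrad U ψ (gradient ψ) := by
  refine ⟨hψ.continuous.locallyIntegrable.locallyIntegrableOn _,
    (continuous_gradient hψ).locallyIntegrable.locallyIntegrableOn _, fun φ hφ hc hs => ?_⟩
  rw [setIntegral_eq_integral_of_forall_compl_eq_zero,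
    setIntegral_eq_integral_of_forall_compl_eq_zero]
  · have i1 : Integrable (fun x => ψ x • gradient φ x) :=
      (hψ.continuous.smul (continuous_gradient hφ)).integrable_of_hasCompactSupport
        (hasCompactSupport_gradient hc).smul_left
    have i2 : Integrable (fun x => φ x • gradient ψ x) :=
      (hφ.continuous.smul (continuous_gradient hψ)).integrable_of_hasCompactSupport
        hc.smul_right
    refine ext_inner_left ℝ fun v => ?_
    rw [inner_neg_right, ← integral_inner i1, ← integral_inner i2]
    simp only [inner_smul_right, inner_gradient_right]
    have := integral_mul_fderiv_eq_neg_fderiv_mul_of_integrable (μ := (volume : Measure (E d)))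
      (f := ψ) (g := φ) (v := v) ?_ ?_ ?_ ?_ ?_
    · rw [this]
      simp only [mul_comm]
    · refine (i2.const_inner v).congr (.of_forall fun x => ?_)
      simp [inner_smul_right, mul_comm]
    · refine (i1.const_inner v).congr (.of_forall fun x => ?_)
      simp [inner_smul_right]
    · exact (hψ.continuous.mul hφ.continuous).integrable_of_hasCompactSupport hc.mul_left
    · exact fun x _ => hψ.differentiable (by simp) x
    · exact fun x _ => hφ.differentiable (by simp) x
  · intro x hx
    rw [image_eq_zero_of_notMem_tsupport (fun h => hx (hs h)), zero_smul]
  · intro x hx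
    rw [gradient_eq_zero_of_notMem_tsupport (fun h => hx (hs h)), smul_zero]

theorem isFiniteMeasure_restrict_of_isBounded (hb : Bornology.IsBounded U) :
    IsFiniteMeasure ((volume : Measure (E d)).restrict U) :=
  ⟨by simpa using hb.measure_lt_top⟩

theorem exists_bound_of_isBounded {F : Type*} [NormedAddCommGroup F] (hb : Bornology.IsBounded U)
    {f : E d → F} (hf : Continuous f) : ∃ C : ℝ, ∀ x ∈ closure U, ‖f x‖ ≤ C :=
  hb.isCompact_closure.exists_bound_of_continuousOn hf.continuousOn

theorem ae_restrict_mem_closure (μ : Measure (E d)) (U : Set (E d)) :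
    ∀ᵐ x ∂μ.restrict U, x ∈ closure U :=
  ae_mono (Measure.restrict_mono subset_closure le_rfl)
    (ae_restrict_mem isClosed_closure.measurableSet)

theorem memLp_restrict_of_continuous {F : Type*} [NormedAddCommGroup F] {μ : Measure (E d)}
    [IsFiniteMeasure (μ.restrict U)] (hb : Bornology.IsBounded U)
    {f : E d → F} (hf : Continuous f) {p : ENNReal} : MemLp f p (μ.restrict U) := by
  obtain ⟨C, hC⟩ := exists_bound_of_isBounded hb hf
  refine MemLp.of_bound ?_ C ?_
  · exact hf.aestronglyMeasurable
  · filter_upwards [ae_restrict_mem_closure μ U] with x hx using hC x hx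

theorem memH1_of_contDiff (hb : Bornology.IsBounded U) {ψ : E d → ℝ}
    (hψ : ContDiff ℝ ∞ ψ) : MemH1 U ψ :=
  have := isFiniteMeasure_restrict_of_isBounded hb
  ⟨memLp_restrict_of_continuous hb hψ.continuous, gradient ψ, isWeakGrad_gradient U hψ,
    memLp_restrict_of_continuous hb (continuous_gradient hψ)⟩

theorem MemH1.add (hU : IsOpen U) (hv : MemH1 U v) (hw : MemH1 U w) :
    MemH1 U (fun x => v x + w x) :=
  ⟨MemLp.add hv.1 hw.1, _, hv.isWeakGrad.add hU hw.isWeakGrad,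
    (hv.memLp_wgrad hU).add (hw.memLp_wgrad hU)⟩

theorem MemH1.const_mul (hU : IsOpen U) (c : ℝ) (hv : MemH1 U v) : MemH1 U (fun x => c * v x) :=
  ⟨hv.1.const_mul c, _, hv.isWeakGrad.const_mul c, (hv.memLp_wgrad hU).const_smul c⟩

theorem MemH1.sub (hU : IsOpen U) (hv : MemH1 U v) (hw : MemH1 U w) :
    MemH1 U (fun x => v x - w x) := by
  simpa [sub_eq_add_neg] using hv.add hU (hw.const_mul hU (-1))

theorem MemH1.mono (h : MemH1 U v) (hU : IsOpen U) (hUU : U' ⊆ U) : MemH1 U' v :=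
  ⟨h.1.mono_measure (Measure.restrict_mono hUU le_rfl), _, h.isWeakGrad.mono hU hUU,
    (h.memLp_wgrad hU).mono_measure (Measure.restrict_mono hUU le_rfl)⟩

theorem wgrad_add (hU : IsOpen U) (hv : MemH1 U v) (hw : MemH1 U w) :
    wgrad U (fun x => v x + w x) =ᵐ[volume.restrict U] fun x => wgrad U v x + wgrad U w x :=
  wgrad_ae_eq hU (hv.isWeakGrad.add hU hw.isWeakGrad)

theorem wgrad_const_mul (hU : IsOpen U) (c : ℝ) (hv : MemH1 U v) :
    wgrad U (fun x => c * v x) =ᵐ[volume.restrict U] fun x => c • wgrad U v x :=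
  wgrad_ae_eq hU (hv.isWeakGrad.const_mul c)

theorem wgrad_sub (hU : IsOpen U) (hv : MemH1 U v) (hw : MemH1 U w) :
    wgrad U (fun x => v x - w x) =ᵐ[volume.restrict U] fun x => wgrad U v x - wgrad U w x := by
  refine wgrad_ae_eq hU ?_
  simpa [sub_eq_add_neg] using hv.isWeakGrad.add hU (hw.isWeakGrad.const_mul (-1))

theorem wgrad_of_contDiff (hU : IsOpen U) {ψ : E d → ℝ} (hψ : ContDiff ℝ ∞ ψ) :
    wgrad U ψ =ᵐ[volume.restrict U] gradient ψ :=
  wgrad_ae_eq hU (isWeakGrad_gradient U hψ)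

theorem gradient_comp_add_right (φ : E d → ℝ) (a x : E d) :
    gradient (fun y => φ (y + a)) x = gradient φ (x + a) := by
  rw [gradient, gradient, fderiv_comp_add_right]

theorem setIntegral_preimage_add {F : Type*} [NormedAddCommGroup F] [NormedSpace ℝ F]
    (f : E d → F) (U : Set (E d)) (a : E d) :
    ∫ x in (fun x => x + a) ⁻¹' U, f (x + a) = ∫ x in U, f x :=
  (measurePreserving_add_right volume a).setIntegral_preimage_emb
    (measurableEmbedding_addRight a) f U

theorem IsWeakGrad.comp_add (h : IsWeakGrad U v G) (hU : IsOpen U) (a : E d) :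
    IsWeakGrad ((fun x => x + a) ⁻¹' U) (fun x => v (x + a)) (fun x => G (x + a)) := by
  have hloc : ∀ {F : Type} [NormedAddCommGroup F] {f : E d → F}, LocallyIntegrableOn f U volume →
      LocallyIntegrableOn (fun x => f (x + a)) ((fun x => x + a) ⁻¹' U) volume := by
    intro F _ f hf
    rw [locallyIntegrableOn_iff (hU.preimage (continuous_add_const a)).isLocallyClosed]
    intro k hk hkc
    have h1 := hf.integrableOn_compact_subset (Set.image_subset_iff.2 hk)
      (hkc.image (continuous_add_const a))
    have h2 := ((measurePreserving_add_right volume a).integrableOn_comp_preimage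
      (measurableEmbedding_addRight a) (f := f) (s := (fun x => x + a) '' k)).2 h1
    rwa [Set.preimage_image_eq _ (add_left_injective a)] at h2
  refine ⟨hloc h.1, hloc h.2.1, fun φ hφ hc hs => ?_⟩
  have e := h.2.2 (fun y => φ (y + (-a))) (hφ.comp (contDiff_id.add contDiff_const))
    (hc.comp_homeomorph (Homeomorph.addRight (-a))) ?_
  · rw [← setIntegral_preimage_add _ U a, ← setIntegral_preimage_add (fun x => φ (x + -a) • G x) U a]
      at e
    simpa only [gradient_comp_add_right, add_neg_cancel_right] using e
  · rw [show (fun y => φ (y + -a)) = φ ∘ (Homeomorph.addRight (-a)) from rfl,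
      tsupport_comp_eq_preimage]
    intro x hx
    simpa using hs hx

end WeakGrad

/-! ### Smooth approximation on convex domains -/

section Average

variable {α β F : Type*} [MeasurableSpace α] [MeasurableSpace β] [NormedAddCommGroup F]
  {μ : Measure α} {ν : Measure β} [IsProbabilityMeasure ν]

/-- Jensen's inequality on every slice: on a probability space the `L¹` norm is at most the `L²`
norm. -/
theorem eLpNorm_integral_le_prod [NormedSpace ℝ F] {f : α × β → F} (hf : AEStronglyMeasurable f (μ.prod ν)) :
    eLpNorm (fun x => ∫ z, f (x, z) ∂ν) 2 μ ≤ eLpNorm f 2 (μ.prod ν) := by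
  rw [eLpNorm_eq_lintegral_rpow_enorm_toReal (by norm_num) (by norm_num),
    eLpNorm_eq_lintegral_rpow_enorm_toReal (by norm_num) (by norm_num)]
  refine ENNReal.rpow_le_rpow ?_ (by norm_num)
  rw [lintegral_prod _ (hf.enorm.pow_const _)]
  refine lintegral_mono_ae ?_
  filter_upwards [hf.prodMk_left] with x hx
  have h1 : eLpNorm (fun z => f (x, z)) 1 ν ≤ eLpNorm (fun z => f (x, z)) 2 ν :=
    eLpNorm_le_eLpNorm_of_exponent_le (by norm_num) hx
  rw [eLpNorm_one_eq_lintegral_enorm,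
    eLpNorm_eq_lintegral_rpow_enorm_toReal (p := 2) (by norm_num) (by norm_num)] at h1
  have h2 := (enorm_integral_le_lintegral_enorm (fun z => f (x, z))).trans h1
  have h3 := ENNReal.rpow_le_rpow h2 (z := (2 : ENNReal).toReal) (by norm_num)
  rwa [← ENNReal.rpow_mul, one_div, inv_mul_cancel₀ (by norm_num), ENNReal.rpow_one] at h3

theorem ae_integrable_of_memLp_prod [SFinite μ] {f : α × β → F} (hf : MemLp f 2 (μ.prod ν)) :
    ∀ᵐ x ∂μ, Integrable (fun z => f (x, z)) ν := by
  have h1 := (memLp_two_iff_integrable_sq_norm hf.1).1 hf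
  filter_upwards [h1.prod_right_ae, hf.1.prodMk_left] with x h2 h3
  exact ((memLp_two_iff_integrable_sq_norm h3).2 h2).integrable (by norm_num)

end Average

/-- The convex combination `(1 - ε) x + ε z`. -/
def shrink (ε : ℝ) (p : E d × E d) : E d := (1 - ε) • p.1 + ε • p.2

theorem continuous_shrink (ε : ℝ) : Continuous (shrink ε : E d × E d → E d) := by
  unfold shrink; fun_prop

/-- For fixed `z` the map is a dilation by `1 - ε` followed by a translation. Its effect on volume
does not depend on `z`, so the average over `ν` leaves the factor unchanged. -/
theorem map_shrink {ε : ℝ} (hε : ε < 1) (ν : Measure (E d)) [IsProbabilityMeasure ν] :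
    (Measure.map (shrink ε) ((volume : Measure (E d)).prod ν)) =
      ENNReal.ofReal (((1 - ε) ^ d)⁻¹) • volume := by
  have h1 : (0 : ℝ) < 1 - ε := by linarith
  ext s hs
  rw [Measure.map_apply (continuous_shrink ε).measurable hs,
    Measure.prod_apply_symm ((continuous_shrink ε).measurable hs)]
  have : ∀ z : E d, volume ((fun x => (x, z)) ⁻¹' (shrink ε ⁻¹' s)) =
      ENNReal.ofReal (((1 - ε) ^ d)⁻¹) * volume s := by
    intro z
    have e : (fun x : E d => (x, z)) ⁻¹' (shrink ε ⁻¹' s) =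
        ((1 - ε) • ·) ⁻¹' ((fun y => y + ε • z) ⁻¹' s) := rfl
    rw [e, Measure.addHaar_preimage_smul _ h1.ne', measure_preimage_add_right]
    rw [abs_of_pos (by positivity)]
    simp
  simp [this]

/-! ### Strong continuity in `L²` of averaging over contractions -/

section Shrink

variable {F : Type*} [NormedAddCommGroup F] {ν : Measure (E d)} [IsProbabilityMeasure ν]
  {f : E d → F}

theorem memLp_comp_shrink {ε : ℝ} (hε : ε < 1) (hf : MemLp f 2 volume) :
    MemLp (fun p => f (shrink ε p)) 2 ((volume : Measure (E d)).prod ν) := by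
  have : MemLp f 2 (Measure.map (shrink ε) ((volume : Measure (E d)).prod ν)) := by
    rw [map_shrink hε]
    exact hf.smul_measure ENNReal.ofReal_ne_top
  exact (memLp_map_measure_iff this.1 (continuous_shrink ε).aemeasurable).1 this

/-- The restriction `ε ≤ 1/2` makes the constant uniform in `ε`; this uniformity is what carries the
convergence from compactly supported continuous functions to `L²`. -/
theorem eLpNorm_comp_shrink_le {ε : ℝ} (hε : ε ≤ 1 / 2) (hf : AEStronglyMeasurable f volume) :
    eLpNorm (fun p => f (shrink ε p)) 2 ((volume : Measure (E d)).prod ν) ≤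
      ENNReal.ofReal (2 ^ d) ^ (1 / 2 : ℝ) * eLpNorm f 2 volume := by
  have hf' : AEStronglyMeasurable f
      (Measure.map (shrink ε) ((volume : Measure (E d)).prod ν)) := by
    rw [map_shrink (by linarith)]
    exact hf.smul_measure _
  have e := eLpNorm_map_measure (p := 2) hf' (continuous_shrink ε).aemeasurable
  rw [show (fun p => f (shrink ε p)) = f ∘ shrink ε from rfl, ← e, map_shrink (by linarith),
    eLpNorm_smul_measure_of_ne_top (by norm_num)]
  simp only [smul_eq_mul]
  have h1 : ((1 - ε) ^ d)⁻¹ ≤ 2 ^ d := by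
    rw [← inv_pow]
    have h2 : (1 - ε)⁻¹ ≤ 2 := by
      rw [inv_le_comm₀ (by linarith) (by norm_num)]
      linarith
    have : 0 ≤ (1 - ε)⁻¹ := inv_nonneg.2 (by linarith)
    gcongr
  rw [show (1 / 2 : ENNReal).toReal = 1 / 2 by simp]
  gcongr

theorem tendsto_comp_shrink_of_continuous {R : ℝ} (hν : ∀ᵐ z ∂ν, ‖z‖ ≤ R) (hf : Continuous f)
    (hc : HasCompactSupport f) {ε : ℕ → ℝ} (hε0 : ∀ n, 0 ≤ ε n) (hε : ∀ n, ε n ≤ 1 / 2)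
    (hεl : Tendsto ε atTop (𝓝 0)) :
    Tendsto (fun n => eLpNorm (fun p : E d × E d => f (shrink (ε n) p) - f p.1) 2
      ((volume : Measure (E d)).prod ν)) atTop (𝓝 0) := by
  obtain ⟨C, hC⟩ := hf.bounded_above_of_compact_support hc
  obtain ⟨R', hR'⟩ := hc.isCompact.isBounded.subset_closedBall (0 : E d)
  -- If `‖x‖ > R2`, then `‖(1 - ε)x + εz‖ ≥ ‖x‖/2 - R > R'`. Beyond this radius both `x` and its
  -- image lie outside the support of `f`, uniformly in `ε ≤ 1/2`.
  set R2 := 2 * R' + 2 * R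
  have hR0 : 0 ≤ R := by
    obtain ⟨z, hz⟩ := hν.exists
    exact (norm_nonneg z).trans hz
  have hf0 : ∀ x, R' < ‖x‖ → f x = 0 := by
    intro x hx
    refine image_eq_zero_of_notMem_tsupport fun h => ?_
    have := hR' h
    simp at this
    linarith
  have key : Tendsto (fun n => ∫⁻ p : E d × E d, ‖f (shrink (ε n) p) - f p.1‖ₑ ^ 2
      ∂((volume : Measure (E d)).prod ν)) atTop (𝓝 0) := by
    have := tendsto_lintegral_of_dominated_convergence (μ := (volume : Measure (E d)).prod ν)
      (F := fun n (p : E d × E d) => ‖f (shrink (ε n) p) - f p.1‖ₑ ^ 2) (f := fun _ => 0)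
      ((Metric.closedBall (0 : E d) R2 ×ˢ Set.univ).indicator fun _ => ENNReal.ofReal (2 * C) ^ 2)
      ?_ ?_ ?_ ?_
    · simpa using this
    · intro n
      have : Continuous fun p : E d × E d => f (shrink (ε n) p) - f p.1 :=
        (hf.comp (continuous_shrink _)).sub (hf.comp continuous_fst)
      exact (this.enorm.measurable.pow_const _)
    · intro n
      have hν' : ∀ᵐ p ∂((volume : Measure (E d)).prod ν), ‖p.2‖ ≤ R :=
        Measure.quasiMeasurePreserving_snd.ae hν
      filter_upwards [hν'] with p hp
      by_cases h : p.1 ∈ Metric.closedBall (0 : E d) R2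
      · rw [Set.indicator_of_mem (by exact ⟨h, trivial⟩)]
        gcongr
        rw [← ofReal_norm]
        refine ENNReal.ofReal_le_ofReal ((norm_sub_le _ _).trans ?_)
        linarith [hC (shrink (ε n) p), hC p.1]
      · rw [Set.indicator_of_notMem (fun h' => h h'.1)]
        simp only [Metric.mem_closedBall, dist_zero_right, not_le] at h
        have h1 : R' < ‖p.1‖ ∧ R' < ‖shrink (ε n) p‖ := by
          have h2 : ‖(1 - ε n) • p.1‖ ≤ ‖shrink (ε n) p‖ + ‖ε n • p.2‖ := by
            have : (1 - ε n) • p.1 = shrink (ε n) p - ε n • p.2 := by simp [shrink]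
            rw [this]
            exact norm_sub_le _ _
          rw [norm_smul, norm_smul, Real.norm_of_nonneg (hε0 n),
            Real.norm_of_nonneg (by linarith [hε n])] at h2
          have h3 : ε n * ‖p.2‖ ≤ R := by nlinarith [hε0 n, hε n, norm_nonneg p.2]
          have h4 : ‖p.1‖ / 2 ≤ (1 - ε n) * ‖p.1‖ := by nlinarith [hε n, norm_nonneg p.1]
          constructor <;> nlinarith [norm_nonneg p.1]
        simp [hf0 _ h1.1, hf0 _ h1.2]
    · rw [lintegral_indicator ((Metric.isClosed_closedBall.measurableSet).prod .univ)]
      simp only [lintegral_const, Measure.restrict_apply, MeasurableSet.univ, Set.univ_inter,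
        Measure.prod_prod, measure_univ, mul_one]
      exact ENNReal.mul_ne_top (ENNReal.pow_ne_top ENNReal.ofReal_ne_top)
        measure_closedBall_lt_top.ne
    · refine .of_forall fun p => ?_
      have h1 : Tendsto (fun n => shrink (ε n) p) atTop (𝓝 p.1) := by
        have : Continuous fun e : ℝ => shrink e p := by unfold shrink; fun_prop
        have h2 := (this.tendsto 0).comp hεl
        simpa [shrink, Function.comp_def] using h2
      have h2 : Tendsto (fun n => f (shrink (ε n) p) - f p.1) atTop (𝓝 (f p.1 - f p.1)) :=
        ((hf.tendsto _).comp h1).sub_const _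
      have h3 := (ENNReal.continuous_pow 2).tendsto _ |>.comp ((continuous_enorm.tendsto _).comp h2)
      simpa [Function.comp_def] using h3
  have h2 := (ENNReal.continuous_rpow_const (y := (1 / 2 : ℝ))).tendsto 0 |>.comp key
  rw [ENNReal.zero_rpow_of_pos (by norm_num)] at h2
  refine h2.congr fun n => ?_
  rw [eLpNorm_eq_lintegral_rpow_enorm_toReal (by norm_num) (by norm_num)]
  simp

theorem tendsto_comp_shrink {R : ℝ} (hν : ∀ᵐ z ∂ν, ‖z‖ ≤ R) [NormedSpace ℝ F]
    (hf : MemLp f 2 volume) {ε : ℕ → ℝ} (hε0 : ∀ n, 0 ≤ ε n) (hε : ∀ n, ε n ≤ 1 / 2)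
    (hεl : Tendsto ε atTop (𝓝 0)) :
    Tendsto (fun n => eLpNorm (fun p : E d × E d => f (shrink (ε n) p) - f p.1) 2
      ((volume : Measure (E d)).prod ν)) atTop (𝓝 0) := by
  set K : ENNReal := ENNReal.ofReal (2 ^ d) ^ (1 / 2 : ℝ)
  have hK : K ≠ ⊤ := by simp [K]
  rw [ENNReal.tendsto_atTop_zero]
  intro δ hδ
  -- With `g` continuous and `η`-close to `f`, the three summands bound `f - g` after the
  -- contraction, the difference for `g`, and `f - g` itself.
  obtain ⟨η, hη0, hη⟩ : ∃ η : ENNReal, 0 < η ∧ K * η + δ / 2 + η ≤ δ := by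
    have h1 : K + 1 ≠ ⊤ := by simp [hK]
    refine ⟨δ / 2 / (K + 1), ENNReal.div_pos (ENNReal.half_pos hδ.ne').ne' h1, ?_⟩
    have h2 : (K + 1) * (δ / 2 / (K + 1)) = δ / 2 := ENNReal.mul_div_cancel (by simp) h1
    calc _ = (K + 1) * (δ / 2 / (K + 1)) + δ / 2 := by ring
      _ = δ := by rw [h2, ENNReal.add_halves]
      _ ≤ δ := le_rfl
  obtain ⟨g, hgc, hg, hgcont, hgm⟩ := hf.exists_hasCompactSupport_eLpNorm_sub_le (by norm_num)
    hη0.ne'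
  have h1 := tendsto_comp_shrink_of_continuous hν hgcont hgc hε0 hε hεl
  obtain ⟨N, hN⟩ := ENNReal.tendsto_atTop_zero.1 h1 (δ / 2) (ENNReal.half_pos hδ.ne')
  refine ⟨N, fun n hn => le_trans ?_ hη⟩
  have hfst : MeasurePreserving (Prod.fst : E d × E d → E d)
    ((volume : Measure (E d)).prod ν) volume := measurePreserving_fst
  have hm1 : ∀ {h : E d → F}, AEStronglyMeasurable h volume →
      AEStronglyMeasurable (fun p : E d × E d => h p.1) ((volume : Measure (E d)).prod ν) :=
    fun hh => hh.comp_measurePreserving hfst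
  have hd := hf.sub hgm
  have m1 := (memLp_comp_shrink (ν := ν) (ε := ε n) (by linarith [hε n]) hd)
  have m2 := (memLp_comp_shrink (ν := ν) (ε := ε n) (by linarith [hε n]) hgm)
  have e : (fun p : E d × E d => f (shrink (ε n) p) - f p.1) =
      ((fun p => (f - g) (shrink (ε n) p)) + fun p => g (shrink (ε n) p) - g p.1) -
        fun p => (f - g) p.1 := by
    ext p; simp
  rw [e]
  refine (eLpNorm_sub_le (m1.1.add (m2.1.sub (hm1 hgm.1))) (hm1 hd.1) (by norm_num)).trans ?_
  refine add_le_add ((eLpNorm_add_le m1.1 (m2.1.sub (hm1 hgm.1)) (by norm_num)).trans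
    (add_le_add ?_ (hN n hn))) ?_
  · exact (eLpNorm_comp_shrink_le (hε n) hd.1).trans (by gcongr)
  · have := eLpNorm_map_measure (p := 2) (f := (Prod.fst : E d × E d → E d))
      (μ := (volume : Measure (E d)).prod ν) (g := f - g) (by rw [hfst.map_eq]; exact hd.1)
      hfst.aemeasurable
    rw [hfst.map_eq] at this
    rw [show (fun p : E d × E d => (f - g) p.1) = (f - g) ∘ Prod.fst from rfl, ← this]
    exact hg

theorem tendsto_average_shrink {R : ℝ} (hν : ∀ᵐ z ∂ν, ‖z‖ ≤ R) [NormedSpace ℝ F] [CompleteSpace F]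
    (hf : MemLp f 2 volume) {ε : ℕ → ℝ} (hε0 : ∀ n, 0 ≤ ε n) (hε : ∀ n, ε n ≤ 1 / 2)
    (hεl : Tendsto ε atTop (𝓝 0)) :
    Tendsto (fun n => eLpNorm (fun x => (∫ z, f (shrink (ε n) (x, z)) ∂ν) - f x) 2 volume)
      atTop (𝓝 0) := by
  refine tendsto_of_tendsto_of_tendsto_of_le_of_le tendsto_const_nhds
    (tendsto_comp_shrink hν hf hε0 hε hεl) (fun _ => bot_le) fun n => ?_
  have m1 := memLp_comp_shrink (ν := ν) (ε := ε n) (by linarith [hε n]) hf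
  have m2 : AEStronglyMeasurable (fun p : E d × E d => f p.1) ((volume : Measure (E d)).prod ν) :=
    hf.1.comp_measurePreserving measurePreserving_fst
  refine le_trans (le_of_eq (eLpNorm_congr_ae ?_)) (eLpNorm_integral_le_prod (m1.1.sub m2))
  filter_upwards [ae_integrable_of_memLp_prod m1] with x hx
  rw [integral_sub hx (integrable_const _)]
  simp

end Shrink
-- Mollification by averages towards an interior point
/-- The measure whose density is a smooth bump function around `x₀`. -/
def bumpMeasure {x₀ : E d} (b : ContDiffBump x₀) : Measure (E d) :=
  volume.withDensity fun z => ENNReal.ofReal (b.normed volume z)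

theorem integral_bumpMeasure {F : Type*} [NormedAddCommGroup F] [NormedSpace ℝ F] {x₀ : E d}
    (b : ContDiffBump x₀) (f : E d → F) :
    ∫ z, f z ∂(bumpMeasure b) = ∫ z, b.normed volume z • f z := by
  rw [bumpMeasure, integral_withDensity_eq_integral_toReal_smul
    (b.continuous_normed.measurable.ennreal_ofReal) (.of_forall fun _ => ENNReal.ofReal_lt_top)]
  simp [ENNReal.toReal_ofReal, b.nonneg_normed]

instance {x₀ : E d} (b : ContDiffBump x₀) : IsProbabilityMeasure (bumpMeasure b) := by
  refine ⟨?_⟩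
  rw [bumpMeasure, withDensity_apply _ .univ, Measure.restrict_univ,
    ← ofReal_integral_eq_lintegral_ofReal b.integrable_normed (.of_forall b.nonneg_normed),
    b.integral_normed, ENNReal.ofReal_one]

theorem ae_bumpMeasure_mem_ball {x₀ : E d} (b : ContDiffBump x₀) :
    ∀ᵐ z ∂(bumpMeasure b), z ∈ Metric.ball x₀ b.rOut := by
  rw [bumpMeasure, ae_withDensity_iff (b.continuous_normed.measurable.ennreal_ofReal)]
  refine .of_forall fun z hz => ?_
  rw [← b.support_normed_eq (μ := volume)]
  intro h
  simp [h] at hz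

/-- The density of `ε z`, reflected, for `z` distributed according to the bump function `b`. -/
def smoothingKernel {x₀ : E d} (b : ContDiffBump x₀) (ε : ℝ) (y : E d) : ℝ :=
  (ε ^ d)⁻¹ * b.normed volume (-(ε⁻¹ • y))

/-- The average of `f` over the points `(1 - ε) x + ε z` of `U`, with `z` near `x₀`. -/
def smoothing (U : Set (E d)) {x₀ : E d} (b : ContDiffBump x₀) (ε : ℝ) (f : E d → ℝ) (x : E d) :
    ℝ := convolution (U.indicator f) (smoothingKernel b ε)
      (ContinuousLinearMap.mul ℝ ℝ) volume ((1 - ε) • x)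

section Smoothing

variable {U : Set (E d)} {x₀ : E d} (b : ContDiffBump x₀) {ε : ℝ}

theorem normed_eq_zero_of_notMem_closedBall {z : E d} (hz : z ∉ Metric.closedBall x₀ b.rOut) :
    b.normed volume z = 0 := by
  have h1 : z ∉ Function.support (b.normed volume) := by
    rw [b.support_normed_eq]
    exact fun h => hz (Metric.ball_subset_closedBall h)
  exact Function.notMem_support.1 h1

theorem contDiff_smoothingKernel : ContDiff ℝ ∞ (smoothingKernel b ε) :=
  contDiff_const.mul (b.contDiff_normed.comp (contDiff_id.const_smul _).neg)

theorem hasCompactSupport_smoothingKernel (hε : 0 < ε) :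
    HasCompactSupport (smoothingKernel b ε) := by
  have h1 := (b.hasCompactSupport_normed (μ := volume)).comp_homeomorph
    ((Homeomorph.smulOfNeZero ε⁻¹ (inv_ne_zero hε.ne')).trans (Homeomorph.neg (E d)))
  exact h1.mul_left

/-- Substitute `t = (1 - ε)x + εz`. The reflection in the kernel undoes the sign of `t` in the
convolution, and its factor `ε ^ (-d)` is the Jacobian. -/
theorem integral_smoothingKernel {F : Type*} [NormedAddCommGroup F] [NormedSpace ℝ F]
    (hε : 0 < ε) (f : E d → F) (x : E d) :
    ∫ t, smoothingKernel b ε ((1 - ε) • x - t) • f t =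
      ∫ z, f (shrink ε (x, z)) ∂(bumpMeasure b) := by
  rw [integral_bumpMeasure]
  have h1 := integral_add_right_eq_self (μ := (volume : Measure (E d)))
    (fun t => smoothingKernel b ε ((1 - ε) • x - t) • f t) ((1 - ε) • x)
  rw [← h1]
  have h2 := Measure.integral_comp_smul (volume : Measure (E d))
    (fun t => smoothingKernel b ε ((1 - ε) • x - (t + (1 - ε) • x)) • f (t + (1 - ε) • x)) ε
  rw [finrank_euclideanSpace_fin, abs_of_pos (by positivity)] at h2
  have h3 : ∀ t : E d, -(ε⁻¹ • ((1 - ε) • x - (ε • t + (1 - ε) • x))) = t := by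
    intro t
    rw [sub_add_cancel_right, smul_neg, neg_neg, smul_smul, inv_mul_cancel₀ hε.ne', one_smul]
  simp only [smoothingKernel, h3] at h2 ⊢
  simp only [mul_smul, integral_smul] at h2 ⊢
  have h4 : (ε ^ d)⁻¹ ≠ 0 := by positivity
  have h5 := smul_right_injective F h4 h2
  rw [← h5]
  simp only [shrink, add_comm]

theorem smoothing_eq (hε : 0 < ε) (f : E d → ℝ) (x : E d) :
    smoothing U b ε f x = ∫ z, U.indicator f (shrink ε (x, z)) ∂(bumpMeasure b) := by
  rw [← integral_smoothingKernel b hε, smoothing, convolution]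
  simp [mul_comm]

theorem contDiff_smoothing (hε : 0 < ε) {f : E d → ℝ}
    (hf : LocallyIntegrable (U.indicator f) volume) :
    ContDiff ℝ ∞ (smoothing U b ε f) := by
  have := (hasCompactSupport_smoothingKernel b hε).contDiff_convolution_right
    (ContinuousLinearMap.mul ℝ ℝ) (n := ⊤) hf (contDiff_smoothingKernel b)
  exact this.comp (contDiff_id.const_smul _)

/-- The support lies in `(1 - ε)x + ε B` with a closed ball `B ⊆ U`, hence in `U` by convexity. So
the kernel is an admissible test function on `U` for every `x ∈ U`, however close to the boundary.
-/
theorem tsupport_smoothingKernel_subset (hc : Convex ℝ U) (hε : 0 < ε) (hε1 : ε < 1)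
    (hb : Metric.closedBall x₀ b.rOut ⊆ U) {x : E d} (hx : x ∈ U) :
    tsupport (fun t => smoothingKernel b ε ((1 - ε) • x - t)) ⊆ U := by
  have h1 : tsupport (fun t => smoothingKernel b ε ((1 - ε) • x - t)) ⊆
      (fun t => -(ε⁻¹ • ((1 - ε) • x - t))) ⁻¹' Metric.closedBall x₀ b.rOut := by
    refine closure_minimal (fun t ht => ?_) (Metric.isClosed_closedBall.preimage (by fun_prop))
    by_contra h0
    refine ht ?_
    change (ε ^ d)⁻¹ * b.normed volume (-(ε⁻¹ • ((1 - ε) • x - t))) = 0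
    rw [normed_eq_zero_of_notMem_closedBall b h0, mul_zero]
  intro t ht
  have h2 := hc hx (hb (h1 ht)) (by linarith : (0:ℝ) ≤ 1 - ε) hε.le (by ring)
  have h3 : (1 - ε) • x + ε • -(ε⁻¹ • ((1 - ε) • x - t)) = t := by
    rw [smul_neg, smul_smul, mul_inv_cancel₀ hε.ne', one_smul]
    abel
  rwa [h3] at h2

/-- The derivative falls on the kernel, which is a test function in `t`, and the definition of the
weak gradient moves it to `G`. The factor `1 - ε` is the derivative of the inner dilation. -/
theorem gradient_smoothing (hU : IsOpen U) (hc : Convex ℝ U) (hε : 0 < ε) (hε1 : ε < 1)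
    (hb : Metric.closedBall x₀ b.rOut ⊆ U) {v : E d → ℝ} {G : E d → E d} (h : IsWeakGrad U v G)
    (hv : LocallyIntegrable (U.indicator v) volume) {x : E d} (hx : x ∈ U) :
    gradient (smoothing U b ε v) x =
      (1 - ε) • ∫ z, U.indicator G (shrink ε (x, z)) ∂(bumpMeasure b) := by
  set k := smoothingKernel b ε with hk
  have hkd : ContDiff ℝ ∞ k := contDiff_smoothingKernel b
  have hkc : HasCompactSupport k := hasCompactSupport_smoothingKernel b hε
  set y := (1 - ε) • x with hy
  set ψ : E d → ℝ := fun t => k (y - t) with hψ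
  have hψd : ContDiff ℝ ∞ ψ := hkd.comp (contDiff_const.sub contDiff_id)
  have hψc : HasCompactSupport ψ := hkc.comp_homeomorph (Homeomorph.subLeft y)
  have hψU : tsupport ψ ⊆ U := tsupport_smoothingKernel_subset b hc hε hε1 hb hx
  have hweak := h.2.2 ψ hψd hψc hψU
  have hgrad : ∀ t w, inner ℝ w (gradient ψ t) = - fderiv ℝ k (y - t) w := by
    intro t w
    rw [inner_gradient_right]
    have h1 : HasFDerivAt ψ ((fderiv ℝ k (y - t)).comp (-ContinuousLinearMap.id ℝ (E d))) t :=
      ((hkd.differentiable (by simp) (y - t)).hasFDerivAt).comp t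
        ((hasFDerivAt_id t).const_sub y)
    rw [h1.fderiv]
    simp
  have hconv := hkc.hasFDerivAt_convolution_right (ContinuousLinearMap.mul ℝ ℝ) hv
    (hkd.of_le (by simp)) y
  have hs : HasFDerivAt (smoothing U b ε v) ((convolution (U.indicator v) (fderiv ℝ k)
      ((ContinuousLinearMap.mul ℝ ℝ).precompR (E d)) volume y).comp
      ((1 - ε) • ContinuousLinearMap.id ℝ (E d))) x :=
    hconv.comp x ((hasFDerivAt_id x).const_smul (1 - ε))
  refine ext_inner_left ℝ fun w => ?_
  rw [inner_gradient_right, hs.fderiv, inner_smul_right]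
  simp only [ContinuousLinearMap.comp_apply, smul_apply,
    ContinuousLinearMap.id_apply, map_smul, smul_eq_mul]
  congr 1
  rw [← integral_smoothingKernel b hε, ← hy, ← hk]
  have hint : Integrable (fun t => ((ContinuousLinearMap.mul ℝ ℝ).precompR (E d))
      (U.indicator v t) (fderiv ℝ k (y - t))) :=
    (hkc.fderiv ℝ).convolutionExists_right _ hv (hkd.continuous_fderiv (by simp)) y
  rw [convolution, ContinuousLinearMap.integral_apply hint]
  have e1 : ∀ t, (((ContinuousLinearMap.mul ℝ ℝ).precompR (E d))
      (U.indicator v t) (fderiv ℝ k (y - t))) w = - U.indicator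
        (fun t => inner ℝ w (v t • gradient ψ t)) t := by
    intro t
    rw [ContinuousLinearMap.precompR_apply]
    by_cases ht : t ∈ U
    · simp only [Set.indicator_of_mem ht, inner_smul_right, hgrad]
      simp
    · simp [Set.indicator_of_notMem ht]
  simp only [e1]
  have e2 : ∀ t, k (y - t) • U.indicator G t = U.indicator (fun t => ψ t • G t) t := by
    intro t
    by_cases ht : t ∈ U
    · simp [Set.indicator_of_mem ht, hψ]
    · simp [Set.indicator_of_notMem ht]
  simp only [e2]
  rw [integral_neg, integral_indicator hU.measurableSet, integral_indicator hU.measurableSet,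
    integral_inner (integrableOn_smul_gradient hU h.1 hψd hψc hψU), hweak, inner_neg_right, neg_neg]

end Smoothing

/-- Smooth functions on `ℝ^d` are dense in `H¹` of a convex domain. -/
theorem exists_contDiff_tendsto {U : Set (E d)} (hU : IsOpen U) (hc : Convex ℝ U)
    (hne : U.Nonempty) {v : E d → ℝ} (hv : MemH1 U v) :
    ∃ φ : ℕ → E d → ℝ, (∀ n, ContDiff ℝ ∞ (φ n)) ∧
      Tendsto (fun n => eLpNorm (fun x => φ n x - v x) 2 (volume.restrict U)) atTop (𝓝 0) ∧
      Tendsto (fun n => eLpNorm (fun x => gradient (φ n) x - wgrad U v x) 2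
        (volume.restrict U)) atTop (𝓝 0) := by
  obtain ⟨x₀, hx₀⟩ := hne
  obtain ⟨r, hr, hrU⟩ := Metric.nhds_basis_closedBall.mem_iff.1 (hU.mem_nhds hx₀)
  let b : ContDiffBump x₀ := ⟨r / 2, r, by linarith, by linarith⟩
  have hbU : Metric.closedBall x₀ b.rOut ⊆ U := hrU
  let ε : ℕ → ℝ := fun n => 1 / ((n : ℝ) + 2)
  have hε0 : ∀ n, 0 < ε n := fun n => by positivity
  have hε : ∀ n, ε n ≤ 1 / 2 := fun n =>
    one_div_le_one_div_of_le (by norm_num) (by linarith [n.cast_nonneg (α := ℝ)])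
  have hεl : Tendsto ε atTop (𝓝 0) := by
    have := (tendsto_add_atTop_iff_nat (f := fun n : ℕ => 1 / (n : ℝ)) 2).2
      tendsto_one_div_atTop_nhds_zero_nat
    simpa [ε] using this
  have hν : ∀ᵐ z ∂(bumpMeasure b), ‖z‖ ≤ ‖x₀‖ + r := by
    filter_upwards [ae_bumpMeasure_mem_ball b] with z hz
    have h1 : dist z x₀ < r := hz
    rw [dist_eq_norm] at h1
    have := norm_le_norm_add_norm_sub x₀ z
    rw [norm_sub_rev] at this
    linarith
  have hv2 : MemLp (U.indicator v) 2 volume := (memLp_indicator_iff_restrict hU.measurableSet).2 hv.1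
  have hG2 : MemLp (U.indicator (wgrad U v)) 2 volume :=
    (memLp_indicator_iff_restrict hU.measurableSet).2 (hv.memLp_wgrad hU)
  have hvl : LocallyIntegrable (U.indicator v) volume := hv2.locallyIntegrable (by norm_num)
  refine ⟨fun n => smoothing U b (ε n) v, fun n => contDiff_smoothing b (hε0 n) hvl, ?_, ?_⟩
  · have h1 := tendsto_average_shrink hν hv2 (fun n => (hε0 n).le) hε hεl
    refine tendsto_of_tendsto_of_tendsto_of_le_of_le tendsto_const_nhds h1 (fun _ => bot_le)
      fun n => ?_
    refine le_trans (le_of_eq (eLpNorm_congr_ae ?_)) (eLpNorm_restrict_le _ _ _ U)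
    filter_upwards [ae_restrict_mem hU.measurableSet] with x hx
    rw [smoothing_eq b (hε0 n), Set.indicator_of_mem hx]
  · have h1 := tendsto_average_shrink hν hG2 (fun n => (hε0 n).le) hε hεl
    have h2 : Tendsto (fun n => ENNReal.ofReal (ε n) *
        eLpNorm (U.indicator (wgrad U v)) 2 volume) atTop (𝓝 0) := by
      have := ENNReal.Tendsto.mul_const ((ENNReal.continuous_ofReal.tendsto _).comp hεl)
        (Or.inr hG2.2.ne)
      simpa using this
    have h3 := h1.add h2
    rw [add_zero] at h3
    refine tendsto_of_tendsto_of_tendsto_of_le_of_le tendsto_const_nhds h3 (fun _ => bot_le)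
      fun n => ?_
    set A : E d → E d := fun x => ∫ z, U.indicator (wgrad U v) (shrink (ε n) (x, z)) ∂(bumpMeasure b)
    have hAm : AEStronglyMeasurable A volume :=
      (memLp_comp_shrink (ν := bumpMeasure b) (by linarith [hε n]) hG2).1.integral_prod_right'
    -- On `U` the gradient error is `(1 - ε)(A - ∇v) - ε∇v`, where `A` is the average of `∇v`; both
    -- parts tend to zero.
    calc _ ≤ eLpNorm ((1 - ε n) • (fun x => A x - U.indicator (wgrad U v) x) -
          ε n • U.indicator (wgrad U v)) 2 volume := by
          refine le_trans (le_of_eq (eLpNorm_congr_ae ?_)) (eLpNorm_restrict_le _ _ _ U)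
          filter_upwards [ae_restrict_mem hU.measurableSet] with x hx
          rw [gradient_smoothing b hU hc (hε0 n) (by linarith [hε n]) hbU hv.isWeakGrad hvl hx]
          simp only [Pi.sub_apply, Pi.smul_apply, Set.indicator_of_mem hx, A]
          module
      _ ≤ eLpNorm ((1 - ε n) • (fun x => A x - U.indicator (wgrad U v) x)) 2 volume +
          eLpNorm (ε n • U.indicator (wgrad U v)) 2 volume :=
          eLpNorm_sub_le ((hAm.sub hG2.1).const_smul _) (hG2.1.const_smul _) (by norm_num)
      _ ≤ _ := by
          refine add_le_add ?_ (le_of_eq ?_)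
          · rw [eLpNorm_const_smul]
            refine mul_le_of_le_one_left bot_le ?_
            rw [Real.enorm_eq_ofReal (by linarith [hε n])]
            exact ENNReal.ofReal_le_one.2 (by linarith [hε0 n])
          · rw [eLpNorm_const_smul, Real.enorm_eq_ofReal (hε0 n).le]

/-! ### The Poincaré inequality on convex domains -/

/-- The case of the Dirac measure at `z` in `map_shrink`. -/
theorem lintegral_comp_shrink_le {ε : ℝ} (hε : ε ≤ 1 / 2) (z : E d) {h : E d → ENNReal}
    (hh : Measurable h) :
    ∫⁻ x, h (shrink ε (x, z)) ≤ ENNReal.ofReal (2 ^ d) * ∫⁻ x, h x := by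
  have h1 := lintegral_map (μ := (volume : Measure (E d)).prod (Measure.dirac z)) hh
    (continuous_shrink ε).measurable
  have hm : Measurable fun p : E d × E d => h (shrink ε p) := hh.comp (continuous_shrink ε).measurable
  rw [map_shrink (by linarith), lintegral_prod_symm _ hm.aemeasurable,
    lintegral_dirac' z (hm.lintegral_prod_left'), lintegral_smul_measure] at h1
  rw [← h1, smul_eq_mul]
  gcongr
  rw [← inv_pow]
  have h2 : (1 - ε)⁻¹ ≤ 2 := by
    rw [inv_le_comm₀ (by linarith) (by norm_num)]
    linarith
  have : 0 ≤ (1 - ε)⁻¹ := inv_nonneg.2 (by linarith)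
  gcongr

theorem lintegral_rotate {α β γ : Type*} [MeasurableSpace α] [MeasurableSpace β]
    [MeasurableSpace γ] {μ : Measure α} {ν : Measure β} {τ : Measure γ} [SFinite μ] [SFinite ν]
    [SFinite τ] {g : α → β → γ → ENNReal}
    (hg : Measurable fun p : α × β × γ => g p.1 p.2.1 p.2.2) :
    ∫⁻ x, ∫⁻ z, ∫⁻ t, g x z t ∂τ ∂ν ∂μ = ∫⁻ t, ∫⁻ x, ∫⁻ z, g x z t ∂ν ∂μ ∂τ := by
  have s1 : ∀ x, ∫⁻ z, ∫⁻ t, g x z t ∂τ ∂ν = ∫⁻ t, ∫⁻ z, g x z t ∂ν ∂τ := fun x =>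
    lintegral_lintegral_swap (hg.comp measurable_prodMk_left).aemeasurable
  simp only [s1]
  refine lintegral_lintegral_swap (Measurable.aemeasurable ?_)
  have h1 : Measurable fun q : (α × γ) × β => g q.1.1 q.2 q.1.2 :=
    hg.comp ((measurable_fst.comp measurable_fst).prodMk
      (measurable_snd.prodMk (measurable_snd.comp measurable_fst)))
  exact h1.lintegral_prod_right'

theorem lintegral_rotate_const_mul {α β γ : Type*} [MeasurableSpace α] [MeasurableSpace β]
    [MeasurableSpace γ] {μ : Measure α} {ν : Measure β} {τ : Measure γ} [SFinite μ] [SFinite ν]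
    [SFinite τ] {g : α → β → γ → ENNReal}
    (hg : Measurable fun p : α × β × γ => g p.1 p.2.1 p.2.2) (c : ENNReal) :
    ∫⁻ x, ∫⁻ z, c * ∫⁻ t, g x z t ∂τ ∂ν ∂μ = c * ∫⁻ t, ∫⁻ x, ∫⁻ z, g x z t ∂ν ∂μ ∂τ := by
  have h1 : Measurable fun q : (α × β) × γ => g q.1.1 q.1.2 q.2 :=
    hg.comp MeasurableEquiv.prodAssoc.measurable
  have h2 : Measurable fun q : α × β => ∫⁻ t, g q.1 q.2 t ∂τ := h1.lintegral_prod_right'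
  have h3 : ∀ x, Measurable fun z => ∫⁻ t, g x z t ∂τ := fun x => h2.comp measurable_prodMk_left
  rw [← lintegral_rotate hg, ← lintegral_const_mul _ h2.lintegral_prod_right']
  simp only [lintegral_const_mul _ (h3 _)]

theorem enorm_integral_sq_le {α F : Type*} [MeasurableSpace α] [NormedAddCommGroup F]
    [NormedSpace ℝ F] {ν : Measure α} [IsProbabilityMeasure ν] {f : α → F}
    (hf : AEStronglyMeasurable f ν) :
    ‖∫ x, f x ∂ν‖ₑ ^ 2 ≤ ∫⁻ x, ‖f x‖ₑ ^ 2 ∂ν := by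
  have h1 : eLpNorm f 1 ν ≤ eLpNorm f 2 ν := eLpNorm_le_eLpNorm_of_exponent_le (by norm_num) hf
  rw [eLpNorm_one_eq_lintegral_enorm,
    eLpNorm_eq_lintegral_rpow_enorm_toReal (p := 2) (by norm_num) (by norm_num)] at h1
  have h3 := ENNReal.rpow_le_rpow ((enorm_integral_le_lintegral_enorm f).trans h1)
    (z := (2 : ENNReal).toReal) (by norm_num)
  rw [← ENNReal.rpow_mul, one_div, inv_mul_cancel₀ (by norm_num), ENNReal.rpow_one] at h3
  simpa using h3

/-- The fundamental theorem of calculus along the segment from `x` to `z`, then Jensen on the unit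
interval and Cauchy-Schwarz. -/
theorem enorm_sub_sq_le_lintegral {φ : E d → ℝ} (hφ : ContDiff ℝ ∞ φ) (x z : E d) :
    ‖φ z - φ x‖ₑ ^ 2 ≤ ‖z - x‖ₑ ^ 2 *
      ∫⁻ t in Set.Ioc (0 : ℝ) 1, ‖gradient φ (shrink t (x, z))‖ₑ ^ 2 := by
  have hder : ∀ t : ℝ, HasDerivAt (fun t => φ (shrink t (x, z)))
      (inner ℝ (gradient φ (shrink t (x, z))) (z - x)) t := by
    intro t
    have h1 : HasDerivAt (fun t : ℝ => shrink t (x, z)) (z - x) t := by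
      have : (fun t : ℝ => shrink t (x, z)) = fun t => x + t • (z - x) := by
        ext1 t; simp only [shrink]; module
      rw [this]
      simpa using ((hasDerivAt_id t).smul_const (z - x)).const_add x
    have h2 := ((hφ.differentiable (by simp) (shrink t (x, z))).hasFDerivAt).comp_hasDerivAt t h1
    rw [inner_gradient_left]
    exact h2
  have hcont : Continuous fun t : ℝ => gradient φ (shrink t (x, z)) :=
    (continuous_gradient hφ).comp (by unfold shrink; fun_prop)
  have hcont' : Continuous fun t : ℝ => inner ℝ (gradient φ (shrink t (x, z))) (z - x) :=
    hcont.inner continuous_const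
  have hftc := intervalIntegral.integral_eq_sub_of_hasDerivAt (a := 0) (b := 1)
    (fun t _ => hder t) (hcont'.intervalIntegrable _ _)
  have : IsProbabilityMeasure ((volume : Measure ℝ).restrict (Set.Ioc 0 1)) := ⟨by simp⟩
  rw [intervalIntegral.integral_of_le zero_le_one] at hftc
  have e : φ z - φ x = ∫ t in Set.Ioc (0 : ℝ) 1, inner ℝ (gradient φ (shrink t (x, z))) (z - x) := by
    rw [hftc]; simp [shrink]
  rw [e, ← lintegral_const_mul _ (hcont.enorm.measurable.pow_const _)]
  refine (enorm_integral_sq_le hcont'.aestronglyMeasurable).trans (lintegral_mono fun t => ?_)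
  rw [← mul_pow, mul_comm]
  gcongr
  simp only [enorm_eq_nnnorm]
  exact_mod_cast nnnorm_inner_le_nnnorm (𝕜 := ℝ) (gradient φ (shrink t (x, z))) (z - x)

/-- The point `(1 - t)x + tz` stays in `U` by convexity. For `t ≤ 1/2` it is used as a new variable
in place of `x`, for `t ≥ 1/2` in place of `z`; either way the Jacobian costs at most `2 ^ d`. -/
theorem lintegral_lintegral_enorm_sub_sq_le {U : Set (E d)} (hU : IsOpen U) (hc : Convex ℝ U)
    {D : NNReal} (hD : ∀ x ∈ U, ∀ z ∈ U, ‖z - x‖ₑ ≤ D) {φ : E d → ℝ} (hφ : ContDiff ℝ ∞ φ) :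
    ∫⁻ x in U, ∫⁻ z in U, ‖φ z - φ x‖ₑ ^ 2 ≤
      D ^ 2 * (volume U * (ENNReal.ofReal (2 ^ d) * ∫⁻ x in U, ‖gradient φ x‖ₑ ^ 2)) := by
  obtain ⟨h, hh⟩ : ∃ h : E d → ENNReal, h = U.indicator fun x => ‖gradient φ x‖ₑ ^ 2 := ⟨_, rfl⟩
  have hhm : Measurable h :=
    hh ▸ ((continuous_gradient hφ).enorm.measurable.pow_const _).indicator hU.measurableSet
  have hint : ∫⁻ x, h x = ∫⁻ x in U, ‖gradient φ x‖ₑ ^ 2 :=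
    hh ▸ lintegral_indicator hU.measurableSet _
  have hjm : Measurable fun p : ℝ × E d × E d => shrink p.1 p.2 := by
    have : Continuous fun p : ℝ × E d × E d => shrink p.1 p.2 := by unfold shrink; fun_prop
    exact this.measurable
  have hsym : ∀ (t : ℝ) (x z : E d), shrink t (x, z) = shrink (1 - t) (z, x) := by
    intro t x z
    simp [shrink, add_comm]
  calc _ ≤ ∫⁻ x in U, ∫⁻ z in U, D ^ 2 * ∫⁻ t in Set.Ioc (0 : ℝ) 1, h (shrink t (x, z)) := by
        refine setLIntegral_mono' hU.measurableSet fun x hx =>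
          setLIntegral_mono' hU.measurableSet fun z hz => ?_
        refine (enorm_sub_sq_le_lintegral hφ x z).trans ?_
        gcongr ?_ ^ 2 * ?_
        · exact hD x hx z hz
        · refine setLIntegral_mono' measurableSet_Ioc fun t ht => ?_
          rw [hh, Set.indicator_of_mem]
          exact hc hx hz (by linarith [ht.2]) ht.1.le (by ring)
    _ = D ^ 2 * ∫⁻ t in Set.Ioc (0 : ℝ) 1, ∫⁻ x in U, ∫⁻ z in U, h (shrink t (x, z)) := by
        have hm3 : Measurable fun p : E d × E d × ℝ => h (shrink p.2.2 (p.1, p.2.1)) :=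
          hhm.comp (hjm.comp ((measurable_snd.comp measurable_snd).prodMk
            (measurable_fst.prodMk (measurable_fst.comp measurable_snd))))
        exact lintegral_rotate_const_mul (g := fun x z t => h (shrink t (x, z))) hm3 _
    _ ≤ D ^ 2 * ∫⁻ t in Set.Ioc (0 : ℝ) 1,
          (volume U * (ENNReal.ofReal (2 ^ d) * ∫⁻ x in U, ‖gradient φ x‖ₑ ^ 2)) := by
        gcongr with t
        rw [← hint]
        have hm2 : Measurable fun p : E d × E d => h (shrink t p) :=
          hhm.comp (continuous_shrink t).measurable
        rcases le_total t (1 / 2) with ht | ht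
        · rw [lintegral_lintegral_swap hm2.aemeasurable]
          calc _ ≤ ∫⁻ z in U, (ENNReal.ofReal (2 ^ d) * ∫⁻ x, h x) := by
                refine lintegral_mono fun z => ?_
                exact (setLIntegral_le_lintegral _ _).trans (lintegral_comp_shrink_le ht z hhm)
            _ = _ := by rw [setLIntegral_const, mul_comm]
        · calc _ ≤ ∫⁻ x in U, (ENNReal.ofReal (2 ^ d) * ∫⁻ x, h x) := by
                refine lintegral_mono fun x => ?_
                simp only [hsym t x]
                exact (setLIntegral_le_lintegral _ _).trans
                  (lintegral_comp_shrink_le (by linarith) x hhm)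
            _ = _ := by rw [setLIntegral_const, mul_comm]
    _ = _ := by simp

/-- For smooth `φ` the deviation from the mean is the average over `z` of `φ x - φ z`, so the double
integral of squared differences controls it. Density of smooth functions and continuity of the mean
extend the bound to `H¹`. -/
theorem exists_poincare {U : Set (E d)} (hU : IsOpen U) (hc : Convex ℝ U)
    (hb : Bornology.IsBounded U) (hne : U.Nonempty) :
    ∃ K : NNReal, ∀ v, MemH1 U v →
      eLpNorm (fun x => v x - mean U v) 2 (volume.restrict U) ≤
        K * eLpNorm (wgrad U v) 2 (volume.restrict U) := by
  have hfin := isFiniteMeasure_restrict_of_isBounded hb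
  have hpos : 0 < volume U := hU.measure_pos volume hne
  have htop : volume U ≠ ⊤ := hb.measure_lt_top.ne
  obtain ⟨D, hD⟩ : ∃ D : NNReal, ∀ x ∈ U, ∀ z ∈ U, ‖z - x‖ₑ ≤ D := by
    obtain ⟨C, hC⟩ := Metric.isBounded_iff.1 hb
    refine ⟨C.toNNReal, fun x hx z hz => ?_⟩
    rw [← ofReal_norm, ← dist_eq_norm]
    exact ENNReal.ofReal_le_ofReal (hC hz hx)
  set K0 : ENNReal := D ^ 2 * ENNReal.ofReal (2 ^ d)
  have hK0 : K0 ≠ ⊤ := by finiteness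
  set K : NNReal := (K0 ^ (1 / 2 : ℝ)).toNNReal
  have hK : (K : ENNReal) = K0 ^ (1 / 2 : ℝ) := ENNReal.coe_toNNReal (by finiteness)
  set ν : Measure (E d) := (volume U)⁻¹ • volume.restrict U
  have hν : IsProbabilityMeasure ν := ⟨by simp [ν, ENNReal.inv_mul_cancel hpos.ne' htop]⟩
  have hmean : ∀ φ : E d → ℝ, ∫ z, φ z ∂ν = mean U φ := by
    intro φ
    simp [ν, mean, Measure.real]
  have smooth : ∀ φ, ContDiff ℝ ∞ φ →
      eLpNorm (fun x => φ x - mean U φ) 2 (volume.restrict U) ≤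
        K * eLpNorm (gradient φ) 2 (volume.restrict U) := by
    intro φ hφ
    have hcont : Continuous fun p : E d × E d => φ p.2 - φ p.1 :=
      (hφ.continuous.comp continuous_snd).sub (hφ.continuous.comp continuous_fst)
    have hφi : Integrable φ ν :=
      (memLp_one_iff_integrable.1 (memLp_restrict_of_continuous hb hφ.continuous)).smul_measure
        (by simp [hpos.ne'])
    have h1 := eLpNorm_integral_le_prod (μ := volume.restrict U) (ν := ν)
      (f := fun p : E d × E d => φ p.2 - φ p.1) hcont.aestronglyMeasurable
    have e1 : (fun x => ∫ z, (φ z - φ x) ∂ν) = - fun x => φ x - mean U φ := by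
      ext x
      rw [integral_sub hφi (integrable_const _), hmean]
      simp
    rw [e1, eLpNorm_neg] at h1
    refine h1.trans ?_
    rw [eLpNorm_eq_lintegral_rpow_enorm_toReal (by norm_num) (by norm_num),
      eLpNorm_eq_lintegral_rpow_enorm_toReal (by norm_num) (by norm_num), hK,
      ENNReal.toReal_ofNat, ← ENNReal.mul_rpow_of_nonneg _ _ (by norm_num)]
    refine ENNReal.rpow_le_rpow ?_ (by norm_num)
    simp only [ENNReal.rpow_ofNat]
    rw [lintegral_prod _ (hcont.enorm.measurable.pow_const _).aemeasurable]
    simp only [ν, lintegral_smul_measure, smul_eq_mul]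
    rw [lintegral_const_mul' _ _ (by simp [hpos.ne'])]
    calc _ ≤ (volume U)⁻¹ * (D ^ 2 * (volume U * (ENNReal.ofReal (2 ^ d) *
          ∫⁻ x in U, ‖gradient φ x‖ₑ ^ 2))) := by
          gcongr
          exact lintegral_lintegral_enorm_sub_sq_le hU hc hD hφ
      _ = ((volume U)⁻¹ * volume U) * (K0 * ∫⁻ x in U, ‖gradient φ x‖ₑ ^ 2) := by
          simp only [K0]; ring
      _ = _ := by rw [ENNReal.inv_mul_cancel hpos.ne' htop, one_mul]
  refine ⟨K, fun v hv => ?_⟩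
  obtain ⟨φ, hφ, h1, h2⟩ := exists_contDiff_tendsto hU hc hne hv
  have hφm : ∀ n, MemLp (φ n) 2 (volume.restrict U) :=
    fun n => memLp_restrict_of_continuous hb (hφ n).continuous
  have hgm : ∀ n, MemLp (gradient (φ n)) 2 (volume.restrict U) :=
    fun n => memLp_restrict_of_continuous hb (continuous_gradient (hφ n))
  have hmeanl : Tendsto (fun n => mean U (φ n)) atTop (𝓝 (mean U v)) := by
    have h3 := tendsto_integral_mul_of_eLpNorm hφm (fun _ => memLp_const (1 : ℝ)) hv.1
      (memLp_const (1 : ℝ)) h1 (by simp)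
    simp only [mul_one] at h3
    exact h3.const_mul _
  have hsub : Tendsto (fun n => eLpNorm (fun x => (φ n x - mean U (φ n)) - (v x - mean U v)) 2
      (volume.restrict U)) atTop (𝓝 0) := by
    have h4 : Tendsto (fun n => eLpNorm (fun _ : E d => mean U (φ n) - mean U v) 2
        (volume.restrict U)) atTop (𝓝 0) := by
      simp only [eLpNorm_const' _ (two_ne_zero) ENNReal.ofNat_ne_top]
      have h5 : Tendsto (fun n => ‖mean U (φ n) - mean U v‖ₑ) atTop (𝓝 0) := by
        have := (continuous_enorm.tendsto _).comp (hmeanl.sub_const (mean U v))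
        simpa [Function.comp_def] using this
      have := ENNReal.Tendsto.mul_const (b := (volume.restrict U Set.univ) ^
        (1 / (2 : ENNReal).toReal)) h5 (Or.inr (by finiteness))
      simpa using this
    have h6 := h1.add h4
    rw [add_zero] at h6
    refine tendsto_of_tendsto_of_tendsto_of_le_of_le tendsto_const_nhds h6 (fun _ => bot_le)
      fun n => ?_
    refine le_trans (le_of_eq ?_) (eLpNorm_sub_le ((hφm n).1.sub hv.1.1)
      aestronglyMeasurable_const (by norm_num))
    congr 1
    ext x
    simp only [Pi.sub_apply]
    ring
  have l1 := tendsto_eLpNorm_of_sub (fun n => (hφm n).sub (memLp_const (mean U (φ n))))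
    (hv.1.sub (memLp_const (mean U v))) hsub
  have l2 := tendsto_eLpNorm_of_sub hgm (hv.memLp_wgrad hU) h2
  exact le_of_tendsto_of_tendsto' l1 (ENNReal.Tendsto.const_mul l2 (Or.inr ENNReal.coe_ne_top))
    fun n => smooth _ (hφ n)

/-! ### Polytopes as intersections of half-spaces -/

section Polytope

variable {U : Set (E d)}

theorem IsOpenPolytope.isOpen (h : IsOpenPolytope U) : IsOpen U := by
  obtain ⟨_, s, rfl⟩ := h
  exact isOpen_interior

theorem IsOpenPolytope.convex (h : IsOpenPolytope U) : Convex ℝ U := by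
  obtain ⟨_, s, rfl⟩ := h
  exact (convex_convexHull ℝ _).interior

theorem IsOpenPolytope.isBounded (h : IsOpenPolytope U) : Bornology.IsBounded U := by
  obtain ⟨_, s, rfl⟩ := h
  exact (isBounded_convexHull.2 s.finite_toSet.isBounded).subset interior_subset

theorem IsOpenPolytope.closure_subset {s : Finset (E d)} :
    closure (interior (convexHull ℝ (s : Set (E d)))) ⊆ convexHull ℝ (s : Set (E d)) :=
  closure_minimal interior_subset (s.finite_toSet.isCompact_convexHull ℝ).isClosed

theorem exists_unit_support (hU : IsOpen U) (hc : Convex ℝ U) (hne : U.Nonempty) {z : E d}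
    (hz : z ∉ U) : ∃ n : E d, ‖n‖ = 1 ∧ ∀ a ∈ U, inner ℝ n a < inner ℝ n z := by
  obtain ⟨f, hf⟩ := geometric_hahn_banach_open_point hc hU hz
  set m := (InnerProductSpace.toDual ℝ (E d)).symm f
  have hm : ∀ a, inner ℝ m a = f a := fun a => InnerProductSpace.toDual_symm_apply
  have hm0 : m ≠ 0 := by
    intro h0
    obtain ⟨a, ha⟩ := hne
    have := hf a ha
    rw [← hm, ← hm, h0] at this
    simp at this
  refine ⟨‖m‖⁻¹ • m, norm_smul_inv_norm hm0, fun a ha => ?_⟩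
  rw [real_inner_smul_left, real_inner_smul_left, hm, hm]
  exact mul_lt_mul_of_pos_left (hf a ha) (inv_pos.2 (norm_pos_iff.2 hm0))

/-- An open polytope is a finite intersection of open half-spaces. -/
theorem IsOpenPolytope.exists_halfspaces (h : IsOpenPolytope U) :
    ∃ H : Finset (E d × ℝ), (∀ p ∈ H, ‖p.1‖ = 1) ∧ U = {x | ∀ p ∈ H, inner ℝ p.1 x < p.2} := by
  classical
  have hUo := h.isOpen
  have hUc := h.convex
  obtain ⟨hne, s, hs⟩ := h
  -- A polytope may have infinitely many supporting hyperplanes. One is selected for each subset `t`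
  -- of the vertices that is contained in some supporting hyperplane, so only finitely many are
  -- kept.
  let P : Finset (E d) → E d × ℝ → Prop := fun t p =>
    ‖p.1‖ = 1 ∧ (∀ a ∈ U, inner ℝ p.1 a < p.2) ∧ ∀ y ∈ t, inner ℝ p.1 y = p.2
  let c : Finset (E d) → E d × ℝ := fun t => if ht : ∃ p, P t p then ht.choose else 0
  have hcP : ∀ t, (∃ p, P t p) → P t (c t) := by
    intro t ht
    simp only [c, dif_pos ht]
    exact ht.choose_spec
  have key : ∀ z ∈ closure U, z ∉ U → ∃ t ∈ s.powerset, (∃ p, P t p) ∧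
      inner ℝ (c t).1 z = (c t).2 := by
    intro z hz hzU
    obtain ⟨n, hn, hnU⟩ := exists_unit_support hUo hUc hne hzU
    have hle : ∀ a ∈ closure U, inner ℝ n a ≤ inner ℝ n z := fun a ha =>
      closure_minimal (t := {a | inner ℝ n a ≤ inner ℝ n z}) (fun a ha => (hnU a ha).le)
        (isClosed_le (continuous_const.inner continuous_id) continuous_const) ha
    have hsU : ∀ y ∈ s, y ∈ closure U := by
      intro y hy
      rw [hs, (convex_convexHull ℝ _).closure_interior_eq_closure_of_nonempty_interior (hs ▸ hne)]
      exact subset_closure (subset_convexHull ℝ _ hy)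
    have hzs : z ∈ convexHull ℝ (s : Set (E d)) := IsOpenPolytope.closure_subset (hs ▸ hz)
    rw [Finset.mem_convexHull'] at hzs
    obtain ⟨w, hw0, hw1, hwz⟩ := hzs
    -- A linear function that attains its maximum over the polytope at `z` takes the same value at
    -- every vertex with nonzero weight in `z`. Thus these vertices share a supporting hyperplane,
    -- and whichever one was selected for them contains `z` too.
    set t := s.filter fun y => w y ≠ 0 with ht
    have hsum : ∑ y ∈ s, w y * (inner ℝ n z - inner ℝ n y) = 0 := by
      have : inner ℝ n z = ∑ y ∈ s, w y * inner ℝ n y := by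
        rw [← hwz, inner_sum]
        exact Finset.sum_congr rfl fun y _ => real_inner_smul_right _ _ _
      simp only [mul_sub, Finset.sum_sub_distrib, ← Finset.sum_mul, hw1, one_mul]
      rw [← this, sub_self]
    have hzero := (Finset.sum_eq_zero_iff_of_nonneg fun y hy =>
      mul_nonneg (hw0 y hy) (sub_nonneg.2 (hle y (hsU y hy)))).1 hsum
    have hex : ∃ p, P t p := by
      refine ⟨(n, inner ℝ n z), hn, hnU, fun y hy => ?_⟩
      rw [ht, Finset.mem_filter] at hy
      rcases mul_eq_zero.1 (hzero y hy.1) with h0 | h0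
      · exact absurd h0 hy.2
      · exact (sub_eq_zero.1 h0).symm
    refine ⟨t, Finset.mem_powerset.2 (Finset.filter_subset _ _), hex, ?_⟩
    have hP := hcP t hex
    rw [← hwz, inner_sum]
    calc _ = ∑ y ∈ s, w y * (c t).2 := by
          refine Finset.sum_congr rfl fun y hy => ?_
          rw [real_inner_smul_right]
          by_cases h0 : w y = 0
          · simp [h0]
          · rw [hP.2.2 y (Finset.mem_filter.2 ⟨hy, h0⟩)]
      _ = _ := by rw [← Finset.sum_mul, hw1, one_mul]
  refine ⟨(s.powerset.filter fun t => ∃ p, P t p).image c, ?_, ?_⟩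
  · intro p hp
    obtain ⟨t, ht, rfl⟩ := Finset.mem_image.1 hp
    exact (hcP t (Finset.mem_filter.1 ht).2).1
  · ext x
    constructor
    · intro hx p hp
      obtain ⟨t, ht, rfl⟩ := Finset.mem_image.1 hp
      exact (hcP t (Finset.mem_filter.1 ht).2).2.1 x hx
    · intro hx
      by_contra hxU
      obtain ⟨x₀, hx₀⟩ := hne
      -- By connectedness, a segment from a point of `U` to a point outside contains a boundary
      -- point `z`. The hyperplane selected for `z` passes through `z`, although both ends of the
      -- segment lie strictly on one side of it.
      obtain ⟨z, hz, hzf⟩ : ∃ z ∈ segment ℝ x₀ x, z ∈ closure U ∧ z ∉ U := by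
        by_contra! hno
        obtain ⟨y, _, hyU, hyc⟩ := (convex_segment x₀ x).isPreconnected U (closure U)ᶜ hUo
          isClosed_closure.isOpen_compl
          (fun y hy => (Classical.em (y ∈ closure U)).imp (hno y hy) id)
          ⟨x₀, left_mem_segment ℝ _ _, hx₀⟩
          ⟨x, right_mem_segment ℝ _ _, fun h => hxU (hno x (right_mem_segment ℝ _ _) h)⟩
        exact hyc (subset_closure hyU)
      obtain ⟨t, ht, hex, hzt⟩ := key z hzf.1 hzf.2
      have hP := hcP t hex
      have hconv : Convex ℝ {y : E d | inner ℝ (c t).1 y < (c t).2} :=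
        convex_halfSpace_lt (IsLinearMap.mk (fun _ _ => inner_add_right _ _ _)
          (fun _ _ => real_inner_smul_right _ _ _)) _
      have := hconv.segment_subset (hP.2.1 x₀ hx₀)
        (hx (c t) (Finset.mem_image_of_mem c (Finset.mem_filter.2 ⟨ht, hex⟩))) hz
      exact absurd hzt this.ne

variable {H : Finset (E d × ℝ)}

theorem closure_eq_of_halfspaces (hne : U.Nonempty)
    (hU : U = {x | ∀ p ∈ H, inner ℝ p.1 x < p.2}) :
    closure U = {x | ∀ p ∈ H, inner ℝ p.1 x ≤ p.2} := by
  refine Set.Subset.antisymm (closure_minimal ?_ ?_) ?_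
  · intro x hx p hp
    rw [hU] at hx
    exact (hx p hp).le
  · simp only [Set.ofPred_forall]
    exact isClosed_biInter fun p _ =>
      isClosed_le (continuous_const.inner continuous_id) continuous_const
  · intro x hx
    obtain ⟨x₀, hx₀⟩ := hne
    have hx₀' : ∀ p ∈ H, inner ℝ p.1 x₀ < p.2 := by rwa [hU] at hx₀
    have hl : Tendsto (fun t : ℝ => x + t • (x₀ - x)) (𝓝[>] 0) (𝓝 x) := by
      have : Continuous fun t : ℝ => x + t • (x₀ - x) := by fun_prop
      have h2 := this.tendsto 0
      simp only [zero_smul, add_zero] at h2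
      exact h2.mono_left nhdsWithin_le_nhds
    refine mem_closure_of_tendsto hl ?_
    have hmem : Set.Ioo (0 : ℝ) 1 ∈ 𝓝[>] (0 : ℝ) := Ioo_mem_nhdsGT one_pos
    filter_upwards [hmem] with t ht
    rw [hU]
    intro p hp
    rw [inner_add_right, real_inner_smul_right, inner_sub_right]
    nlinarith [hx p hp, hx₀' p hp, ht.1, ht.2]

theorem frontier_eq_of_halfspaces (hUo : IsOpen U) (hne : U.Nonempty)
    (hU : U = {x | ∀ p ∈ H, inner ℝ p.1 x < p.2}) :
    frontier U = ⋃ p ∈ H, {x ∈ closure U | inner ℝ p.1 x = p.2} := by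
  ext x
  rw [hUo.frontier_eq]
  simp only [Set.mem_sdiff, Set.mem_iUnion, Set.mem_ofPred_eq, exists_prop]
  constructor
  · rintro ⟨h1, h2⟩
    rw [hU] at h2
    simp only [Set.mem_ofPred_eq, not_forall, not_lt] at h2
    obtain ⟨p, hp, h3⟩ := h2
    have h4 := h1
    rw [closure_eq_of_halfspaces hne hU] at h4
    exact ⟨p, hp, h1, le_antisymm (h4 p hp) h3⟩
  · rintro ⟨p, hp, h1, h2⟩
    refine ⟨h1, fun h3 => ?_⟩
    rw [hU] at h3
    exact absurd h2 (h3 p hp).ne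

end Polytope

/-! ### The surface measure on hyperplanes -/

theorem volume_level_eq_zero {F : Type*} [NormedAddCommGroup F] [InnerProductSpace ℝ F]
    [FiniteDimensional ℝ F] [MeasurableSpace F] [BorelSpace F] {ℓ : F →ₗ[ℝ] ℝ} (hℓ : ℓ ≠ 0)
    (a : ℝ) : volume {y | ℓ y = a} = 0 := by
  by_cases hne : ∃ y₀, ℓ y₀ = a
  · obtain ⟨y₀, rfl⟩ := hne
    have e : {y | ℓ y = ℓ y₀} = (fun y => y + (-y₀)) ⁻¹' (LinearMap.ker ℓ : Set F) := by
      ext y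
      simp [← sub_eq_add_neg, sub_eq_zero]
    rw [e, measure_preimage_add_right]
    refine Measure.addHaar_submodule _ _ fun h => hℓ (LinearMap.ker_eq_top.1 h)
  · push Not at hne
    simp [hne]

section Hyperplane

variable {n m : E d}

theorem finrank_orthogonal_span_of_norm (hn : ‖n‖ = 1) :
    Module.finrank ℝ (Submodule.span ℝ {n})ᗮ = d - 1 := by
  have hn0 : n ≠ 0 := by rintro rfl; simp at hn
  have := (Submodule.span ℝ {n}).finrank_add_finrank_orthogonal
  rw [finrank_span_singleton hn0, finrank_euclideanSpace_fin] at this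
  omega

/-- The parametrisation is an isometry, isometries transport the normalised Hausdorff measure, and
on a Euclidean space of its own dimension that measure is the volume. -/
theorem map_hyperplane (hn : ‖n‖ = 1) (c : ℝ) :
    Measure.map (fun y : (Submodule.span ℝ {n})ᗮ => c • n + (y : E d)) volume =
      (μHE[d - 1] : Measure (E d)).restrict {x | inner ℝ n x = c} := by
  have hiso : Isometry (fun y : (Submodule.span ℝ {n})ᗮ => c • n + (y : E d)) :=
    (isometry_add_left (c • n)).comp isometry_subtype_coe
  have h1 := hiso.map_euclideanHausdorffMeasure (d := d - 1)
  rw [← finrank_orthogonal_span_of_norm hn,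
    InnerProductSpace.euclideanHausdorffMeasure_eq_volume] at h1
  rw [h1, finrank_orthogonal_span_of_norm hn]
  congr 1
  ext x
  simp only [Set.mem_range, Set.mem_ofPred_eq, Subtype.exists]
  constructor
  · rintro ⟨y, hy, rfl⟩
    rw [Submodule.mem_orthogonal_singleton_iff_inner_right] at hy
    rw [inner_add_right, real_inner_smul_right, real_inner_self_eq_norm_sq, hn, hy]
    simp
  · intro hx
    refine ⟨x - c • n, ?_, by simp⟩
    rw [Submodule.mem_orthogonal_singleton_iff_inner_right, inner_sub_right, hx,
      real_inner_smul_right, real_inner_self_eq_norm_sq, hn]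
    simp

/-- Orthogonal splitting of the space, with the sign of the normal coordinate reversed so that it
measures the depth below the hyperplane. -/
theorem measurePreserving_hyperplane (hn : ‖n‖ = 1) (c : ℝ) :
    MeasurePreserving (fun q : (Submodule.span ℝ {n})ᗮ × ℝ => c • n + (q.1 : E d) - q.2 • n)
      volume volume := by
  have h1 := ((Submodule.span ℝ {n}).measurePreserving_measurableEquivProd (c • n)).symm
  have e : (μHE[Module.finrank ℝ (E d)] : Measure (E d)) = volume :=
    InnerProductSpace.euclideanHausdorffMeasure_eq_volume
  rw [e] at h1
  have h2 : MeasurePreserving (LinearIsometryEquiv.toSpanUnitSingleton (𝕜 := ℝ) n hn) volume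
      volume := LinearIsometryEquiv.measurePreserving _
  have h3 := (Measure.measurePreserving_neg (volume : Measure ℝ))
  have h4 : MeasurePreserving (Prod.map (fun t : ℝ => LinearIsometryEquiv.toSpanUnitSingleton
      (𝕜 := ℝ) n hn (-t)) (id : (Submodule.span ℝ {n})ᗮ → _)) (volume.prod volume)
      (volume.prod volume) := (h2.comp h3).prod (MeasurePreserving.id _)
  have h5 := h1.comp (h4.comp (Measure.measurePreserving_swap (μ := volume)
    (ν := (volume : Measure ℝ))))
  convert! h5 using 1
  ext1 q
  simp
  abel

/-- Inside the first hyperplane the second equation is a level set of a linear functional, which is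
null unless the functional vanishes. In that case `m = ± n`, and since `h1` and `h2` exclude both
descriptions of the same hyperplane, the intersection is empty. -/
theorem euclideanHausdorffMeasure_inter_hyperplane (hn : ‖n‖ = 1) (hm : ‖m‖ = 1) {c c' : ℝ}
    (h1 : ¬ (m = n ∧ c' = c)) (h2 : ¬ (m = -n ∧ c' = -c)) :
    (μHE[d - 1] : Measure (E d)) ({x | inner ℝ n x = c} ∩ {x | inner ℝ m x = c'}) = 0 := by
  have hcl : ∀ (n : E d) (c : ℝ), MeasurableSet {x : E d | inner ℝ n x = c} := fun n c =>
    (isClosed_eq (continuous_const.inner continuous_id) continuous_const).measurableSet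
  rw [Set.inter_comm, ← Measure.restrict_apply (hcl m c'), ← map_hyperplane hn,
    Measure.map_apply (by fun_prop) (hcl m c')]
  set K := (Submodule.span ℝ {n})ᗮ
  let ℓ : K →ₗ[ℝ] ℝ := (innerₗ (E d) m).comp K.subtype
  have hℓ : ∀ y : K, ℓ y = inner ℝ m (y : E d) := fun y => rfl
  have e : ((fun y : K => c • n + (y : E d)) ⁻¹' {x | inner ℝ m x = c'}) =
      {y | ℓ y = c' - c * inner ℝ m n} := by
    ext y
    simp only [Set.mem_preimage, Set.mem_ofPred_eq, hℓ, inner_add_right, real_inner_smul_right]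
    constructor <;> intro h <;> linarith
  rw [e]
  by_cases hℓ0 : ℓ = 0
  · have hmn : m ∈ Kᗮ := by
      intro y hy
      have := LinearMap.congr_fun hℓ0 ⟨y, hy⟩
      rw [real_inner_comm]
      exact this
    rw [Submodule.orthogonal_orthogonal, Submodule.mem_span_singleton] at hmn
    obtain ⟨a, rfl⟩ := hmn
    have ha : |a| = 1 := by simpa [norm_smul, hn] using hm
    have hemp : {y : K | ℓ y = c' - c * inner ℝ (a • n) n} = ∅ := by
      rw [Set.eq_empty_iff_forall_notMem]
      intro y hy
      have hy' : ℓ y = c' - c * inner ℝ (a • n) n := hy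
      rw [hℓ0, real_inner_smul_left, real_inner_self_eq_norm_sq, hn, LinearMap.zero_apply] at hy'
      rcases eq_or_eq_neg_of_abs_eq ha with rfl | rfl
      · exact h1 ⟨by simp, by linarith⟩
      · exact h2 ⟨by simp, by linarith⟩
    rw [hemp, measure_empty]
  · exact volume_level_eq_zero hℓ0 _

theorem euclideanHausdorffMeasure_lt_top_of_subset (hn : ‖n‖ = 1) {c : ℝ} {s : Set (E d)}
    (hs : s ⊆ {x | inner ℝ n x = c}) (hb : Bornology.IsBounded s) :
    (μHE[d - 1] : Measure (E d)) s < ⊤ := by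
  refine (measure_mono subset_closure).trans_lt ?_
  have hcl : IsClosed {x : E d | inner ℝ n x = c} :=
    isClosed_eq (continuous_const.inner continuous_id) continuous_const
  have e : closure s = closure s ∩ {x | inner ℝ n x = c} :=
    (Set.inter_eq_left.2 (closure_minimal hs hcl)).symm
  rw [e, ← Measure.restrict_apply isClosed_closure.measurableSet, ← map_hyperplane hn,
    Measure.map_apply (by fun_prop) isClosed_closure.measurableSet]
  have hiso : Isometry (fun y : (Submodule.span ℝ {n})ᗮ => c • n + (y : E d)) :=
    (isometry_add_left (c • n)).comp isometry_subtype_coe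
  exact (hiso.antilipschitz.isBounded_preimage hb.closure).measure_lt_top

end Hyperplane

theorem IsOpenPolytope.isFiniteMeasure_surf {U : Set (E d)} (h : IsOpenPolytope U) :
    IsFiniteMeasure (surf U) := by
  obtain ⟨H, hH, hU⟩ := h.exists_halfspaces
  refine ⟨?_⟩
  rw [surf, Measure.restrict_apply_univ, frontier_eq_of_halfspaces h.isOpen h.1 hU]
  refine (measure_biUnion_finset_le H _).trans_lt (ENNReal.sum_lt_top.2 fun p hp => ?_)
  exact euclideanHausdorffMeasure_lt_top_of_subset (hH p hp) (fun x hx => hx.2)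
    (h.isBounded.closure.subset fun x hx => hx.1)

/-! ### The divergence theorem on polytopes -/

theorem continuous_deriv_smoothTransition : Continuous (deriv Real.smoothTransition) :=
  (Real.smoothTransition.contDiff (n := 1)).continuous_deriv le_rfl

theorem hasDerivAt_smoothTransition (t : ℝ) :
    HasDerivAt Real.smoothTransition (deriv Real.smoothTransition t) t :=
  ((Real.smoothTransition.contDiff (n := 1)).differentiable (by norm_num) t).hasDerivAt

theorem deriv_smoothTransition_of_notMem {t : ℝ} (ht : t ∉ Set.Icc (0 : ℝ) 1) :
    deriv Real.smoothTransition t = 0 := by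
  rw [Set.mem_Icc, not_and_or, not_le, not_le] at ht
  rcases ht with ht | ht
  · have : Real.smoothTransition =ᶠ[𝓝 t] fun _ => 0 := by
      filter_upwards [Iio_mem_nhds ht] with s hs using Real.smoothTransition.zero_of_nonpos hs.le
    rw [this.deriv_eq, deriv_const]
  · have : Real.smoothTransition =ᶠ[𝓝 t] fun _ => 1 := by
      filter_upwards [Ioi_mem_nhds ht] with s hs using Real.smoothTransition.one_of_one_le hs.le
    rw [this.deriv_eq, deriv_const]

/-- The profile across a thin slab has total mass one, so in the limit each face enters with its
surface measure exactly. -/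
theorem integral_deriv_smoothTransition : ∫ t, deriv Real.smoothTransition t = 1 := by
  rw [← setIntegral_eq_integral_of_forall_compl_eq_zero
    (s := Set.Icc (0 : ℝ) 1) fun t ht => deriv_smoothTransition_of_notMem ht,
    integral_Icc_eq_integral_Ioc, ← intervalIntegral.integral_of_le zero_le_one,
    intervalIntegral.integral_eq_sub_of_hasDerivAt (fun t _ => hasDerivAt_smoothTransition t)
      (continuous_deriv_smoothTransition.intervalIntegrable _ _)]
  simp

theorem exists_bound_deriv_smoothTransition : ∃ C, ∀ t, |deriv Real.smoothTransition t| ≤ C := by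
  obtain ⟨C, hC⟩ := isCompact_Icc.exists_bound_of_continuousOn (s := Set.Icc (0 : ℝ) 1)
    continuous_deriv_smoothTransition.continuousOn
  refine ⟨max C 0, fun t => ?_⟩
  by_cases ht : t ∈ Set.Icc (0 : ℝ) 1
  · exact (hC t ht).trans (le_max_left _ _)
  · simp [deriv_smoothTransition_of_notMem ht]

/-- The distance of `x` to the boundary hyperplane of the half-space `⟨p.1, x⟩ < p.2`. -/
def slack (p : E d × ℝ) (x : E d) : ℝ := p.2 - inner ℝ p.1 x

theorem contDiff_slack (p : E d × ℝ) : ContDiff ℝ ∞ (slack p) :=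
  contDiff_const.sub (contDiff_const.inner ℝ contDiff_id)

theorem continuous_slack (p : E d × ℝ) : Continuous (slack p) := (contDiff_slack p).continuous

/-- The hyperplane through the origin orthogonal to `n`. -/
abbrev orthHyperplane (n : E d) : Submodule ℝ (E d) := (Submodule.span ℝ {n})ᗮ

/-- The point at depth `ε t` below the point `y` of the hyperplane `⟨n, x⟩ = c`. -/
def slabMap (n : E d) (c ε : ℝ) (q : orthHyperplane n × ℝ) : E d :=
  c • n + (q.1 : E d) - (ε * q.2) • n

theorem continuous_slabMap (n : E d) (c ε : ℝ) : Continuous (slabMap n c ε) := by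
  unfold slabMap
  fun_prop

theorem tendsto_slabMap (n : E d) (c : ℝ) {ε : ℕ → ℝ} (hε : Tendsto ε atTop (𝓝 0))
    (q : orthHyperplane n × ℝ) :
    Tendsto (fun k => slabMap n c (ε k) q) atTop (𝓝 (c • n + (q.1 : E d))) := by
  have h1 : Continuous fun e : ℝ => slabMap n c e q := by unfold slabMap; fun_prop
  have h2 := (h1.tendsto 0).comp hε
  simpa [slabMap, Function.comp_def] using h2

theorem slack_slabMap {n : E d} (hn : ‖n‖ = 1) (c ε : ℝ) (q : orthHyperplane n × ℝ) :
    slack (n, c) (slabMap n c ε q) = ε * q.2 := by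
  have h1 : inner ℝ n (q.1 : E d) = 0 :=
    Submodule.mem_orthogonal_singleton_iff_inner_right.1 q.1.2
  simp only [slack, slabMap, inner_sub_right, inner_add_right, real_inner_smul_right,
    real_inner_self_eq_norm_sq, hn, h1]
  ring

theorem norm_le_of_slabMap {n : E d} (hn : ‖n‖ = 1) {c ε R : ℝ} (hε0 : 0 ≤ ε) (hε1 : ε ≤ 1)
    {q : orthHyperplane n × ℝ} (hR : ‖slabMap n c ε q‖ ≤ R) (hq : q.2 ∈ Set.Icc (0 : ℝ) 1) :
    ‖q.1‖ ≤ R + |c| + 1 := by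
  have h2 : (q.1 : E d) = slabMap n c ε q - c • n + (ε * q.2) • n := by
    simp only [slabMap]; abel
  rw [← Submodule.norm_coe, h2]
  refine (norm_add_le _ _).trans (add_le_add ((norm_sub_le _ _).trans (add_le_add hR ?_)) ?_)
  · rw [norm_smul, hn, mul_one, Real.norm_eq_abs]
  · rw [norm_smul, hn, mul_one, Real.norm_eq_abs, abs_of_nonneg (mul_nonneg hε0 hq.1)]
    exact mul_le_one₀ hε1 hq.1 hq.2

theorem map_slabMap {n : E d} (hn : ‖n‖ = 1) (c : ℝ) {ε : ℝ} (hε : 0 < ε) :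
    Measure.map (slabMap n c ε) volume = ENNReal.ofReal ε⁻¹ • volume := by
  have h1 := measurePreserving_hyperplane hn c
  have h2 : Measure.map (Prod.map id (ε * ·)) (volume : Measure (orthHyperplane n × ℝ)) =
      ENNReal.ofReal ε⁻¹ • volume := by
    rw [Measure.volume_eq_prod, ← Measure.map_prod_map _ _ measurable_id (measurable_const_mul ε),
      Measure.map_id, Real.map_volume_mul_left hε.ne', abs_of_pos (inv_pos.2 hε),
      Measure.prod_smul_right]
  have h3 := Measure.map_map (μ := (volume : Measure (orthHyperplane n × ℝ))) h1.measurable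
    (measurable_id.prodMap (measurable_const_mul ε))
  rw [h2, Measure.map_smul, h1.map_eq] at h3
  rw [h3]
  rfl

theorem integral_slabMap {n : E d} (hn : ‖n‖ = 1) (c : ℝ) {ε : ℝ} (hε : 0 < ε) {g : E d → ℝ}
    (hg : Continuous g) : ε⁻¹ * ∫ x, g x = ∫ q, g (slabMap n c ε q) := by
  rw [← integral_map (continuous_slabMap n c ε).aemeasurable hg.aestronglyMeasurable,
    map_slabMap hn c hε, integral_smul_measure, ENNReal.toReal_ofReal (inv_pos.2 hε).le,
    smul_eq_mul]

/-- A factor with integral one in the depth variable is inserted, so that the face integral has the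
form of the limit of rescaled slab integrals. -/
theorem setIntegral_hyperplane {n : E d} (hn : ‖n‖ = 1) (c : ℝ) {A : Set (E d)} (hA : IsClosed A)
    {ψ : E d → ℝ} (hψ : Continuous ψ) :
    ∫ x in {x ∈ A | inner ℝ n x = c}, ψ x ∂(μHE[d - 1] : Measure (E d)) =
      ∫ q : orthHyperplane n × ℝ, A.indicator ψ (c • n + (q.1 : E d)) *
        deriv Real.smoothTransition q.2 := by
  have hc : Continuous fun y : orthHyperplane n => c • n + (y : E d) := by fun_prop
  rw [Measure.volume_eq_prod,
    integral_prod_mul (f := fun y : orthHyperplane n => A.indicator ψ (c • n + (y : E d)))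
    (g := deriv Real.smoothTransition), integral_deriv_smoothTransition, mul_one]
  have e : {x ∈ A | inner ℝ n x = c} = A ∩ {x | inner ℝ n x = c} := rfl
  rw [e, ← Measure.restrict_restrict hA.measurableSet, ← map_hyperplane hn,
    ← integral_indicator hA.measurableSet, integral_map hc.aemeasurable
      (hψ.stronglyMeasurable.indicator hA.measurableSet).aestronglyMeasurable]

/-! ### Cutoff functions whose derivatives concentrate on the faces -/

section Face

variable {U : Set (E d)} {H : Finset (E d × ℝ)}

/-- A smooth version of the derivative of the cutoff function in the direction of a face. -/
def faceDensity (H : Finset (E d × ℝ)) (p : E d × ℝ) (ε : ℝ) (x : E d) : ℝ :=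
  open Classical in
  deriv Real.smoothTransition (slack p x / ε) *
    ∏ q ∈ H.erase p, Real.smoothTransition (slack q x / ε)

theorem continuous_faceDensity (p : E d × ℝ) (ε : ℝ) : Continuous (faceDensity H p ε) := by
  unfold faceDensity
  refine (continuous_deriv_smoothTransition.comp ((continuous_slack p).div_const ε)).mul
    (continuous_finsetProd _ fun q _ =>
      Real.smoothTransition.continuous.comp ((continuous_slack q).div_const ε))

theorem faceDensity_eq_zero (hne : U.Nonempty) (hU : U = {x | ∀ p ∈ H, inner ℝ p.1 x < p.2})
    (p : E d × ℝ) {ε : ℝ} (hε : 0 < ε) {x : E d} (hx : x ∉ closure U) :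
    faceDensity H p ε x = 0 := by
  classical
  rw [closure_eq_of_halfspaces hne hU] at hx
  simp only [Set.mem_ofPred_eq, not_forall, not_le] at hx
  obtain ⟨q, hq, hx⟩ := hx
  have hneg : slack q x / ε < 0 := div_neg_of_neg_of_pos (by unfold slack; linarith) hε
  unfold faceDensity
  by_cases hqp : q = p
  · subst hqp
    rw [deriv_smoothTransition_of_notMem (fun h => by linarith [h.1]), zero_mul]
  · rw [Finset.prod_eq_zero (Finset.mem_erase.2 ⟨hqp, hq⟩)
      (Real.smoothTransition.zero_of_nonpos hneg.le), mul_zero]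

theorem abs_prod_smoothTransition_le (s : Finset (E d × ℝ)) (f : E d × ℝ → ℝ) :
    |∏ q ∈ s, Real.smoothTransition (f q)| ≤ 1 := by
  rw [Finset.abs_prod]
  refine Finset.prod_le_one (fun _ _ => abs_nonneg _) fun q _ => ?_
  rw [abs_of_nonneg (Real.smoothTransition.nonneg _)]
  exact Real.smoothTransition.le_one _

theorem notMem_halfspaces_of_eq (hne : U.Nonempty)
    (hU : U = {x | ∀ p ∈ H, inner ℝ p.1 x < p.2}) {p q : E d × ℝ} (hp : p ∈ H) (hq : q ∈ H) :
    ¬ (q.1 = -p.1 ∧ q.2 = -p.2) := by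
  rintro ⟨h1, h2⟩
  obtain ⟨x, hx⟩ := hne
  rw [hU] at hx
  have e1 := hx p hp
  have e2 := hx q hq
  rw [h1, h2, inner_neg_left] at e2
  linarith

theorem faceDensity_slabMap {n : E d} (hn : ‖n‖ = 1) (c : ℝ) {ε : ℝ} (hε : 0 < ε)
    (q : orthHyperplane n × ℝ) :
    open Classical in
    faceDensity H (n, c) ε (slabMap n c ε q) = deriv Real.smoothTransition q.2 *
      ∏ r ∈ H.erase (n, c), Real.smoothTransition (slack r (slabMap n c ε q) / ε) := by
  rw [faceDensity, slack_slabMap hn, mul_div_cancel_left₀ _ hε.ne']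

theorem abs_faceDensity_slabMap_le {n : E d} (hn : ‖n‖ = 1) (c : ℝ) {ε C' : ℝ} (hε : 0 < ε)
    (hC' : ∀ t, |deriv Real.smoothTransition t| ≤ C') (q : orthHyperplane n × ℝ) :
    |faceDensity H (n, c) ε (slabMap n c ε q)| ≤ C' := by
  have hC0' : 0 ≤ C' := (abs_nonneg _).trans (hC' 0)
  rw [faceDensity_slabMap hn c hε, abs_mul]
  calc _ ≤ C' * 1 := mul_le_mul (hC' _) (abs_prod_smoothTransition_le _ _) (abs_nonneg _) hC0'
    _ = C' := mul_one _

/-- Points of a face that lie on a second bounding hyperplane form a null set. There the cutoff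
factor of the second hyperplane need not tend to `1`. -/
theorem ae_slack_ne_zero (hne : U.Nonempty) (hH : ∀ p ∈ H, ‖p.1‖ = 1)
    (hU : U = {x | ∀ p ∈ H, inner ℝ p.1 x < p.2}) {n : E d} {c : ℝ} (hp : (n, c) ∈ H) :
    ∀ᵐ q : orthHyperplane n × ℝ, ∀ r ∈ H, r ≠ (n, c) → slack r (c • n + (q.1 : E d)) ≠ 0 := by
  have hn : ‖n‖ = 1 := hH (n, c) hp
  have hgood : ∀ᵐ y : orthHyperplane n, ∀ r ∈ H, r ≠ (n, c) →
      slack r (c • n + (y : E d)) ≠ 0 := by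
    refine (Finset.eventually_all H).2 fun r hr => ?_
    by_cases hrn : r = (n, c)
    · exact .of_forall fun y h => absurd hrn h
    have h1 := euclideanHausdorffMeasure_inter_hyperplane hn (hH r hr) (c := c) (c' := r.2)
      (fun h => hrn (Prod.ext h.1 h.2)) (notMem_halfspaces_of_eq hne hU hp hr)
    have hm : MeasurableSet {x : E d | inner ℝ r.1 x = r.2} :=
      (isClosed_eq (continuous_const.inner continuous_id) continuous_const).measurableSet
    rw [Set.inter_comm, ← Measure.restrict_apply hm, ← map_hyperplane hn,
      Measure.map_apply (by fun_prop) hm] at h1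
    rw [ae_iff]
    refine measure_mono_null (fun y hy => ?_) h1
    simp only [hrn, slack, ne_eq, not_not, not_false_eq_true, forall_const,
      Set.mem_ofPred_eq] at hy
    exact (sub_eq_zero.1 hy).symm
  exact Measure.quasiMeasurePreserving_fst.ae hgood

/-- Over a point of the closed polytope the other slacks are positive, so their cutoff factors are
eventually `1`. Over a point outside the closure the density is eventually `0`. -/
theorem tendsto_faceDensity_slabMap (hne : U.Nonempty) (hH : ∀ p ∈ H, ‖p.1‖ = 1)
    (hU : U = {x | ∀ p ∈ H, inner ℝ p.1 x < p.2}) {n : E d} {c : ℝ} (hp : (n, c) ∈ H)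
    {ψ : E d → ℝ} (hψ : Continuous ψ)
    {ε : ℕ → ℝ} (hε0 : ∀ k, 0 < ε k) (hεl : Tendsto ε atTop (𝓝 0)) {q : orthHyperplane n × ℝ}
    (hq : ∀ r ∈ H, r ≠ (n, c) → slack r (c • n + (q.1 : E d)) ≠ 0) :
    Tendsto (fun k => ψ (slabMap n c (ε k) q) * faceDensity H (n, c) (ε k) (slabMap n c (ε k) q))
      atTop (𝓝 ((closure U).indicator ψ (c • n + (q.1 : E d)) *
        deriv Real.smoothTransition q.2)) := by
  classical
  have hn : ‖n‖ = 1 := hH (n, c) hp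
  have hΦl := tendsto_slabMap n c hεl q
  have hsl : ∀ r, Tendsto (fun k => slack r (slabMap n c (ε k) q)) atTop
      (𝓝 (slack r (c • n + (q.1 : E d)))) := fun r => ((continuous_slack r).tendsto _).comp hΦl
  by_cases hA : c • n + (q.1 : E d) ∈ closure U
  · rw [Set.indicator_of_mem hA]
    refine ((hψ.tendsto _).comp hΦl).mul ?_
    simp only [faceDensity_slabMap hn c (hε0 _)]
    have h1 : Tendsto (fun k => ∏ r ∈ H.erase (n, c),
        Real.smoothTransition (slack r (slabMap n c (ε k) q) / ε k)) atTop (𝓝 1) := by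
      rw [show (1 : ℝ) = ∏ r ∈ H.erase (n, c), (1 : ℝ) by simp]
      refine tendsto_finsetProd _ fun r hr => ?_
      obtain ⟨hrn, hrH⟩ := Finset.mem_erase.1 hr
      have hpos : 0 < slack r (c • n + (q.1 : E d)) := by
        refine lt_of_le_of_ne ?_ (hq r hrH hrn).symm
        rw [closure_eq_of_halfspaces hne hU] at hA
        exact sub_nonneg.2 (hA r hrH)
      refine tendsto_const_nhds.congr' ?_
      filter_upwards [(hsl r).eventually (lt_mem_nhds (half_lt_self hpos)),
        hεl.eventually (gt_mem_nhds (half_pos hpos))] with k h2 h3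
      rw [Real.smoothTransition.one_of_one_le]
      rw [le_div_iff₀ (hε0 k)]
      linarith
    simpa using h1.const_mul (deriv Real.smoothTransition q.2)
  · rw [Set.indicator_of_notMem hA, zero_mul]
    refine tendsto_const_nhds.congr' ?_
    filter_upwards [hΦl.eventually (isClosed_closure.isOpen_compl.mem_nhds hA)] with k h2
    rw [faceDensity_eq_zero hne hU _ (hε0 k) h2, mul_zero]

/-- Rescaling the depth by `ε` absorbs the factor `ε⁻¹`. The integrands are then dominated by a
constant on a fixed ball times `[0, 1]`. -/
theorem tendsto_integral_faceDensity (hb : Bornology.IsBounded U) (hne : U.Nonempty)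
    (hH : ∀ p ∈ H, ‖p.1‖ = 1) (hU : U = {x | ∀ p ∈ H, inner ℝ p.1 x < p.2})
    {p : E d × ℝ} (hp : p ∈ H) {ψ : E d → ℝ} (hψ : Continuous ψ)
    {ε : ℕ → ℝ} (hε0 : ∀ k, 0 < ε k) (hε1 : ∀ k, ε k ≤ 1) (hεl : Tendsto ε atTop (𝓝 0)) :
    Tendsto (fun k => (ε k)⁻¹ * ∫ x, ψ x * faceDensity H p (ε k) x) atTop
      (𝓝 (∫ x in {x ∈ closure U | inner ℝ p.1 x = p.2}, ψ x ∂(μHE[d - 1] : Measure (E d)))) := by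
  obtain ⟨n, c⟩ := p
  have hn : ‖n‖ = 1 := hH (n, c) hp
  have hgc : ∀ k, Continuous fun x => ψ x * faceDensity H (n, c) (ε k) x := fun k =>
    hψ.mul (continuous_faceDensity _ _)
  simp only [integral_slabMap hn c (hε0 _) (hgc _)]
  rw [setIntegral_hyperplane hn c isClosed_closure hψ]
  obtain ⟨C, hC⟩ := exists_bound_of_isBounded hb hψ
  obtain ⟨C', hC'⟩ := exists_bound_deriv_smoothTransition
  obtain ⟨R, hR⟩ := hb.closure.subset_closedBall (0 : E d)
  have hC0 : 0 ≤ C := (norm_nonneg _).trans (hC _ (subset_closure hne.some_mem))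
  have hC0' : 0 ≤ C' := (abs_nonneg _).trans (hC' 0)
  refine tendsto_integral_of_dominated_convergence
    ((Metric.closedBall (0 : orthHyperplane n) (R + |c| + 1) ×ˢ
      Set.Icc (0 : ℝ) 1).indicator fun _ => C * C')
    (fun k => ((hgc k).comp (continuous_slabMap n c _)).aestronglyMeasurable) ?_ ?_ ?_
  · refine (integrable_indicator_iff
      (Metric.isClosed_closedBall.measurableSet.prod measurableSet_Icc)).2
      (integrableOn_const ?_)
    exact ((isCompact_closedBall _ _).prod isCompact_Icc).measure_lt_top.ne
  · refine fun k => .of_forall fun q => ?_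
    by_cases hq : slabMap n c (ε k) q ∈ closure U ∧ q.2 ∈ Set.Icc (0 : ℝ) 1
    · rw [Set.indicator_of_mem, norm_mul]
      · exact mul_le_mul (hC _ hq.1) (abs_faceDensity_slabMap_le hn c (hε0 k) hC' q)
          (norm_nonneg _) hC0
      · refine ⟨?_, hq.2⟩
        have h1 : ‖slabMap n c (ε k) q‖ ≤ R := mem_closedBall_zero_iff.1 (hR hq.1)
        exact mem_closedBall_zero_iff.2 (norm_le_of_slabMap hn (hε0 k).le (hε1 k) h1 hq.2)
    · have h0 : faceDensity H (n, c) (ε k) (slabMap n c (ε k) q) = 0 := by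
        rcases not_and_or.1 hq with h | h
        · exact faceDensity_eq_zero hne hU _ (hε0 k) h
        · rw [faceDensity_slabMap hn c (hε0 k), deriv_smoothTransition_of_notMem h, zero_mul]
      rw [h0, mul_zero, norm_zero]
      exact Set.indicator_nonneg (fun _ _ => mul_nonneg hC0 hC0') _
  · filter_upwards [ae_slack_ne_zero hne hH hU hp] with q hq
    exact tendsto_faceDensity_slabMap hne hH hU hp hψ hε0 hεl hq

/-- Multiply by the cutoff `χ k`, which vanishes off `U`, and integrate by parts on the whole space,
where there is no boundary term. The gradient of `χ k` is a sum over the faces of inward normals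
times `faceDensity`, which converges to surface measure, while `χ k` itself tends to `1` on `U`. -/
theorem integral_fderiv_of_halfspaces (hb : Bornology.IsBounded U) (hne : U.Nonempty)
    (hUo : IsOpen U)
    (hH : ∀ p ∈ H, ‖p.1‖ = 1) (hU : U = {x | ∀ p ∈ H, inner ℝ p.1 x < p.2})
    {ψ : E d → ℝ} (hψ : ContDiff ℝ ∞ ψ) (e : E d) :
    ∫ x in U, fderiv ℝ ψ x e = ∑ p ∈ H, inner ℝ p.1 e *
      ∫ x in {x ∈ closure U | inner ℝ p.1 x = p.2}, ψ x ∂(μHE[d - 1] : Measure (E d)) := by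
  classical
  let ε : ℕ → ℝ := fun k => 1 / ((k : ℝ) + 1)
  have hε0 : ∀ k, 0 < ε k := fun k => Nat.one_div_pos_of_nat
  have hε1 : ∀ k, ε k ≤ 1 := fun k => by
    simp only [ε]
    rw [div_le_one (by positivity)]
    linarith [k.cast_nonneg (α := ℝ)]
  have hεl : Tendsto ε atTop (𝓝 0) := tendsto_one_div_add_atTop_nhds_zero_nat
  let χ : ℕ → E d → ℝ := fun k x => ∏ p ∈ H, Real.smoothTransition (slack p x / ε k)
  have hχd : ∀ k, ContDiff ℝ ∞ (χ k) := fun k =>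
    contDiff_prod fun p _ => Real.smoothTransition.contDiff.comp ((contDiff_slack p).div_const _)
  have hχ0 : ∀ k x, x ∉ U → χ k x = 0 := by
    intro k x hx
    rw [hU] at hx
    simp only [Set.mem_ofPred_eq, not_forall, not_lt] at hx
    obtain ⟨p, hp, hx⟩ := hx
    refine Finset.prod_eq_zero hp (Real.smoothTransition.zero_of_nonpos ?_)
    exact div_nonpos_of_nonpos_of_nonneg (by unfold slack; linarith) (hε0 k).le
  have hχc : ∀ k, HasCompactSupport (χ k) := fun k =>
    HasCompactSupport.intro hb.isCompact_closure fun x hx =>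
      hχ0 k x fun h => hx (subset_closure h)
  have hfd : ∀ k x, fderiv ℝ (χ k) x e =
      ∑ p ∈ H, -(inner ℝ p.1 e * ((ε k)⁻¹ * faceDensity H p (ε k) x)) := by
    intro k x
    have h1 : ∀ p ∈ H, HasFDerivAt (fun x => Real.smoothTransition (slack p x / ε k))
        (deriv Real.smoothTransition (slack p x / ε k) • ((ε k)⁻¹ • (-(innerSL ℝ p.1)))) x := by
      intro p _
      have h2 : HasFDerivAt (slack p) (-(innerSL ℝ p.1)) x :=
        (innerSL ℝ p.1).hasFDerivAt.const_sub p.2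
      have h3 : HasFDerivAt (fun x => slack p x / ε k) ((ε k)⁻¹ • (-(innerSL ℝ p.1))) x := by
        simpa only [div_eq_inv_mul, smul_eq_mul] using h2.const_mul (ε k)⁻¹
      exact (hasDerivAt_smoothTransition _).comp_hasFDerivAt x h3
    have h4 := HasFDerivAt.finsetProd h1
    rw [h4.fderiv, sum_apply]
    refine Finset.sum_congr rfl fun p _ => ?_
    simp only [smul_apply, neg_apply, innerSL_apply_apply, smul_eq_mul, faceDensity]
    ring
  have hint : ∀ k p, p ∈ H → Integrable fun x => ψ x * faceDensity H p (ε k) x := by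
    intro k p _
    refine (hψ.continuous.mul (continuous_faceDensity p (ε k))).integrable_of_hasCompactSupport
      (HasCompactSupport.intro hb.isCompact_closure fun x hx => ?_)
    rw [Pi.mul_apply, faceDensity_eq_zero hne hU p (hε0 k) hx, mul_zero]
  have hfc : Continuous fun x => fderiv ℝ ψ x e :=
    (hψ.continuous_fderiv (by simp)).clm_apply continuous_const
  have hk : ∀ k, ∫ x in U, χ k x * fderiv ℝ ψ x e = ∑ p ∈ H, inner ℝ p.1 e *
      ((ε k)⁻¹ * ∫ x, ψ x * faceDensity H p (ε k) x) := by
    intro k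
    rw [setIntegral_eq_integral_of_forall_compl_eq_zero fun x hx => by rw [hχ0 k x hx, zero_mul],
      integral_mul_fderiv_eq_neg_fderiv_mul_of_integrable]
    · simp only [hfd, Finset.sum_mul]
      rw [integral_finsetSum, ← Finset.sum_neg_distrib]
      · refine Finset.sum_congr rfl fun p hp => ?_
        rw [← integral_neg, ← integral_const_mul, ← integral_const_mul]
        exact integral_congr_ae (.of_forall fun x => by ring)
      · intro p hp
        refine ((hint k p hp).const_mul (-(inner ℝ p.1 e * (ε k)⁻¹))).congr
          (.of_forall fun x => by ring)
    · exact ((((hχd k).continuous_fderiv (by simp)).clm_apply continuous_const).mul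
        hψ.continuous).integrable_of_hasCompactSupport
        (((hχc k).fderiv_apply (𝕜 := ℝ) e).mul_right)
    · exact ((hχd k).continuous.mul hfc).integrable_of_hasCompactSupport (hχc k).mul_right
    · exact ((hχd k).continuous.mul hψ.continuous).integrable_of_hasCompactSupport
        (hχc k).mul_right
    · exact fun x _ => (hχd k).differentiable (by simp) x
    · exact fun x _ => hψ.differentiable (by simp) x
  have hl1 : Tendsto (fun k => ∫ x in U, χ k x * fderiv ℝ ψ x e) atTop
      (𝓝 (∫ x in U, fderiv ℝ ψ x e)) := by
    have hfin := isFiniteMeasure_restrict_of_isBounded hb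
    have hi : Integrable (fun x => fderiv ℝ ψ x e) (volume.restrict U) :=
      memLp_one_iff_integrable.1 (memLp_restrict_of_continuous hb hfc)
    refine tendsto_integral_of_dominated_convergence (fun x => ‖fderiv ℝ ψ x e‖)
      (fun k => ((hχd k).continuous.mul hfc).aestronglyMeasurable) hi.norm ?_ ?_
    · refine fun k => .of_forall fun x => ?_
      rw [norm_mul]
      exact mul_le_of_le_one_left (norm_nonneg _) (abs_prod_smoothTransition_le _ _)
    · filter_upwards [ae_restrict_mem hUo.measurableSet] with x hx
      rw [hU] at hx
      have h1 : Tendsto (fun k => χ k x) atTop (𝓝 1) := by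
        rw [show (1 : ℝ) = ∏ r ∈ H, (1 : ℝ) by simp]
        refine tendsto_finsetProd _ fun r hr => ?_
        have hpos : 0 < slack r x := sub_pos.2 (hx r hr)
        refine tendsto_const_nhds.congr' ?_
        filter_upwards [hεl.eventually (gt_mem_nhds hpos)] with k h3
        rw [Real.smoothTransition.one_of_one_le]
        rw [le_div_iff₀ (hε0 k)]
        linarith
      simpa using h1.mul_const (fderiv ℝ ψ x e)
  refine tendsto_nhds_unique hl1 ?_
  simp only [hk]
  exact tendsto_finsetSum _ fun p hp => (tendsto_integral_faceDensity hb hne hH hU hp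
    hψ.continuous hε0 hε1 hεl).const_mul _

end Face

/-- The divergence theorem on an open polytope; `ν` is the exterior unit normal almost everywhere
on the boundary. -/
theorem IsOpenPolytope.exists_normal {U : Set (E d)} (h : IsOpenPolytope U) :
    ∃ ν : E d → E d, Measurable ν ∧ (∃ C, ∀ x, ‖ν x‖ ≤ C) ∧
      (∀ ψ : E d → ℝ, ContDiff ℝ ∞ ψ → ∀ e : E d,
        ∫ x in U, fderiv ℝ ψ x e = ∫ x, ψ x * inner ℝ (ν x) e ∂(surf U)) ∧
      ∃ x₀ : E d, ∃ r > 0, ∀ x ∈ frontier U, r ≤ inner ℝ (ν x) (x - x₀) := by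
  have hfin := h.isFiniteMeasure_surf
  obtain ⟨H, hH, hU⟩ := h.exists_halfspaces
  have hfr := frontier_eq_of_halfspaces h.isOpen h.1 hU
  let F : E d × ℝ → Set (E d) := fun p => {x ∈ closure U | inner ℝ p.1 x = p.2}
  have hFm : ∀ p, MeasurableSet (F p) := fun p => (isClosed_closure.inter
    (isClosed_eq (continuous_const.inner continuous_id) continuous_const)).measurableSet
  have hFf : ∀ p ∈ H, F p ⊆ frontier U := by
    intro p hp
    rw [hfr]
    exact Set.subset_biUnion_of_mem (u := F) hp
  -- Where faces meet, their normals add up. The integral formula is additive over the faces, so it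
  -- is not affected, and the lower bound for `⟨ν, x - x₀⟩` survives because every summand is
  -- nonnegative.
  let ν : E d → E d := fun x => ∑ p ∈ H, (F p).indicator (fun _ => p.1) x
  have hν : ∀ x e, inner ℝ (ν x) e = ∑ p ∈ H, (F p).indicator (fun _ => inner ℝ p.1 e) x := by
    intro x e
    simp only [ν, sum_inner]
    refine Finset.sum_congr rfl fun p _ => ?_
    by_cases hx : x ∈ F p <;> simp [hx]
  refine ⟨ν, Finset.measurable_fun_sum _ fun p _ => measurable_const.indicator (hFm p),
    ⟨∑ p ∈ H, 1, fun x => ?_⟩, ?_, ?_⟩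
  · refine (norm_sum_le _ _).trans (Finset.sum_le_sum fun p hp => ?_)
    exact (norm_indicator_le_norm_self _ _).trans (hH p hp).le
  · intro ψ hψ e
    rw [integral_fderiv_of_halfspaces h.isBounded h.1 h.isOpen hH hU hψ]
    simp only [hν, Finset.mul_sum]
    have hψi : Integrable ψ (surf U) := by
      refine memLp_one_iff_integrable.1 ?_
      have : IsFiniteMeasure ((μHE[d - 1] : Measure (E d)).restrict (frontier U)) := hfin
      exact memLp_restrict_of_continuous (h.isBounded.closure.subset frontier_subset_closure)
        hψ.continuous
    rw [integral_finsetSum]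
    · refine Finset.sum_congr rfl fun p hp => ?_
      have e1 : (fun x => ψ x * (F p).indicator (fun _ => inner ℝ p.1 e) x) =
          (F p).indicator fun x => inner ℝ p.1 e * ψ x := by
        ext x
        by_cases hx : x ∈ F p <;> simp [hx, mul_comm]
      rw [e1, integral_indicator (hFm p), integral_const_mul, surf,
        Measure.restrict_restrict (hFm p), Set.inter_eq_left.2 (hFf p hp)]
    · intro p _
      have e1 : (fun x => ψ x * (F p).indicator (fun _ => inner ℝ p.1 e) x) =
          (F p).indicator fun x => inner ℝ p.1 e * ψ x := by
        ext x
        by_cases hx : x ∈ F p <;> simp [hx, mul_comm]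
      rw [e1]
      exact (hψi.const_mul _).indicator (hFm p)
  · obtain ⟨x₀, hx₀⟩ := h.1
    have hx₀' : ∀ p ∈ H, 0 < slack p x₀ := by
      rw [hU] at hx₀
      exact fun p hp => sub_pos.2 (hx₀ p hp)
    obtain ⟨r, hr, hrH⟩ : ∃ r > 0, ∀ p ∈ H, r ≤ slack p x₀ := by
      rcases H.eq_empty_or_nonempty with h0 | h0
      · exact ⟨1, one_pos, by simp [h0]⟩
      · exact ⟨H.inf' h0 fun p => slack p x₀, (Finset.lt_inf'_iff h0).2 hx₀',
          fun p hp => Finset.inf'_le _ hp⟩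
    refine ⟨x₀, r, hr, fun x hx => ?_⟩
    rw [hν]
    have hterm : ∀ p ∈ H, 0 ≤ (F p).indicator (fun _ => inner ℝ p.1 (x - x₀)) x ∧
        (x ∈ F p → r ≤ (F p).indicator (fun _ => inner ℝ p.1 (x - x₀)) x) := by
      intro p hp
      by_cases hxp : x ∈ F p
      · have : inner ℝ p.1 (x - x₀) = slack p x₀ := by
          rw [inner_sub_right, hxp.2, slack]
        rw [Set.indicator_of_mem hxp, this]
        exact ⟨(hx₀' p hp).le, fun _ => hrH p hp⟩
      · rw [Set.indicator_of_notMem hxp]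
        exact ⟨le_rfl, fun h => absurd h hxp⟩
    rw [hfr] at hx
    simp only [Set.mem_iUnion, exists_prop] at hx
    obtain ⟨p, hp, hxp⟩ := hx
    exact ((hterm p hp).2 hxp).trans (Finset.single_le_sum (fun q hq => (hterm q hq).1) hp)

/-! ### Traces on polytopes -/

theorem sum_mul_fderiv_single (φ : E d → ℝ) (x y : E d) :
    ∑ j, y j * fderiv ℝ φ x (EuclideanSpace.single j 1) = fderiv ℝ φ x y := by
  have : y = ∑ j, y j • EuclideanSpace.single j (1 : ℝ) := by
    ext k
    simp [Finset.sum_apply, Pi.single_apply]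
  conv_rhs => rw [this]
  simp [map_sum]

theorem inner_eq_sum_mul (x y : E d) : inner ℝ x y = ∑ j, x j * y j := by
  rw [PiLp.inner_apply]
  simp [mul_comm]

/-- The divergence theorem for the field `φ²(x - x₀)`: on the boundary `⟨ν, x - x₀⟩ ≥ r`, and inside
the divergence is `d φ² + 2 φ ⟨∇φ, x - x₀⟩`. With `|x - x₀| ≤ D` this gives the constant `(d +
D)/r`. -/
theorem IsOpenPolytope.exists_trace_inequality_sq {U : Set (E d)} (h : IsOpenPolytope U) :
    ∃ K : ℝ, 0 ≤ K ∧ ∀ φ : E d → ℝ, ContDiff ℝ ∞ φ →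
      ∫ x, φ x ^ 2 ∂(surf U) ≤ K * ((∫ x in U, φ x ^ 2) + ∫ x in U, ‖gradient φ x‖ ^ 2) := by
  have hfin := h.isFiniteMeasure_surf
  have hfin' : IsFiniteMeasure ((μHE[d - 1] : Measure (E d)).restrict (frontier U)) := hfin
  have hfinU := isFiniteMeasure_restrict_of_isBounded h.isBounded
  have hfb : Bornology.IsBounded (frontier U) :=
    h.isBounded.closure.subset frontier_subset_closure
  obtain ⟨ν, hνm, ⟨Cν, hCν⟩, hdiv, x₀, r, hr, hνr⟩ := h.exists_normal
  obtain ⟨D, hD⟩ := exists_bound_of_isBounded h.isBounded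
    (f := fun x : E d => x - x₀) (by fun_prop)
  have hD0 : 0 ≤ D := (norm_nonneg _).trans (hD _ (subset_closure h.1.some_mem))
  refine ⟨r⁻¹ * (d + D), by positivity, fun φ hφ => ?_⟩
  have hint : ∀ {f : E d → ℝ}, Continuous f → Integrable f (surf U) := fun hf =>
    memLp_one_iff_integrable.1 (memLp_restrict_of_continuous hfb hf)
  have hintU : ∀ {f : E d → ℝ}, Continuous f → Integrable f (volume.restrict U) := fun hf =>
    memLp_one_iff_integrable.1 (memLp_restrict_of_continuous h.isBounded hf)
  let ψ : Fin d → E d → ℝ := fun j x => φ x ^ 2 * (x j - x₀ j)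
  have hcoord : ∀ j, ContDiff ℝ ∞ fun x : E d => x j - x₀ j := fun j =>
    (EuclideanSpace.proj (𝕜 := ℝ) j).contDiff.sub contDiff_const
  have hψ : ∀ j, ContDiff ℝ ∞ (ψ j) := fun j => (hφ.pow 2).mul (hcoord j)
  have hψd : ∀ j x, fderiv ℝ (ψ j) x (EuclideanSpace.single j 1) =
      φ x ^ 2 + 2 * φ x * ((x j - x₀ j) * fderiv ℝ φ x (EuclideanSpace.single j 1)) := by
    intro j x
    have h1 : HasFDerivAt (fun x : E d => x j - x₀ j) (EuclideanSpace.proj (𝕜 := ℝ) j) x :=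
      (EuclideanSpace.proj (𝕜 := ℝ) j).hasFDerivAt.sub_const _
    have h2 := ((hφ.differentiable (by simp) x).hasFDerivAt.pow 2).mul h1
    have h3 : fderiv ℝ (ψ j) x = _ := h2.fderiv
    rw [h3]
    simp
    ring
  have hidiv : ∀ j, Integrable (fun x => ψ j x * ν x j) (surf U) := by
    intro j
    refine (hint (hψ j).continuous).mul_bdd (c := Cν) ?_ (.of_forall fun x => ?_)
    · exact ((EuclideanSpace.proj (𝕜 := ℝ) j).continuous.measurable.comp hνm).aestronglyMeasurable
    · exact (PiLp.norm_apply_le (ν x) j).trans (hCν x)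
  have e1 : ∫ x, φ x ^ 2 * inner ℝ (ν x) (x - x₀) ∂(surf U) =
      ∫ x in U, (d * φ x ^ 2 + 2 * φ x * inner ℝ (gradient φ x) (x - x₀)) := by
    have e2 : ∀ x, φ x ^ 2 * inner ℝ (ν x) (x - x₀) = ∑ j, ψ j x * ν x j := by
      intro x
      rw [inner_eq_sum_mul, Finset.mul_sum]
      refine Finset.sum_congr rfl fun j _ => ?_
      simp only [ψ, PiLp.sub_apply]
      ring
    have e3 : ∀ x, d * φ x ^ 2 + 2 * φ x * inner ℝ (gradient φ x) (x - x₀) =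
        ∑ j, fderiv ℝ (ψ j) x (EuclideanSpace.single j 1) := by
      intro x
      simp only [hψd, Finset.sum_add_distrib, ← Finset.mul_sum]
      have := sum_mul_fderiv_single φ x (x - x₀)
      simp only [PiLp.sub_apply] at this
      rw [this, inner_gradient_left]
      simp
    simp only [e2, e3]
    rw [integral_finsetSum _ fun j _ => hidiv j, integral_finsetSum _ fun j _ => hintU
      (((hψ j).continuous_fderiv (by simp)).clm_apply continuous_const)]
    refine Finset.sum_congr rfl fun j _ => ?_
    rw [hdiv (ψ j) (hψ j)]
    simp [EuclideanSpace.inner_single_right]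
  have hνi : Integrable (fun x => φ x ^ 2 * inner ℝ (ν x) (x - x₀)) (surf U) := by
    have e2 : (fun x => φ x ^ 2 * inner ℝ (ν x) (x - x₀)) = fun x => ∑ j, ψ j x * ν x j := by
      ext x
      rw [inner_eq_sum_mul, Finset.mul_sum]
      refine Finset.sum_congr rfl fun j _ => ?_
      simp only [ψ, PiLp.sub_apply]
      ring
    rw [e2]
    exact integrable_finsetSum _ fun j _ => hidiv j
  have h1 : r * ∫ x, φ x ^ 2 ∂(surf U) ≤ ∫ x, φ x ^ 2 * inner ℝ (ν x) (x - x₀) ∂(surf U) := by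
    rw [← integral_const_mul]
    refine integral_mono_ae ((hint (hφ.continuous.pow 2)).const_mul r) hνi ?_
    have : ∀ᵐ x ∂(surf U), x ∈ frontier U := ae_restrict_mem isClosed_frontier.measurableSet
    filter_upwards [this] with x hx
    nlinarith [hνr x hx, sq_nonneg (φ x)]
  have h2 : ∫ x in U, (d * φ x ^ 2 + 2 * φ x * inner ℝ (gradient φ x) (x - x₀)) ≤
      ∫ x in U, ((d + D) * (φ x ^ 2 + ‖gradient φ x‖ ^ 2)) := by
    have hg := continuous_gradient hφ
    refine integral_mono_ae (hintU ?_) (hintU ?_) ?_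
    · exact (continuous_const.mul (hφ.continuous.pow 2)).add
        ((continuous_const.mul hφ.continuous).mul (hg.inner (by fun_prop)))
    · exact continuous_const.mul ((hφ.continuous.pow 2).add (hg.norm.pow 2))
    · filter_upwards [ae_restrict_mem_closure volume U] with x hx
      have h3 : |inner ℝ (gradient φ x) (x - x₀)| ≤ ‖gradient φ x‖ * D :=
        (abs_real_inner_le_norm _ _).trans (mul_le_mul_of_nonneg_left (hD x hx) (norm_nonneg _))
      have h4 : 2 * φ x * inner ℝ (gradient φ x) (x - x₀) ≤
          2 * (|φ x| * (‖gradient φ x‖ * D)) := by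
        rw [mul_assoc]
        refine mul_le_mul_of_nonneg_left ((le_abs_self _).trans ?_) (by norm_num)
        rw [abs_mul]
        exact mul_le_mul_of_nonneg_left h3 (abs_nonneg _)
      have h5 : 2 * (|φ x| * ‖gradient φ x‖) ≤ φ x ^ 2 + ‖gradient φ x‖ ^ 2 := by
        rw [← sq_abs (φ x)]
        nlinarith [sq_nonneg (|φ x| - ‖gradient φ x‖)]
      have hd : (0 : ℝ) ≤ d := d.cast_nonneg
      have h6 : D * (2 * (|φ x| * ‖gradient φ x‖)) ≤ D * (φ x ^ 2 + ‖gradient φ x‖ ^ 2) :=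
        mul_le_mul_of_nonneg_left h5 hD0
      have h7 : 0 ≤ (d : ℝ) * ‖gradient φ x‖ ^ 2 := by positivity
      nlinarith
  have hsum : ∫ x in U, (φ x ^ 2 + ‖gradient φ x‖ ^ 2) =
      (∫ x in U, φ x ^ 2) + ∫ x in U, ‖gradient φ x‖ ^ 2 :=
    integral_add (hintU (hφ.continuous.pow 2)) (hintU ((continuous_gradient hφ).norm.pow 2))
  rw [integral_const_mul, hsum] at h2
  rw [e1] at h1
  rw [mul_assoc, inv_mul_eq_div, le_div_iff₀' hr]
  exact h1.trans h2

theorem IsOpenPolytope.exists_trace_inequality {U : Set (E d)} (h : IsOpenPolytope U) :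
    ∃ C : NNReal, ∀ φ : E d → ℝ, ContDiff ℝ ∞ φ →
      eLpNorm φ 2 (surf U) ≤ C * (eLpNorm φ 2 (volume.restrict U) +
        eLpNorm (gradient φ) 2 (volume.restrict U)) := by
  obtain ⟨K, hK0, hK⟩ := h.exists_trace_inequality_sq
  have hfin : IsFiniteMeasure ((μHE[d - 1] : Measure (E d)).restrict (frontier U)) :=
    h.isFiniteMeasure_surf
  have hfinU := isFiniteMeasure_restrict_of_isBounded h.isBounded
  refine ⟨(Real.sqrt K).toNNReal, fun φ hφ => ?_⟩
  have m1 : MemLp φ 2 (surf U) := memLp_restrict_of_continuous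
    (h.isBounded.closure.subset frontier_subset_closure) hφ.continuous
  have m2 : MemLp φ 2 (volume.restrict U) :=
    memLp_restrict_of_continuous h.isBounded hφ.continuous
  have m3 : MemLp (gradient φ) 2 (volume.restrict U) :=
    memLp_restrict_of_continuous h.isBounded (continuous_gradient hφ)
  rw [eLpNorm_two_eq_ofReal_sqrt m1, eLpNorm_two_eq_ofReal_sqrt m2, eLpNorm_two_eq_ofReal_sqrt m3,
    ← ENNReal.ofReal_add (Real.sqrt_nonneg _) (Real.sqrt_nonneg _)]
  change _ ≤ ENNReal.ofReal _ * _
  rw [← ENNReal.ofReal_mul (Real.sqrt_nonneg _)]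
  refine ENNReal.ofReal_le_ofReal ?_
  simp only [Real.norm_eq_abs, sq_abs]
  set A := ∫ x in U, φ x ^ 2
  set B := ∫ x in U, ‖gradient φ x‖ ^ 2
  have hA : 0 ≤ A := integral_nonneg fun x => sq_nonneg _
  have hB : 0 ≤ B := integral_nonneg fun x => sq_nonneg _
  calc _ ≤ Real.sqrt (K * (A + B)) := Real.sqrt_le_sqrt (hK φ hφ)
    _ = Real.sqrt K * Real.sqrt (A + B) := Real.sqrt_mul hK0 _
    _ ≤ _ := by
      gcongr
      refine Real.sqrt_le_iff.2 ⟨by positivity, ?_⟩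
      nlinarith [Real.sq_sqrt hA, Real.sq_sqrt hB,
        mul_nonneg (Real.sqrt_nonneg A) (Real.sqrt_nonneg B)]

/-- The smooth functions `φ n` converge to `v` in `H¹(U)`. -/
structure ApproxH1 (U : Set (E d)) (v : E d → ℝ) (φ : ℕ → E d → ℝ) : Prop where
  contDiff : ∀ n, ContDiff ℝ ∞ (φ n)
  tendsto : Tendsto (fun n => eLpNorm (fun x => φ n x - v x) 2 (volume.restrict U)) atTop (𝓝 0)
  tendsto_gradient : Tendsto (fun n => eLpNorm (fun x => gradient (φ n) x - wgrad U v x) 2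
    (volume.restrict U)) atTop (𝓝 0)

section Trace

variable {U : Set (E d)} {v w : E d → ℝ} {φ ψ : ℕ → E d → ℝ}

theorem IsOpenPolytope.exists_approxH1 (h : IsOpenPolytope U) (hv : MemH1 U v) :
    ∃ φ, ApproxH1 U v φ := by
  obtain ⟨φ, h1, h2, h3⟩ := exists_contDiff_tendsto h.isOpen h.convex h.1 hv
  exact ⟨φ, h1, h2, h3⟩

theorem IsOpenPolytope.memLp_surf (h : IsOpenPolytope U) {f : E d → ℝ} (hf : Continuous f)
    {p : ENNReal} : MemLp f p (surf U) :=
  have : IsFiniteMeasure ((μHE[d - 1] : Measure (E d)).restrict (frontier U)) :=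
    h.isFiniteMeasure_surf
  memLp_restrict_of_continuous (h.isBounded.closure.subset frontier_subset_closure) hf

theorem IsOpenPolytope.memLp_volume (h : IsOpenPolytope U) {F : Type*} [NormedAddCommGroup F]
    {f : E d → F} (hf : Continuous f) {p : ENNReal} : MemLp f p (volume.restrict U) :=
  have := isFiniteMeasure_restrict_of_isBounded h.isBounded
  memLp_restrict_of_continuous h.isBounded hf

theorem gradient_sub_apply {f g : E d → ℝ} {x : E d} (hf : DifferentiableAt ℝ f x)
    (hg : DifferentiableAt ℝ g x) :
    gradient (fun y => f y - g y) x = gradient f x - gradient g x := by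
  simp only [gradient]
  rw [show (fun y => f y - g y) = f - g from rfl, fderiv_sub hf hg, map_sub]

theorem gradient_const_mul_apply {f : E d → ℝ} {x : E d} (c : ℝ) (hf : DifferentiableAt ℝ f x) :
    gradient (fun y => c * f y) x = c • gradient f x := by
  simp only [gradient]
  rw [fderiv_const_mul hf, map_smul]

/-- The `H¹(U)`-distance of the approximations bounds the distance of their boundary values. -/
theorem ApproxH1.eLpNorm_sub_le {C : NNReal} (h : IsOpenPolytope U) (hv : MemH1 U v)
    (hC : ∀ φ : E d → ℝ, ContDiff ℝ ∞ φ → eLpNorm φ 2 (surf U) ≤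
      C * (eLpNorm φ 2 (volume.restrict U) + eLpNorm (gradient φ) 2 (volume.restrict U)))
    (hφ : ApproxH1 U v φ) (hψ : ApproxH1 U v ψ) (n m : ℕ) :
    eLpNorm (fun x => φ n x - ψ m x) 2 (surf U) ≤
      C * ((eLpNorm (fun x => φ n x - v x) 2 (volume.restrict U) +
        eLpNorm (fun x => gradient (φ n) x - wgrad U v x) 2 (volume.restrict U)) +
        (eLpNorm (fun x => ψ m x - v x) 2 (volume.restrict U) +
        eLpNorm (fun x => gradient (ψ m) x - wgrad U v x) 2 (volume.restrict U))) := by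
  refine (hC _ ((hφ.contDiff n).sub (hψ.contDiff m))).trans ?_
  rw [add_add_add_comm]
  gcongr
  · have e : (fun x => φ n x - ψ m x) = (fun x => φ n x - v x) - fun x => ψ m x - v x := by
      ext x; simp
    rw [e]
    exact MeasureTheory.eLpNorm_sub_le
      ((h.memLp_volume (hφ.contDiff n).continuous (p := 2)).1.sub hv.1.1)
      ((h.memLp_volume (hψ.contDiff m).continuous (p := 2)).1.sub hv.1.1) (by norm_num)
  · have e : gradient (fun x => φ n x - ψ m x) = (fun x => gradient (φ n) x - wgrad U v x) -
        fun x => gradient (ψ m) x - wgrad U v x := by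
      ext1 x
      rw [gradient_sub_apply ((hφ.contDiff n).differentiable (by simp) x)
        ((hψ.contDiff m).differentiable (by simp) x)]
      simp
    have m0 := (hv.memLp_wgrad h.isOpen).1
    rw [e]
    exact MeasureTheory.eLpNorm_sub_le
      ((h.memLp_volume (continuous_gradient (hφ.contDiff n)) (p := 2)).1.sub m0)
      ((h.memLp_volume (continuous_gradient (hψ.contDiff m)) (p := 2)).1.sub m0) (by norm_num)

/-- By the trace inequality the boundary values of an `H¹`-approximating sequence are Cauchy in
`L²(∂U)`; the trace is their limit. -/
theorem IsOpenPolytope.exists_isTrace (h : IsOpenPolytope U) (hv : MemH1 U v) :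
    ∃ T, IsTrace U v T := by
  obtain ⟨C, hC⟩ := h.exists_trace_inequality
  obtain ⟨φ, hφ⟩ := h.exists_approxH1 hv
  have hm : ∀ n, MemLp (φ n) 2 (surf U) := fun n => h.memLp_surf (hφ.contDiff n).continuous
  have hcau : CauchySeq fun n => (hm n).toLp (φ n) := by
    rw [EMetric.cauchySeq_iff]
    intro ε hε
    have hl : Tendsto (fun n => (C : ENNReal) *
        (eLpNorm (fun x => φ n x - v x) 2 (volume.restrict U) +
        eLpNorm (fun x => gradient (φ n) x - wgrad U v x) 2 (volume.restrict U))) atTop (𝓝 0) := by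
      have := ENNReal.Tendsto.const_mul (a := (C : ENNReal)) (hφ.tendsto.add hφ.tendsto_gradient)
        (Or.inr ENNReal.coe_ne_top)
      simpa using this
    obtain ⟨N, hN⟩ := (hl.eventually (gt_mem_nhds (ENNReal.half_pos hε.ne'))).exists_forall_of_atTop
    refine ⟨N, fun n hn m hm' => ?_⟩
    rw [Lp.edist_toLp_toLp]
    refine (hφ.eLpNorm_sub_le h hv hC hφ n m).trans_lt ?_
    rw [mul_add, ← ENNReal.add_halves ε]
    exact ENNReal.add_lt_add (hN n hn) (hN m hm')
  obtain ⟨T, hT⟩ := cauchySeq_tendsto_of_complete hcau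
  refine ⟨T, Lp.memLp T, φ, hφ.contDiff, hφ.tendsto, hφ.tendsto_gradient, ?_⟩
  rw [← Lp.toLp_coeFn T (Lp.memLp T)] at hT
  exact (Lp.tendsto_Lp_iff_tendsto_eLpNorm'' φ hm T (Lp.memLp T)).1 hT

theorem IsOpenPolytope.isTrace_trace (h : IsOpenPolytope U) (hv : MemH1 U v) :
    IsTrace U v (trace U v) := by
  have hex := h.exists_isTrace hv
  rw [trace, dif_pos hex]
  exact hex.choose_spec

theorem IsOpenPolytope.memLp_trace (h : IsOpenPolytope U) (hv : MemH1 U v) :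
    MemLp (trace U v) 2 (surf U) := (h.isTrace_trace hv).1

/-- The trace was selected by choice together with one approximating sequence. Two such sequences
have boundary values that approach each other, so every approximating sequence computes it. -/
theorem ApproxH1.tendsto_trace (hφ : ApproxH1 U v φ) (h : IsOpenPolytope U) (hv : MemH1 U v) :
    Tendsto (fun n => eLpNorm (fun x => φ n x - trace U v x) 2 (surf U)) atTop (𝓝 0) := by
  obtain ⟨C, hC⟩ := h.exists_trace_inequality
  obtain ⟨hT, ψ, h1, h2, h3, h4⟩ := h.isTrace_trace hv
  have hψ : ApproxH1 U v ψ := ⟨h1, h2, h3⟩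
  have hl : Tendsto (fun n => (C : ENNReal) *
      ((eLpNorm (fun x => φ n x - v x) 2 (volume.restrict U) +
        eLpNorm (fun x => gradient (φ n) x - wgrad U v x) 2 (volume.restrict U)) +
        (eLpNorm (fun x => ψ n x - v x) 2 (volume.restrict U) +
        eLpNorm (fun x => gradient (ψ n) x - wgrad U v x) 2 (volume.restrict U))) +
      eLpNorm (fun x => ψ n x - trace U v x) 2 (surf U)) atTop (𝓝 0) := by
    have := (ENNReal.Tendsto.const_mul (a := (C : ENNReal))
      ((hφ.tendsto.add hφ.tendsto_gradient).add (hψ.tendsto.add hψ.tendsto_gradient))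
      (Or.inr ENNReal.coe_ne_top)).add h4
    simpa using this
  refine tendsto_of_tendsto_of_tendsto_of_le_of_le tendsto_const_nhds hl (fun _ => bot_le)
    fun n => ?_
  refine le_trans ?_ (add_le_add (hφ.eLpNorm_sub_le h hv hC hψ n n) le_rfl)
  have e : (fun x => φ n x - trace U v x) = (fun x => φ n x - ψ n x) +
      fun x => ψ n x - trace U v x := by
    ext x; simp
  have m1 := (h.memLp_surf (hφ.contDiff n).continuous (p := 2)).1
  have m2 := (h.memLp_surf (hψ.contDiff n).continuous (p := 2)).1
  rw [e]
  exact eLpNorm_add_le (m1.sub m2) (m2.sub hT.1) (by norm_num)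

theorem ApproxH1.trace_ae_eq (hφ : ApproxH1 U v φ) (h : IsOpenPolytope U) (hv : MemH1 U v)
    {T : E d → ℝ} (hT : AEStronglyMeasurable T (surf U))
    (hl : Tendsto (fun n => eLpNorm (fun x => φ n x - T x) 2 (surf U)) atTop (𝓝 0)) :
    trace U v =ᵐ[surf U] T :=
  ae_eq_of_tendsto_eLpNorm (fun n => (h.memLp_surf (hφ.contDiff n).continuous (p := 2)).1)
    (h.memLp_trace hv).1 hT (hφ.tendsto_trace h hv) hl

theorem tendsto_eLpNorm_add {α F : Type*} [MeasurableSpace α] {μ : Measure α}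
    [NormedAddCommGroup F] {f g : ℕ → α → F} {f' g' : α → F}
    (hf : ∀ n, AEStronglyMeasurable (f n) μ) (hg : ∀ n, AEStronglyMeasurable (g n) μ)
    (hf' : AEStronglyMeasurable f' μ) (hg' : AEStronglyMeasurable g' μ)
    (h1 : Tendsto (fun n => eLpNorm (fun x => f n x - f' x) 2 μ) atTop (𝓝 0))
    (h2 : Tendsto (fun n => eLpNorm (fun x => g n x - g' x) 2 μ) atTop (𝓝 0)) :
    Tendsto (fun n => eLpNorm (fun x => (f n x + g n x) - (f' x + g' x)) 2 μ) atTop (𝓝 0) := by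
  have h3 := h1.add h2
  rw [add_zero] at h3
  refine tendsto_of_tendsto_of_tendsto_of_le_of_le tendsto_const_nhds h3 (fun _ => bot_le)
    fun n => ?_
  refine le_trans (le_of_eq ?_) (eLpNorm_add_le ((hf n).sub hf') ((hg n).sub hg') (by norm_num))
  congr 1
  ext x
  simp only [Pi.add_apply]
  abel

theorem tendsto_eLpNorm_const_smul {α F : Type*} [MeasurableSpace α] {μ : Measure α}
    [NormedAddCommGroup F] [NormedSpace ℝ F] {f : ℕ → α → F} {f' : α → F} (c : ℝ)
    (h1 : Tendsto (fun n => eLpNorm (fun x => f n x - f' x) 2 μ) atTop (𝓝 0)) :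
    Tendsto (fun n => eLpNorm (fun x => c • f n x - c • f' x) 2 μ) atTop (𝓝 0) := by
  have h2 := ENNReal.Tendsto.const_mul (a := ‖c‖ₑ) h1 (Or.inr enorm_ne_top)
  rw [mul_zero] at h2
  refine h2.congr fun n => ?_
  rw [← eLpNorm_const_smul]
  congr 1
  ext x
  simp [smul_sub]

theorem ApproxH1.add (h : IsOpenPolytope U) (hv : MemH1 U v) (hw : MemH1 U w)
    (hφ : ApproxH1 U v φ) (hψ : ApproxH1 U w ψ) :
    ApproxH1 U (fun x => v x + w x) (fun n x => φ n x + ψ n x) := by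
  have m1 := fun n => (h.memLp_volume (hφ.contDiff n).continuous (p := 2)).1
  have m2 := fun n => (h.memLp_volume (hψ.contDiff n).continuous (p := 2)).1
  have m3 := fun n => (h.memLp_volume (continuous_gradient (hφ.contDiff n)) (p := 2)).1
  have m4 := fun n => (h.memLp_volume (continuous_gradient (hψ.contDiff n)) (p := 2)).1
  refine ⟨fun n => (hφ.contDiff n).add (hψ.contDiff n),
    tendsto_eLpNorm_add m1 m2 hv.1.1 hw.1.1 hφ.tendsto hψ.tendsto, ?_⟩
  refine (tendsto_eLpNorm_add m3 m4 (hv.memLp_wgrad h.isOpen).1 (hw.memLp_wgrad h.isOpen).1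
    hφ.tendsto_gradient hψ.tendsto_gradient).congr fun n => eLpNorm_congr_ae ?_
  filter_upwards [wgrad_add h.isOpen hv hw] with x hx
  rw [hx, gradient_add_apply ((hφ.contDiff n).differentiable (by simp) x)
        ((hψ.contDiff n).differentiable (by simp) x)]

theorem ApproxH1.const_mul (h : IsOpenPolytope U) (hv : MemH1 U v) (c : ℝ)
    (hφ : ApproxH1 U v φ) : ApproxH1 U (fun x => c * v x) (fun n x => c * φ n x) := by
  refine ⟨fun n => contDiff_const.mul (hφ.contDiff n), tendsto_eLpNorm_const_smul c hφ.tendsto, ?_⟩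
  refine (tendsto_eLpNorm_const_smul c hφ.tendsto_gradient).congr fun n => eLpNorm_congr_ae ?_
  filter_upwards [wgrad_const_mul h.isOpen c hv] with x hx
  rw [hx, gradient_const_mul_apply c ((hφ.contDiff n).differentiable (by simp) x)]

theorem trace_add (h : IsOpenPolytope U) (hv : MemH1 U v) (hw : MemH1 U w) :
    trace U (fun x => v x + w x) =ᵐ[surf U] fun x => trace U v x + trace U w x := by
  obtain ⟨φ, hφ⟩ := h.exists_approxH1 hv
  obtain ⟨ψ, hψ⟩ := h.exists_approxH1 hw
  have m1 := fun n => (h.memLp_surf (hφ.contDiff n).continuous (p := 2)).1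
  have m2 := fun n => (h.memLp_surf (hψ.contDiff n).continuous (p := 2)).1
  exact (hφ.add h hv hw hψ).trace_ae_eq h (hv.add h.isOpen hw)
    ((h.memLp_trace hv).1.add (h.memLp_trace hw).1)
    (tendsto_eLpNorm_add m1 m2 (h.memLp_trace hv).1 (h.memLp_trace hw).1
      (hφ.tendsto_trace h hv) (hψ.tendsto_trace h hw))

theorem trace_const_mul (h : IsOpenPolytope U) (c : ℝ) (hv : MemH1 U v) :
    trace U (fun x => c * v x) =ᵐ[surf U] fun x => c * trace U v x := by
  obtain ⟨φ, hφ⟩ := h.exists_approxH1 hv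
  exact (hφ.const_mul h hv c).trace_ae_eq h (hv.const_mul h.isOpen c)
    ((h.memLp_trace hv).1.const_mul c) (tendsto_eLpNorm_const_smul c (hφ.tendsto_trace h hv))

theorem IsOpenPolytope.exists_trace_le (h : IsOpenPolytope U) :
    ∃ C : NNReal, ∀ v : E d → ℝ, MemH1 U v →
      eLpNorm (trace U v) 2 (surf U) ≤ C * (eLpNorm v 2 (volume.restrict U) +
        eLpNorm (wgrad U v) 2 (volume.restrict U)) := by
  obtain ⟨C, hC⟩ := h.exists_trace_inequality
  refine ⟨C, fun v hv => ?_⟩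
  obtain ⟨φ, hφ⟩ := h.exists_approxH1 hv
  have l1 := tendsto_eLpNorm_of_sub (fun n => h.memLp_surf (hφ.contDiff n).continuous)
    (h.memLp_trace hv) (hφ.tendsto_trace h hv)
  have l2 := tendsto_eLpNorm_of_sub (fun n => h.memLp_volume (hφ.contDiff n).continuous)
    hv.1 hφ.tendsto
  have l3 := tendsto_eLpNorm_of_sub
    (fun n => h.memLp_volume (continuous_gradient (hφ.contDiff n)))
    (hv.memLp_wgrad h.isOpen) hφ.tendsto_gradient
  exact le_of_tendsto_of_tendsto' l1 (ENNReal.Tendsto.const_mul (l2.add l3)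
    (Or.inr ENNReal.coe_ne_top)) fun n => hC _ (hφ.contDiff n)

end Trace

/-! ### Weak Laplacian and normal derivative -/

section Normal

variable {U : Set (E d)} {v w f g : E d → ℝ}

theorem IsWeakLap.ae_eq {f' : E d → ℝ} (hU : IsOpen U) (hf : IsWeakLap U v f)
    (hf' : IsWeakLap U v f') : f =ᵐ[volume.restrict U] f' := by
  have hli : ∀ {f : E d → ℝ}, MemLp f 2 (volume.restrict U) → LocallyIntegrableOn f U volume :=
    fun hf => locallyIntegrableOn_of_locallyIntegrable_restrict
      (hf.locallyIntegrable (by norm_num))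
  have := hU.ae_eq_zero_of_integral_contDiff_smul_eq_zero (μ := volume) (f := fun x => f x - f' x)
    ((hli hf.1).sub (hli hf'.1)) fun φ hφ hc hs => by
      have i1 := integrableOn_smul_of_tsupport_subset hU (hli hf.1) hφ.continuous hc hs
      have i2 := integrableOn_smul_of_tsupport_subset hU (hli hf'.1) hφ.continuous hc hs
      have h1 := hf.2 φ hφ hc hs
      have h2 := hf'.2 φ hφ hc hs
      have e : ∫ x, φ x • (f x - f' x) = ∫ x in U, φ x • (f x - f' x) := by
        refine (setIntegral_eq_integral_of_forall_compl_eq_zero fun x hx => ?_).symm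
        rw [image_eq_zero_of_notMem_tsupport fun h => hx (hs h), zero_smul]
      rw [e]
      simp only [smul_sub]
      rw [integral_sub i1 i2, sub_eq_zero]
      simp only [smul_eq_mul, mul_comm (φ _)]
      linarith
  rw [EventuallyEq, ae_restrict_iff' hU.measurableSet]
  filter_upwards [this] with x hx hxU
  exact sub_eq_zero.1 (hx hxU)

theorem isWeakLap_wlap (h : ∃ f, IsWeakLap U v f) : IsWeakLap U v (wlap U v) := by
  rw [wlap, dif_pos h]
  exact h.choose_spec

theorem isNormalDeriv_normalDeriv (h : ∃ f, IsNormalDeriv U v f) :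
    IsNormalDeriv U v (normalDeriv U v) := by
  rw [normalDeriv, dif_pos h]
  exact h.choose_spec

theorem IsOpenPolytope.ae_eq_of_integral_mul (h : IsOpenPolytope U)
    (hf : MemLp f 2 (surf U)) (hg : MemLp g 2 (surf U))
    (H : ∀ φ : E d → ℝ, ContDiff ℝ ∞ φ → ∫ x, f x * φ x ∂(surf U) = ∫ x, g x * φ x ∂(surf U)) :
    f =ᵐ[surf U] g := by
  have hfin := h.isFiniteMeasure_surf
  have := ae_eq_zero_of_integral_contDiff_smul_eq_zero (μ := surf U) (f := fun x => f x - g x)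
    ((hf.locallyIntegrable (by norm_num)).sub (hg.locallyIntegrable (by norm_num)))
    fun φ hφ hc => by
      have h1 := integrable_mul_of_memLp hf (h.memLp_surf hφ.continuous)
      have h2 := integrable_mul_of_memLp hg (h.memLp_surf hφ.continuous)
      simp only [smul_eq_mul, mul_comm (φ _), sub_mul]
      rw [integral_sub h1 h2, H φ hφ, sub_self]
  filter_upwards [this] with x hx
  exact sub_eq_zero.1 hx

theorem integral_surf_mul_eq_zero (hU : IsOpen U) {φ : E d → ℝ} (hs : tsupport φ ⊆ U) :
    ∫ x, g x * φ x ∂(surf U) = 0 := by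
  refine setIntegral_eq_zero_of_forall_eq_zero fun x hx => ?_
  have hx' : x ∈ closure U \ U := hU.frontier_eq ▸ hx
  rw [image_eq_zero_of_notMem_tsupport (f := φ) fun h => hx'.2 (hs h), mul_zero]

/-- A Green formula against smooth functions identifies Laplacian and normal derivative. -/
theorem IsOpenPolytope.memH1Normal_of (h : IsOpenPolytope U) (hv : MemH1 U v)
    (hf : MemLp f 2 (volume.restrict U)) (hg : MemLp g 2 (surf U))
    (H : ∀ φ : E d → ℝ, ContDiff ℝ ∞ φ →
      (∫ x in U, f x * φ x) + ∫ x in U, inner ℝ (wgrad U v x) (gradient φ x) =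
        ∫ x, g x * φ x ∂(surf U)) :
    MemH1Normal U v ∧ wlap U v =ᵐ[volume.restrict U] f ∧ normalDeriv U v =ᵐ[surf U] g := by
  have hlap : IsWeakLap U v f := by
    refine ⟨hf, fun φ hφ _ hs => ?_⟩
    have := H φ hφ
    rw [integral_surf_mul_eq_zero h.isOpen hs] at this
    linarith
  have hl := isWeakLap_wlap ⟨f, hlap⟩
  have hle := hl.ae_eq h.isOpen hlap
  have hn : IsNormalDeriv U v g := by
    refine ⟨hg, fun φ hφ => ?_⟩
    rw [integral_add (integrable_mul_of_memLp hl.1 (h.memLp_volume hφ.continuous))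
      (integrable_inner_of_memLp (hv.memLp_wgrad h.isOpen)
        (h.memLp_volume (continuous_gradient hφ))), ← H φ hφ]
    congr 1
    refine integral_congr_ae ?_
    filter_upwards [hle] with x hx
    rw [hx]
  refine ⟨⟨hv, ⟨f, hlap⟩, ⟨g, hn⟩⟩, hle, ?_⟩
  have hn' := isNormalDeriv_normalDeriv ⟨g, hn⟩
  refine h.ae_eq_of_integral_mul hn'.1 hg fun φ hφ => ?_
  rw [← hn'.2 φ hφ, ← hn.2 φ hφ]

theorem MemH1Normal.memLp_wlap (hv : MemH1Normal U v) : MemLp (wlap U v) 2 (volume.restrict U) :=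
  (isWeakLap_wlap hv.2.1).1

theorem MemH1Normal.memLp_normalDeriv (hv : MemH1Normal U v) :
    MemLp (normalDeriv U v) 2 (surf U) :=
  (isNormalDeriv_normalDeriv hv.2.2).1

theorem MemH1Normal.integral_smooth (h : IsOpenPolytope U) (hv : MemH1Normal U v)
    {φ : E d → ℝ} (hφ : ContDiff ℝ ∞ φ) :
    (∫ x in U, wlap U v x * φ x) + ∫ x in U, inner ℝ (wgrad U v x) (gradient φ x) =
      ∫ x, normalDeriv U v x * φ x ∂(surf U) := by
  rw [← (isNormalDeriv_normalDeriv hv.2.2).2 φ hφ,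
    integral_add (integrable_mul_of_memLp hv.memLp_wlap (h.memLp_volume hφ.continuous))
      (integrable_inner_of_memLp (hv.1.memLp_wgrad h.isOpen)
        (h.memLp_volume (continuous_gradient hφ)))]

/-- Green's formula. -/
theorem MemH1Normal.integral_wlap_mul_add (h : IsOpenPolytope U) (hv : MemH1Normal U v)
    (hw : MemH1 U w) :
    (∫ x in U, wlap U v x * w x) + ∫ x in U, inner ℝ (wgrad U v x) (wgrad U w x) =
      bdInner U (normalDeriv U v) (trace U w) := by
  obtain ⟨φ, hφ⟩ := h.exists_approxH1 hw
  have c0 : ∀ {α F : Type _} [MeasurableSpace α] [NormedAddCommGroup F] (μ : Measure α)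
      (f : α → F), Tendsto (fun _ : ℕ => eLpNorm (fun x => f x - f x) 2 μ) atTop (𝓝 0) := by
    intros; simp
  have l1 := tendsto_integral_mul_of_eLpNorm (fun _ => hv.memLp_wlap)
    (fun n => h.memLp_volume (hφ.contDiff n).continuous) hv.memLp_wlap hw.1 (c0 _ _) hφ.tendsto
  have m := hv.1.memLp_wgrad h.isOpen
  have l2 := tendsto_integral_inner_of_eLpNorm (fun _ => m)
    (fun n => h.memLp_volume (continuous_gradient (hφ.contDiff n))) m (hw.memLp_wgrad h.isOpen)
    (c0 _ _) hφ.tendsto_gradient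
  have l3 := tendsto_integral_mul_of_eLpNorm (fun _ => hv.memLp_normalDeriv)
    (fun n => h.memLp_surf (hφ.contDiff n).continuous) hv.memLp_normalDeriv (h.memLp_trace hw)
    (c0 _ _) (hφ.tendsto_trace h hw)
  exact tendsto_nhds_unique (l1.add l2)
    (l3.congr fun n => (hv.integral_smooth h (hφ.contDiff n)).symm)

theorem MemH1Normal.add_aux (h : IsOpenPolytope U) (hv : MemH1Normal U v) (hw : MemH1Normal U w) :
    MemH1Normal U (fun x => v x + w x) ∧
    wlap U (fun x => v x + w x) =ᵐ[volume.restrict U] (fun x => wlap U v x + wlap U w x) ∧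
    normalDeriv U (fun x => v x + w x) =ᵐ[surf U]
      fun x => normalDeriv U v x + normalDeriv U w x := by
  refine h.memH1Normal_of (hv.1.add h.isOpen hw.1) (hv.memLp_wlap.add hw.memLp_wlap)
    (hv.memLp_normalDeriv.add hw.memLp_normalDeriv) fun φ hφ => ?_
  have m1 := h.memLp_volume hφ.continuous (p := 2)
  have m2 := h.memLp_volume (continuous_gradient hφ) (p := 2)
  have m3 := h.memLp_surf hφ.continuous (p := 2)
  have e1 : ∫ x in U, inner ℝ (wgrad U (fun x => v x + w x) x) (gradient φ x) =
      ∫ x in U, (inner ℝ (wgrad U v x) (gradient φ x) + inner ℝ (wgrad U w x) (gradient φ x)) := by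
    refine integral_congr_ae ?_
    filter_upwards [wgrad_add h.isOpen hv.1 hw.1] with x hx
    rw [hx, inner_add_left]
  simp only [add_mul]
  rw [e1, integral_add (integrable_mul_of_memLp hv.memLp_wlap m1)
    (integrable_mul_of_memLp hw.memLp_wlap m1),
    integral_add (integrable_inner_of_memLp (hv.1.memLp_wgrad h.isOpen) m2)
    (integrable_inner_of_memLp (hw.1.memLp_wgrad h.isOpen) m2),
    integral_add (integrable_mul_of_memLp hv.memLp_normalDeriv m3)
    (integrable_mul_of_memLp hw.memLp_normalDeriv m3), ← hv.integral_smooth h hφ,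
    ← hw.integral_smooth h hφ]
  ring

theorem MemH1Normal.add (h : IsOpenPolytope U) (hv : MemH1Normal U v) (hw : MemH1Normal U w) :
    MemH1Normal U (fun x => v x + w x) := (hv.add_aux h hw).1

theorem MemH1Normal.wlap_add (h : IsOpenPolytope U) (hv : MemH1Normal U v)
    (hw : MemH1Normal U w) :
    wlap U (fun x => v x + w x) =ᵐ[volume.restrict U] fun x => wlap U v x + wlap U w x :=
  (hv.add_aux h hw).2.1

theorem MemH1Normal.normalDeriv_add (h : IsOpenPolytope U) (hv : MemH1Normal U v)
    (hw : MemH1Normal U w) :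
    normalDeriv U (fun x => v x + w x) =ᵐ[surf U]
      fun x => normalDeriv U v x + normalDeriv U w x :=
  (hv.add_aux h hw).2.2

theorem MemH1Normal.const_mul_aux (h : IsOpenPolytope U) (c : ℝ) (hv : MemH1Normal U v) :
    MemH1Normal U (fun x => c * v x) ∧
    wlap U (fun x => c * v x) =ᵐ[volume.restrict U] (fun x => c * wlap U v x) ∧
    normalDeriv U (fun x => c * v x) =ᵐ[surf U] fun x => c * normalDeriv U v x := by
  refine h.memH1Normal_of (hv.1.const_mul h.isOpen c) (hv.memLp_wlap.const_mul c)
    (hv.memLp_normalDeriv.const_mul c) fun φ hφ => ?_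
  have e1 : ∫ x in U, inner ℝ (wgrad U (fun x => c * v x) x) (gradient φ x) =
      ∫ x in U, c * inner ℝ (wgrad U v x) (gradient φ x) := by
    refine integral_congr_ae ?_
    filter_upwards [wgrad_const_mul h.isOpen c hv.1] with x hx
    rw [hx, real_inner_smul_left]
  simp only [mul_assoc]
  rw [e1, integral_const_mul, integral_const_mul, integral_const_mul, ← hv.integral_smooth h hφ]
  ring

theorem MemH1Normal.const_mul (h : IsOpenPolytope U) (c : ℝ) (hv : MemH1Normal U v) :
    MemH1Normal U (fun x => c * v x) := (hv.const_mul_aux h c).1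

theorem MemH1Normal.wlap_const_mul (h : IsOpenPolytope U) (c : ℝ) (hv : MemH1Normal U v) :
    wlap U (fun x => c * v x) =ᵐ[volume.restrict U] fun x => c * wlap U v x :=
  (hv.const_mul_aux h c).2.1

theorem MemH1Normal.normalDeriv_const_mul (h : IsOpenPolytope U) (c : ℝ)
    (hv : MemH1Normal U v) :
    normalDeriv U (fun x => c * v x) =ᵐ[surf U] fun x => c * normalDeriv U v x :=
  (hv.const_mul_aux h c).2.2

/-- The normal derivative of a function with vanishing gradient vanishes. -/
theorem MemH1Normal.normalDeriv_eq_zero (h : IsOpenPolytope U) (hv : MemH1Normal U v)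
    (h0 : wgrad U v =ᵐ[volume.restrict U] 0) : normalDeriv U v =ᵐ[surf U] 0 := by
  refine (h.memH1Normal_of (f := 0) hv.1 MemLp.zero MemLp.zero fun φ _ => ?_).2.2
  have : ∫ x in U, inner ℝ (wgrad U v x) (gradient φ x) = 0 := by
    refine integral_eq_zero_of_ae ?_
    filter_upwards [h0] with x hx
    simp [hx]
  rw [this]
  simp

theorem memLp_bounded_mul {μ : Measure (E d)} {C : ℝ} (hg : MemLp g 2 μ)
    (hf : AEStronglyMeasurable f μ) (hC : ∀ x, ‖f x‖ ≤ C) : MemLp (fun x => f x * g x) 2 μ :=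
  hg.of_le_mul (c := C) (hf.mul hg.1) (.of_forall fun x => by
    rw [norm_mul]; exact mul_le_mul_of_nonneg_right (hC x) (norm_nonneg _))

/-- The Gauss formula for `H¹` functions. -/
theorem IsOpenPolytope.integral_mul_fderiv_add (h : IsOpenPolytope U) {ν : E d → E d}
    (hνm : Measurable ν) (hνb : ∃ C, ∀ x, ‖ν x‖ ≤ C)
    (hdiv : ∀ ψ : E d → ℝ, ContDiff ℝ ∞ ψ → ∀ e : E d,
      ∫ x in U, fderiv ℝ ψ x e = ∫ x, ψ x * inner ℝ (ν x) e ∂(surf U))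
    (hw : MemH1 U w) {φ : E d → ℝ} (hφ : ContDiff ℝ ∞ φ) (e : E d) :
    (∫ x in U, w x * fderiv ℝ φ x e) + ∫ x in U, inner ℝ (wgrad U w x) (φ x • e) =
      ∫ x, trace U w x * (φ x * inner ℝ (ν x) e) ∂(surf U) := by
  obtain ⟨ψ, hψ⟩ := h.exists_approxH1 hw
  obtain ⟨C, hC⟩ := hνb
  have c0 : ∀ {α F : Type _} [MeasurableSpace α] [NormedAddCommGroup F] (μ : Measure α)
      (f : α → F), Tendsto (fun _ : ℕ => eLpNorm (fun x => f x - f x) 2 μ) atTop (𝓝 0) := by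
    intros; simp
  have m1 : MemLp (fun x => fderiv ℝ φ x e) 2 (volume.restrict U) :=
    h.memLp_volume ((hφ.continuous_fderiv (by simp)).clm_apply continuous_const)
  have m2 : MemLp (fun x => φ x • e) 2 (volume.restrict U) :=
    h.memLp_volume (hφ.continuous.smul continuous_const)
  have m3 : MemLp (fun x => φ x * inner ℝ (ν x) e) 2 (surf U) := by
    have := memLp_bounded_mul (f := fun x => inner ℝ (ν x) e) (C := C * ‖e‖)
      (h.memLp_surf hφ.continuous (p := 2)) (hνm.inner_const.aestronglyMeasurable)
      (fun x => (norm_inner_le_norm _ _).trans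
        (mul_le_mul_of_nonneg_right (hC x) (norm_nonneg _)))
    simpa only [mul_comm (φ _)] using this
  have l1 := tendsto_integral_mul_of_eLpNorm 
    (fun n => h.memLp_volume (hψ.contDiff n).continuous) (fun _ => m1) hw.1 m1 hψ.tendsto (c0 _ _)
  have l2 := tendsto_integral_inner_of_eLpNorm
    (fun n => h.memLp_volume (continuous_gradient (hψ.contDiff n))) (fun _ => m2)
    (hw.memLp_wgrad h.isOpen) m2 hψ.tendsto_gradient (c0 _ _)
  have l3 := tendsto_integral_mul_of_eLpNorm 
    (fun n => h.memLp_surf (hψ.contDiff n).continuous) (fun _ => m3) (h.memLp_trace hw) m3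
    (hψ.tendsto_trace h hw) (c0 _ _)
  refine tendsto_nhds_unique (l1.add l2) (l3.congr fun n => ?_)
  have hd := hdiv _ ((hψ.contDiff n).mul hφ) e
  simp only [← mul_assoc]
  rw [← hd, ← integral_add (integrable_mul_of_memLp (h.memLp_volume (hψ.contDiff n).continuous) m1)
    (integrable_inner_of_memLp (h.memLp_volume (continuous_gradient (hψ.contDiff n))) m2)]
  refine integral_congr_ae (.of_forall fun x => ?_)
  have := (((hψ.contDiff n).differentiable (by simp) x).hasFDerivAt.mul
    (hφ.differentiable (by simp) x).hasFDerivAt).fderiv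
  change fderiv ℝ (fun x => ψ n x * φ x) x e = _
  rw [show (fun x => ψ n x * φ x) = ψ n * φ from rfl, this]
  simp only [add_apply, smul_apply, smul_eq_mul,
    real_inner_smul_right, inner_gradient_left]

/-- The Laplacian is `∑ ∂_j ∂_j v` and the normal derivative is `∑ ν_j tr(∂_j v)`. The Gauss formula
for each `∂_j v ∈ H¹(U)` confirms this against smooth test functions. -/
theorem MemH2.memH1Normal (h : IsOpenPolytope U) (hv : MemH2 U v) : MemH1Normal U v := by
  obtain ⟨ν, hνm, hνb, hdiv, -⟩ := h.exists_normal
  have hνj : ∀ j, Measurable fun x => ν x j := fun j =>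
    (EuclideanSpace.proj (𝕜 := ℝ) j).continuous.measurable.comp hνm
  have hm : ∀ j, MemLp (fun x => ν x j * trace U (fun y => wgrad U v y j) x) 2 (surf U) := by
    obtain ⟨C, hC⟩ := hνb
    exact fun j => memLp_bounded_mul (h.memLp_trace (hv.2 j)) (hνj j).aestronglyMeasurable
      (fun x => (PiLp.norm_apply_le (ν x) j).trans (hC x))
  have hmf : ∀ j, MemLp (fun x => wgrad U (fun y => wgrad U v y j) x j) 2 (volume.restrict U) :=
    fun j => ((EuclideanSpace.proj (𝕜 := ℝ) j).comp_memLp' ((hv.2 j).memLp_wgrad h.isOpen))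
  refine (h.memH1Normal_of (f := fun x => ∑ j, wgrad U (fun y => wgrad U v y j) x j)
    (g := fun x => ∑ j, ν x j * trace U (fun y => wgrad U v y j) x) hv.1 
    (memLp_finsetSum _ fun j _ => hmf j)
    (memLp_finsetSum _ fun j _ => hm j) fun φ hφ => ?_).1
  have m1 := h.memLp_volume hφ.continuous (p := 2)
  have m3 := h.memLp_surf hφ.continuous (p := 2)
  have md : ∀ j, MemLp (fun x => fderiv ℝ φ x (EuclideanSpace.single j 1)) 2 (volume.restrict U) :=
    fun j => h.memLp_volume ((hφ.continuous_fderiv (by simp)).clm_apply continuous_const)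
  simp only [Finset.sum_mul]
  rw [integral_finsetSum _ fun j _ => integrable_mul_of_memLp (hmf j) m1,
    integral_finsetSum _ fun j _ => integrable_mul_of_memLp (hm j) m3]
  have e : ∀ x, inner ℝ (wgrad U v x) (gradient φ x) =
      ∑ j, wgrad U v x j * fderiv ℝ φ x (EuclideanSpace.single j 1) := fun x => by
    rw [inner_gradient_right, sum_mul_fderiv_single]
  simp only [e]
  rw [integral_finsetSum _ fun j _ => integrable_mul_of_memLp (hv.2 j).1 (md j),
    ← Finset.sum_add_distrib]
  refine Finset.sum_congr rfl fun j _ => ?_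
  have := h.integral_mul_fderiv_add hνm hνb hdiv (hv.2 j) hφ (EuclideanSpace.single j 1)
  simp only [inner_smul_right, EuclideanSpace.inner_single_right] at this
  rw [add_comm]
  convert this using 3
  · simp [mul_comm]
  · simp; ring

end Normal

/-! ### The local constants -/

/-- The map `A` factors through the range of `J`, which is finite-dimensional, so the factor is
continuous. -/
theorem exists_norm_le_of_ker_le {X Y Z : Type*} [AddCommGroup X] [Module ℝ X]
    [FiniteDimensional ℝ X] [NormedAddCommGroup Y] [NormedSpace ℝ Y] [NormedAddCommGroup Z]
    [NormedSpace ℝ Z] (A : X →ₗ[ℝ] Y) (J : X →ₗ[ℝ] Z) (h : LinearMap.ker J ≤ LinearMap.ker A) :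
    ∃ C : ℝ, ∀ x, ‖A x‖ ≤ C * ‖J x‖ := by
  obtain ⟨g, hg⟩ := J.rangeRestrict.exists_rightInverse_of_surjective J.range_rangeRestrict
  let B := (A ∘ₗ g).toContinuousLinearMap
  refine ⟨‖B‖, fun x => ?_⟩
  have h1 : A x = B (J.rangeRestrict x) := by
    change A x = A (g (J.rangeRestrict x))
    rw [← sub_eq_zero, ← map_sub]
    refine h (?_ : J _ = 0)
    have h2 : J.rangeRestrict (g (J.rangeRestrict x)) = J.rangeRestrict x :=
      LinearMap.congr_fun hg _
    rw [map_sub, sub_eq_zero]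
    exact (congrArg Subtype.val h2).symm
  rw [h1]
  exact B.le_opNorm _

section Local

variable {U : Set (E d)} {v w : E d → ℝ}

theorem IsOpenPolytope.measureReal_pos (h : IsOpenPolytope U) : 0 < volume.real U :=
  ENNReal.toReal_pos (h.isOpen.measure_pos volume h.1).ne' h.isBounded.measure_lt_top.ne

theorem MemH1.integrable (h : IsOpenPolytope U) (hv : MemH1 U v) :
    Integrable v (volume.restrict U) :=
  have := isFiniteMeasure_restrict_of_isBounded h.isBounded
  hv.1.integrable (by norm_num)

theorem mean_add (h : IsOpenPolytope U) (hv : MemH1 U v) (hw : MemH1 U w) :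
    mean U (fun x => v x + w x) = mean U v + mean U w := by
  simp only [mean]
  rw [integral_add (hv.integrable h) (hw.integrable h), mul_add]

theorem mean_const_mul (c : ℝ) : mean U (fun x => c * v x) = c * mean U v := by
  simp only [mean]
  rw [integral_const_mul]
  ring

theorem mean_const (h : IsOpenPolytope U) (c : ℝ) : mean U (fun _ => c) = c := by
  simp only [mean]
  rw [setIntegral_const, smul_eq_mul, inv_mul_cancel_left₀ h.measureReal_pos.ne']

theorem sinner_eq : sinner U v w = volume.real U * (mean U v * mean U w) +
    ∫ x in U, inner ℝ (wgrad U v x) (wgrad U w x) := by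
  rw [sinner, setIntegral_const, smul_eq_mul]

theorem l2grad_sq : l2grad U v ^ 2 = ∫ x in U, ‖wgrad U v x‖ ^ 2 :=
  Real.sq_sqrt (integral_nonneg fun _ => sq_nonneg _)

theorem l2_sq : l2 U v ^ 2 = ∫ x in U, v x ^ 2 :=
  Real.sq_sqrt (integral_nonneg fun _ => sq_nonneg _)

theorem bdNorm_sq : bdNorm U v ^ 2 = ∫ x, v x ^ 2 ∂(surf U) :=
  Real.sq_sqrt (integral_nonneg fun _ => sq_nonneg _)

theorem sinner_self : sinner U v v = volume.real U * mean U v ^ 2 + l2grad U v ^ 2 := by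
  rw [sinner_eq, l2grad_sq]
  simp only [real_inner_self_eq_norm_sq, sq]

theorem l2grad_nonneg : 0 ≤ l2grad U v := Real.sqrt_nonneg _

theorem l2_nonneg : 0 ≤ l2 U v := Real.sqrt_nonneg _

theorem bdNorm_nonneg : 0 ≤ bdNorm U v := Real.sqrt_nonneg _

theorem snorm_nonneg : 0 ≤ snorm U v := Real.sqrt_nonneg _

theorem l2grad_le_snorm : l2grad U v ≤ snorm U v := by
  refine Real.le_sqrt_of_sq_le ?_
  rw [sinner_self]
  have : 0 ≤ volume.real U * mean U v ^ 2 := by positivity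
  linarith

theorem mean_le_snorm : Real.sqrt (volume.real U) * |mean U v| ≤ snorm U v := by
  refine Real.le_sqrt_of_sq_le ?_
  rw [sinner_self, mul_pow, Real.sq_sqrt measureReal_nonneg, sq_abs]
  have : 0 ≤ l2grad U v ^ 2 := sq_nonneg _
  linarith

theorem l2grad_eq_toReal (h : IsOpenPolytope U) (hv : MemH1 U v) :
    l2grad U v = (eLpNorm (wgrad U v) 2 (volume.restrict U)).toReal := by
  rw [toReal_eLpNorm_two (hv.memLp_wgrad h.isOpen), l2grad]

theorem l2_eq_toReal (hv : MemLp v 2 (volume.restrict U)) :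
    l2 U v = (eLpNorm v 2 (volume.restrict U)).toReal := by
  rw [toReal_eLpNorm_two hv, l2]
  simp only [Real.norm_eq_abs, sq_abs]

theorem bdNorm_eq_toReal (hv : MemLp v 2 (surf U)) :
    bdNorm U v = (eLpNorm v 2 (surf U)).toReal := by
  rw [toReal_eLpNorm_two hv, bdNorm]
  simp only [Real.norm_eq_abs, sq_abs]

/-- Split `v` into its deviation from the mean, controlled by Poincaré, and the mean, whose `L²(U)`
norm is part of `snorm`. -/
theorem IsOpenPolytope.exists_l2_le_snorm (h : IsOpenPolytope U) :
    ∃ C : ℝ, 0 ≤ C ∧ ∀ v, MemH1 U v → l2 U v ≤ C * snorm U v := by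
  obtain ⟨K, hK⟩ := exists_poincare h.isOpen h.convex h.isBounded h.1
  refine ⟨K + 1, by positivity, fun v hv => ?_⟩
  have := isFiniteMeasure_restrict_of_isBounded h.isBounded
  have m0 : MemLp (fun _ : E d => mean U v) 2 (volume.restrict U) := memLp_const _
  have m1 : MemLp (fun x => v x - mean U v) 2 (volume.restrict U) := hv.1.sub m0
  have h1 : eLpNorm v 2 (volume.restrict U) ≤ K * eLpNorm (wgrad U v) 2 (volume.restrict U) +
      eLpNorm (fun _ : E d => mean U v) 2 (volume.restrict U) := by
    refine le_trans ?_ (add_le_add (hK v hv) le_rfl)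
    have e : v = (fun x => v x - mean U v) + fun _ => mean U v := by
      ext x; simp
    calc _ = eLpNorm ((fun x => v x - mean U v) + fun _ => mean U v) 2 (volume.restrict U) := by
          rw [← e]
      _ ≤ _ := eLpNorm_add_le m1.1 m0.1 (by norm_num)
  have t1 := (hv.memLp_wgrad h.isOpen).2.ne
  have h2 := ENNReal.toReal_mono (ENNReal.add_ne_top.2
    ⟨ENNReal.mul_ne_top ENNReal.coe_ne_top t1, m0.2.ne⟩) h1
  rw [ENNReal.toReal_add (ENNReal.mul_ne_top ENNReal.coe_ne_top t1) m0.2.ne, ENNReal.toReal_mul,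
    ← l2_eq_toReal hv.1, ← l2grad_eq_toReal h hv, ← l2_eq_toReal m0] at h2
  have h3 : l2 U (fun _ => mean U v) = Real.sqrt (volume.real U) * |mean U v| := by
    rw [l2, setIntegral_const, smul_eq_mul, Real.sqrt_mul measureReal_nonneg, Real.sqrt_sq_eq_abs]
  rw [h3] at h2
  change l2 U v ≤ (K : ℝ) * _ + _ at h2
  have h4 := mul_le_mul_of_nonneg_left (l2grad_le_snorm (U := U) (v := v)) K.coe_nonneg
  have h5 := mean_le_snorm (U := U) (v := v)
  rw [add_mul, one_mul]
  linarith

theorem IsOpenPolytope.exists_bdNorm_trace_le_snorm (h : IsOpenPolytope U) :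
    ∃ C : ℝ, 0 ≤ C ∧ ∀ v, MemH1 U v → bdNorm U (trace U v) ≤ C * snorm U v := by
  obtain ⟨C, hC0, hC⟩ := h.exists_l2_le_snorm
  obtain ⟨K, hK⟩ := h.exists_trace_le
  refine ⟨K * (C + 1), by positivity, fun v hv => ?_⟩
  have t1 := (hv.memLp_wgrad h.isOpen).2.ne
  have t2 := hv.1.2.ne
  have h2 := ENNReal.toReal_mono (ENNReal.mul_ne_top ENNReal.coe_ne_top
    (ENNReal.add_ne_top.2 ⟨t2, t1⟩)) (hK v hv)
  rw [ENNReal.toReal_mul, ENNReal.toReal_add t2 t1, ← l2_eq_toReal hv.1,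
    ← l2grad_eq_toReal h hv, ← bdNorm_eq_toReal (h.memLp_trace hv)] at h2
  refine h2.trans ?_
  rw [mul_assoc, add_mul, one_mul]
  exact mul_le_mul_of_nonneg_left (add_le_add (hC v hv) l2grad_le_snorm) K.coe_nonneg

theorem bddAbove_of_le_mul {P : (E d → ℝ) → Prop} {f s : (E d → ℝ) → ℝ} {C : ℝ} (hC : 0 ≤ C)
    (hs : ∀ v, 0 ≤ s v) (h : ∀ v, P v → f v ≤ C * s v) :
    BddAbove {r | ∃ v, P v ∧ r = f v / s v} := by
  refine ⟨C, ?_⟩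
  rintro _ ⟨v, hv, rfl⟩
  exact div_le_of_le_mul₀ (hs v) hC (h v hv)

/-- If `s v = 0`, the quotient is `0` by convention and carries no information about `f v`; there
the a priori bound supplies `f v ≤ 0`. -/
theorem le_sSup_mul_of_le_mul {P : (E d → ℝ) → Prop} {f s : (E d → ℝ) → ℝ} {C : ℝ} (hC : 0 ≤ C)
    (hs : ∀ v, 0 ≤ s v) (h : ∀ v, P v → f v ≤ C * s v) {v : E d → ℝ} (hv : P v) :
    f v ≤ sSup {r | ∃ v, P v ∧ r = f v / s v} * s v := by
  rcases (hs v).eq_or_lt with h0 | h0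
  · have := h v hv
    rw [← h0, mul_zero] at this ⊢
    exact this
  · rw [← div_le_iff₀ h0]
    exact le_csSup (bddAbove_of_le_mul hC hs h) ⟨v, hv, rfl⟩

variable {W : Submodule ℝ (E d → ℝ)}

theorem setA_eq : setA U W = {r | ∃ v, (MemH1 U v ∧ ∀ w ∈ W, sinner U v w = 0) ∧
    r = l2 U v / snorm U v} := by
  simp only [setA, and_assoc]

theorem setB_eq : setB U W = {r | ∃ v, (MemH1 U v ∧ ∀ w ∈ W, sinner U v w = 0) ∧
    r = bdNorm U (trace U v) / snorm U v} := by
  simp only [setB, and_assoc]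

theorem IsOpenPolytope.bddAbove_setA (h : IsOpenPolytope U) : BddAbove (setA U W) := by
  obtain ⟨C, hC0, hC⟩ := h.exists_l2_le_snorm
  rw [setA_eq]
  exact bddAbove_of_le_mul hC0 (fun _ => snorm_nonneg) fun v hv => hC v hv.1

theorem IsOpenPolytope.bddAbove_setB (h : IsOpenPolytope U) : BddAbove (setB U W) := by
  obtain ⟨C, hC0, hC⟩ := h.exists_bdNorm_trace_le_snorm
  rw [setB_eq]
  exact bddAbove_of_le_mul hC0 (fun _ => snorm_nonneg) fun v hv => hC v hv.1

theorem IsOpenPolytope.l2_le_cA (h : IsOpenPolytope U) (hv : MemH1 U v)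
    (ho : ∀ w ∈ W, sinner U v w = 0) : l2 U v ≤ cA U W * snorm U v := by
  obtain ⟨C, hC0, hC⟩ := h.exists_l2_le_snorm
  rw [cA, setA_eq]
  exact le_sSup_mul_of_le_mul (P := fun v => MemH1 U v ∧ ∀ w ∈ W, sinner U v w = 0)
    (f := l2 U) (s := snorm U) hC0 (fun _ => snorm_nonneg) (fun v hv => hC v hv.1) ⟨hv, ho⟩

theorem IsOpenPolytope.bdNorm_le_cB (h : IsOpenPolytope U) (hv : MemH1 U v)
    (ho : ∀ w ∈ W, sinner U v w = 0) : bdNorm U (trace U v) ≤ cB U W * snorm U v := by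
  obtain ⟨C, hC0, hC⟩ := h.exists_bdNorm_trace_le_snorm
  rw [cB, setB_eq]
  exact le_sSup_mul_of_le_mul (P := fun v => MemH1 U v ∧ ∀ w ∈ W, sinner U v w = 0)
    (f := fun v => bdNorm U (trace U v)) (s := snorm U) hC0 (fun _ => snorm_nonneg)
    (fun v hv => hC v hv.1) ⟨hv, ho⟩

theorem cA_nonneg : 0 ≤ cA U W := Real.sSup_nonneg (by
  rintro _ ⟨v, -, -, rfl⟩; exact div_nonneg l2_nonneg snorm_nonneg)

theorem cB_nonneg : 0 ≤ cB U W := Real.sSup_nonneg (by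
  rintro _ ⟨v, -, -, rfl⟩; exact div_nonneg bdNorm_nonneg snorm_nonneg)

theorem cD_nonneg : 0 ≤ cD U W := Real.sSup_nonneg (by
  rintro _ ⟨v, -, rfl⟩; exact div_nonneg bdNorm_nonneg snorm_nonneg)

/-! ### Hilbert space structure of `⟨·,·⟩_κ`, projections and finiteness of `d_κ` -/

/-- The space `H¹(U)`. -/
def h1Submodule (h : IsOpenPolytope U) : Submodule ℝ (E d → ℝ) where
  carrier := {v | MemH1 U v}
  add_mem' hv hw := MemH1.add h.isOpen hv hw
  zero_mem' := memH1_of_contDiff h.isBounded contDiff_const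
  smul_mem' c _ hv := MemH1.const_mul h.isOpen c hv

/-- The map that realises `sinner` as the inner product of a Hilbert space. -/
def h1Map (h : IsOpenPolytope U) :
    h1Submodule h →ₗ[ℝ] WithLp 2 (ℝ × Lp (E d) 2 (volume.restrict U)) where
  toFun v := WithLp.toLp 2 (Real.sqrt (volume.real U) * mean U v,
    (MemH1.memLp_wgrad h.isOpen v.2).toLp (wgrad U v))
  map_add' v w := by
    rw [← WithLp.toLp_add, Prod.mk_add_mk, ← mul_add]
    congr 2
    · congr 1
      exact mean_add h v.2 w.2
    · rw [← MemLp.toLp_add, MemLp.toLp_eq_toLp_iff]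
      exact wgrad_add h.isOpen v.2 w.2
  map_smul' c v := by
    rw [← WithLp.toLp_smul, Prod.smul_mk]
    congr 2
    · rw [smul_eq_mul, RingHom.id_apply, ← mul_assoc, mul_comm c, mul_assoc]
      congr 1
      exact mean_const_mul c
    · rw [RingHom.id_apply, ← MemLp.toLp_const_smul, MemLp.toLp_eq_toLp_iff]
      exact wgrad_const_mul h.isOpen c v.2

theorem inner_h1Map (h : IsOpenPolytope U) (v w : h1Submodule h) :
    inner ℝ (h1Map h v) (h1Map h w) = sinner U v w := by
  rw [sinner_eq, WithLp.prod_inner_apply]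
  simp only [h1Map, LinearMap.coe_mk, AddHom.coe_mk]
  rw [inner_toLp_two]
  congr 1
  simp only [RCLike.inner_apply, conj_trivial]
  linear_combination (mean U v * mean U w) * Real.mul_self_sqrt (measureReal_nonneg (μ := volume) (s := U))

theorem norm_h1Map (h : IsOpenPolytope U) (v : h1Submodule h) : ‖h1Map h v‖ = snorm U v := by
  rw [snorm, ← inner_h1Map h, real_inner_self_eq_norm_sq, Real.sqrt_sq (norm_nonneg _)]

/-- The image of `W` in the Hilbert space is finite-dimensional and hence admits orthogonal
projections. Any preimage of the projected vector serves, so `h1Map` need not be injective. -/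
theorem exists_sinner_projection (h : IsOpenPolytope U) [FiniteDimensional ℝ W]
    (hW : ∀ w ∈ W, MemH1 U w) (hv : MemH1 U v) :
    ∃ w ∈ W, ∀ z ∈ W, sinner U (fun x => v x - w x) z = 0 := by
  have hle : W ≤ h1Submodule h := hW
  let J := h1Map h ∘ₗ Submodule.inclusion hle
  have : FiniteDimensional ℝ (LinearMap.range J) := inferInstance
  obtain ⟨_, ⟨w, rfl⟩, ho⟩ := Submodule.HasOrthogonalProjection.exists_orthogonal
    (K := LinearMap.range J) (h1Map h ⟨v, hv⟩)
  refine ⟨w, w.2, fun z hz => ?_⟩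
  have := (Submodule.mem_orthogonal' _ _).1 ho (J ⟨z, hz⟩) ⟨_, rfl⟩
  have e : h1Map h ⟨v, hv⟩ - J w = h1Map h (⟨v, hv⟩ - Submodule.inclusion hle w) :=
    (map_sub (h1Map h) _ _).symm
  rw [e] at this
  exact (inner_h1Map h _ _).symm.trans this

theorem setD_eq : setD U W = {r | ∃ v, v ∈ W ∧
    r = bdNorm U (normalDeriv U v) / snorm U v} := rfl

/-- On a finite-dimensional space it suffices that the normal derivative vanishes when `snorm` does.
In that case the gradient is zero, and so is the normal derivative by Green's formula. -/
theorem exists_normalDeriv_le_snorm (h : IsOpenPolytope U) [FiniteDimensional ℝ W]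
    (hW : ∀ w ∈ W, MemH1Normal U w) :
    ∃ C : ℝ, 0 ≤ C ∧ ∀ v ∈ W, bdNorm U (normalDeriv U v) ≤ C * snorm U v := by
  have hle : W ≤ h1Submodule h := fun w hw => (hW w hw).1
  let A : W →ₗ[ℝ] Lp ℝ 2 (surf U) :=
    { toFun := fun v => (hW v v.2).memLp_normalDeriv.toLp _
      map_add' := fun v w => by
        rw [← MemLp.toLp_add, MemLp.toLp_eq_toLp_iff]
        exact (hW v v.2).normalDeriv_add h (hW w w.2)
      map_smul' := fun c v => by
        rw [RingHom.id_apply, ← MemLp.toLp_const_smul, MemLp.toLp_eq_toLp_iff]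
        exact (hW v v.2).normalDeriv_const_mul h c }
  have hA : ∀ v : W, ‖A v‖ = bdNorm U (normalDeriv U v) := fun v => by
    refine (norm_toLp_two (hW v v.2).memLp_normalDeriv).trans ?_
    simp only [Real.norm_eq_abs, sq_abs, bdNorm]
  obtain ⟨C, hC⟩ := exists_norm_le_of_ker_le A (h1Map h ∘ₗ Submodule.inclusion hle) fun v hv => by
    have h1 : snorm U v = 0 := by
      have : ‖h1Map h (Submodule.inclusion hle v)‖ = 0 := by
        rw [norm_eq_zero]; exact hv
      rwa [norm_h1Map] at this
    have h2 : l2grad U v = 0 := le_antisymm (h1 ▸ l2grad_le_snorm) l2grad_nonneg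
    have h3 : wgrad U v =ᵐ[volume.restrict U] 0 := by
      rw [l2grad_eq_toReal h (hW v v.2).1, ENNReal.toReal_eq_zero_iff] at h2
      have m := (hW v v.2).1.memLp_wgrad h.isOpen
      exact (eLpNorm_eq_zero_iff m.1 (by norm_num)).1 (h2.resolve_right m.2.ne)
    refine (MemLp.toLp_eq_toLp_iff (hW v v.2).memLp_normalDeriv MemLp.zero).2
      ((hW v v.2).normalDeriv_eq_zero h h3) |>.trans ?_
    exact MemLp.toLp_zero _
  refine ⟨|C|, abs_nonneg C, fun v hv => ?_⟩
  have := hC ⟨v, hv⟩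
  rw [hA, LinearMap.comp_apply, norm_h1Map] at this
  exact this.trans (mul_le_mul_of_nonneg_right (le_abs_self C) snorm_nonneg)

theorem bddAbove_setD (h : IsOpenPolytope U) [FiniteDimensional ℝ W]
    (hW : ∀ w ∈ W, MemH1Normal U w) : BddAbove (setD U W) := by
  obtain ⟨C, hC0, hC⟩ := exists_normalDeriv_le_snorm h hW
  rw [setD_eq]
  exact bddAbove_of_le_mul hC0 (fun _ => snorm_nonneg) hC

theorem bdNorm_le_cD (h : IsOpenPolytope U) [FiniteDimensional ℝ W]
    (hW : ∀ w ∈ W, MemH1Normal U w) (hv : v ∈ W) :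
    bdNorm U (normalDeriv U v) ≤ cD U W * snorm U v := by
  obtain ⟨C, hC0, hC⟩ := exists_normalDeriv_le_snorm h hW
  rw [cD, setD_eq]
  exact le_sSup_mul_of_le_mul (P := fun v => v ∈ W) (f := fun v => bdNorm U (normalDeriv U v))
    (s := snorm U) hC0 (fun _ => snorm_nonneg) hC hv

theorem wgrad_const (h : IsOpenPolytope U) (c : ℝ) :
    wgrad U (fun _ => c) =ᵐ[volume.restrict U] 0 := by
  filter_upwards [wgrad_of_contDiff h.isOpen (ψ := fun _ => c) contDiff_const] with x hx
  rw [hx]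
  simp [gradient]

theorem memH1_const (h : IsOpenPolytope U) (c : ℝ) : MemH1 U fun _ => c :=
  memH1_of_contDiff h.isBounded contDiff_const

theorem wgrad_sub_const (h : IsOpenPolytope U) (hv : MemH1 U v) (c : ℝ) :
    wgrad U (fun x => v x - c) =ᵐ[volume.restrict U] wgrad U v := by
  filter_upwards [wgrad_sub h.isOpen hv (memH1_const h c), wgrad_const h c] with x h1 h2
  rw [h1, h2]
  simp

theorem l2grad_congr (h : wgrad U v =ᵐ[volume.restrict U] wgrad U w) :
    l2grad U v = l2grad U w := by
  rw [l2grad, l2grad]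
  congr 1
  refine integral_congr_ae ?_
  filter_upwards [h] with x hx
  rw [hx]

theorem bdNorm_congr (h : v =ᵐ[surf U] w) : bdNorm U v = bdNorm U w := by
  rw [bdNorm, bdNorm]
  congr 1
  refine integral_congr_ae ?_
  filter_upwards [h] with x hx
  rw [hx]

/-- The normal derivative on the approximation space is controlled by the gradient. -/
theorem bdNorm_le_cD_mul_l2grad (h : IsOpenPolytope U) [FiniteDimensional ℝ W]
    (hW : ∀ w ∈ W, MemH1Normal U w) (h1 : (fun _ => (1 : ℝ)) ∈ W) (hv : v ∈ W) :
    bdNorm U (normalDeriv U v) ≤ cD U W * l2grad U v := by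
  have hc : ∀ c : ℝ, (fun _ : E d => c) ∈ W := fun c => by
    have := W.smul_mem c h1
    simpa [Pi.smul_def] using this
  -- Subtracting the mean stays in `W` and leaves the normal derivative unchanged, and it turns
  -- `snorm` into the norm of the gradient.
  have hz : (fun x => v x + -mean U v) ∈ W := W.add_mem hv (hc _)
  have hzb := bdNorm_le_cD h hW hz
  have e1 : snorm U (fun x => v x + -mean U v) = l2grad U v := by
    have : mean U (fun x => v x + -mean U v) = 0 := by
      rw [mean_add h (hW v hv).1 (memH1_const h _), mean_const h]
      ring
    rw [snorm, sinner_self, this, l2grad_congr (w := v), sq 0, zero_mul, mul_zero, zero_add,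
      Real.sqrt_sq l2grad_nonneg]
    exact wgrad_sub_const h (hW v hv).1 _
  have e2 : bdNorm U (normalDeriv U (fun x => v x + -mean U v)) = bdNorm U (normalDeriv U v) := by
    refine bdNorm_congr ?_
    filter_upwards [(hW v hv).normalDeriv_add h (hW _ (hc (-mean U v))),
      (hW _ (hc (-mean U v))).normalDeriv_eq_zero h (wgrad_const h _)] with x h1 h2
    rw [h1, h2]
    simp
  rwa [e1, e2] at hzb

/-- The remainder of the projection has mean zero, and its gradient and the gradient of the
projection are controlled by the gradient of the function. -/
theorem exists_projection (h : IsOpenPolytope U) [FiniteDimensional ℝ W]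
    (hW : ∀ w ∈ W, MemH1 U w) (h1 : (fun _ => (1 : ℝ)) ∈ W) (hv : MemH1 U v) :
    ∃ w ∈ W, (∀ z ∈ W, sinner U (fun x => v x - w x) z = 0) ∧
      snorm U (fun x => v x - w x) ≤ l2grad U v ∧ l2grad U w ≤ l2grad U v := by
  obtain ⟨w, hw, ho⟩ := exists_sinner_projection h hW hv
  have hz := hv.sub h.isOpen (hW w hw)
  -- Orthogonality to the constant `1` has no gradient part, so it says that the mean vanishes.
  have hm : mean U (fun x => v x - w x) = 0 := by
    have := ho _ h1
    rw [sinner_eq, mean_const h, integral_eq_zero_of_ae, add_zero, mul_one] at this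
    · exact (mul_eq_zero.1 this).resolve_left h.measureReal_pos.ne'
    · filter_upwards [wgrad_const h 1] with x hx
      rw [hx]
      simp
  have h2 := ho w hw
  rw [sinner_eq, hm, zero_mul, mul_zero, zero_add] at h2
  -- Because the remainder has mean zero, its orthogonality to `w` is orthogonality of the
  -- gradients, and Pythagoras applies.
  have h3 : l2grad U v ^ 2 = l2grad U (fun x => v x - w x) ^ 2 + l2grad U w ^ 2 := by
    have mz := hz.memLp_wgrad h.isOpen
    have mw := (hW w hw).memLp_wgrad h.isOpen
    have e : ∫ x in U, ‖wgrad U v x‖ ^ 2 =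
        ∫ x in U, ((inner ℝ (wgrad U (fun x => v x - w x) x) (wgrad U (fun x => v x - w x) x) +
          2 * inner ℝ (wgrad U (fun x => v x - w x) x) (wgrad U w x)) +
          inner ℝ (wgrad U w x) (wgrad U w x)) := by
      refine integral_congr_ae ?_
      filter_upwards [wgrad_sub h.isOpen hv (hW w hw)] with x hx
      have : wgrad U v x = wgrad U (fun x => v x - w x) x + wgrad U w x := by rw [hx]; simp
      rw [this, norm_add_sq_real, real_inner_self_eq_norm_sq, real_inner_self_eq_norm_sq]
    have i2 := (integrable_inner_of_memLp mz mw).const_mul 2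
    have i1 : Integrable (fun x => inner ℝ (wgrad U (fun x => v x - w x) x)
        (wgrad U (fun x => v x - w x) x) + 2 * inner ℝ (wgrad U (fun x => v x - w x) x)
        (wgrad U w x)) (volume.restrict U) := (integrable_inner_of_memLp mz mz).add i2
    rw [l2grad_sq, e, integral_add i1 (integrable_inner_of_memLp mw mw), integral_add (integrable_inner_of_memLp mz mz) i2,
      integral_const_mul, h2, l2grad_sq, l2grad_sq]
    simp only [real_inner_self_eq_norm_sq]
    ring
  refine ⟨w, hw, ho, ?_, ?_⟩
  · rw [snorm, sinner_self, hm]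
    refine Real.sqrt_le_iff.2 ⟨l2grad_nonneg, ?_⟩
    nlinarith [sq_nonneg (l2grad U w)]
  · refine abs_le_of_sq_le_sq' ?_ l2grad_nonneg |>.2
    nlinarith [sq_nonneg (l2grad U (fun x => v x - w x))]

end Local

/-! ### Geometry of the mesh -/

theorem exists_unit_separation {A B : Set (E d)} (hA : IsOpen A) (hA' : Convex ℝ A)
    (hAn : A.Nonempty) (hB : IsOpen B) (hB' : Convex ℝ B) (hBn : B.Nonempty) (h : Disjoint A B) :
    ∃ (n : E d) (c : ℝ), ‖n‖ = 1 ∧ (∀ a ∈ A, inner ℝ n a < c) ∧ ∀ b ∈ B, c < inner ℝ n b := by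
  obtain ⟨f, u, hfA, hfB⟩ := geometric_hahn_banach_open_open hA' hA hB' hB h
  set m := (InnerProductSpace.toDual ℝ (E d)).symm f
  have hm : ∀ a, inner ℝ m a = f a := fun a => InnerProductSpace.toDual_symm_apply
  obtain ⟨a, ha⟩ := hAn
  obtain ⟨b, hb⟩ := hBn
  have hm0 : m ≠ 0 := by
    intro h0
    have h1 := hfA a ha
    have h2 := hfB b hb
    rw [← hm, h0, inner_zero_left] at h1 h2
    linarith
  have hpos : 0 < ‖m‖⁻¹ := inv_pos.2 (norm_pos_iff.2 hm0)
  refine ⟨‖m‖⁻¹ • m, ‖m‖⁻¹ * u, by rw [norm_smul, norm_inv, norm_norm,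
    inv_mul_cancel₀ (norm_ne_zero_iff.2 hm0)], fun a ha => ?_, fun b hb => ?_⟩
  · rw [real_inner_smul_left, hm]
    exact mul_lt_mul_of_pos_left (hfA a ha) hpos
  · rw [real_inner_smul_left, hm]
    exact mul_lt_mul_of_pos_left (hfB b hb) hpos

/-- Three pairwise disjoint open convex sets have no common face of codimension one. -/
theorem euclideanHausdorffMeasure_inter_closure {A B C : Set (E d)} (hA : IsOpen A)
    (hA' : Convex ℝ A) (hAn : A.Nonempty) (hB : IsOpen B) (hB' : Convex ℝ B) (hBn : B.Nonempty)
    (hC : IsOpen C) (hC' : Convex ℝ C) (hCn : C.Nonempty) (hAB : Disjoint A B)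
    (hAC : Disjoint A C) (hBC : Disjoint B C) :
    (μHE[d - 1] : Measure (E d)) (closure A ∩ closure B ∩ closure C) = 0 := by
  obtain ⟨n₁, c₁, h₁, hA₁, hB₁⟩ := exists_unit_separation hA hA' hAn hB hB' hBn hAB
  obtain ⟨n₂, c₂, h₂, hA₂, hC₂⟩ := exists_unit_separation hA hA' hAn hC hC' hCn hAC
  obtain ⟨n₃, c₃, h₃, hB₃, hC₃⟩ := exists_unit_separation hB hB' hBn hC hC' hCn hBC
  have hle : ∀ {S : Set (E d)} {n : E d} {c : ℝ}, (∀ a ∈ S, inner ℝ n a < c) →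
      ∀ a ∈ closure S, inner ℝ n a ≤ c := fun {S n c} h a ha =>
    closure_minimal (t := {a | inner ℝ n a ≤ c}) (fun a ha => (h a ha).le)
      (isClosed_le (continuous_const.inner continuous_id) continuous_const) ha
  have hge : ∀ {S : Set (E d)} {n : E d} {c : ℝ}, (∀ a ∈ S, c < inner ℝ n a) →
      ∀ a ∈ closure S, c ≤ inner ℝ n a := fun {S n c} h a ha =>
    closure_minimal (t := {a | c ≤ inner ℝ n a}) (fun a ha => (h a ha).le)
      (isClosed_le continuous_const (continuous_const.inner continuous_id)) ha
  obtain ⟨a, ha⟩ := hAn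
  obtain ⟨b, hb⟩ := hBn
  obtain ⟨c, hc⟩ := hCn
  have hA1 := hA₁ a ha
  have hA2 := hA₂ a ha
  have hC2 := hC₂ c hc
  have hB1 := hB₁ b hb
  have hB3 := hB₃ b hb
  have hC3 := hC₃ c hc
  -- The triple intersection lies in all three separating hyperplanes, and two of them are distinct.
  -- If the hyperplanes for `A|B` and `A|C` agree, then `B` and `C` lie on the same side of it and
  -- `B|C` needs another one; otherwise the first two already differ, since `A` lies below both.
  by_cases h12 : n₂ = n₁ ∧ c₂ = c₁
  · refine measure_mono_null ?_ (euclideanHausdorffMeasure_inter_hyperplane h₁ h₃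
      (c := c₁) (c' := c₃) ?_ ?_)
    · rintro x ⟨⟨xA, xB⟩, xC⟩
      exact ⟨le_antisymm (hle hA₁ x xA) (hge hB₁ x xB), le_antisymm (hle hB₃ x xB) (hge hC₃ x xC)⟩
    · rintro ⟨rfl, rfl⟩
      linarith
    · rintro ⟨rfl, rfl⟩
      rw [h12.1, h12.2] at hC2
      rw [inner_neg_left] at hC3
      linarith
  · refine measure_mono_null ?_ (euclideanHausdorffMeasure_inter_hyperplane h₁ h₂
      (c := c₁) (c' := c₂) h12 ?_)
    · rintro x ⟨⟨xA, xB⟩, xC⟩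
      exact ⟨le_antisymm (hle hA₁ x xA) (hge hB₁ x xB), le_antisymm (hle hA₂ x xA) (hge hC₂ x xC)⟩
    · rintro ⟨rfl, rfl⟩
      rw [inner_neg_left] at hA2
      linarith

theorem closure_cube : closure (cube d) = {x | ∀ j, 0 ≤ x j ∧ x j ≤ 1} := by
  have h1 : cube d = PiLp.homeomorph 2 (fun _ : Fin d => ℝ) ⁻¹'
      Set.univ.pi fun _ => Set.Ioo (0 : ℝ) 1 := by
    ext x; simp [cube]; rfl
  have h2 : {x : E d | ∀ j, 0 ≤ x j ∧ x j ≤ 1} = PiLp.homeomorph 2 (fun _ : Fin d => ℝ) ⁻¹'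
      Set.univ.pi fun _ => Set.Icc (0 : ℝ) 1 := by
    ext x; simp [Pi.le_def, forall_and]; rfl
  rw [h1, h2, ← Homeomorph.preimage_closure, closure_pi_set]
  simp

theorem isOpen_cube : IsOpen (cube d) := by
  have h1 : cube d = PiLp.homeomorph 2 (fun _ : Fin d => ℝ) ⁻¹'
      Set.univ.pi fun _ => Set.Ioo (0 : ℝ) 1 := by
    ext x; simp [cube]; rfl
  rw [h1]
  exact (isOpen_set_pi Set.finite_univ fun _ _ => isOpen_Ioo).preimage (Homeomorph.continuous _)

@[simp] theorem latt_apply (k : Fin d → ℤ) (j : Fin d) : latt k j = k j := rfl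

theorem latt_zero : latt (0 : Fin d → ℤ) = 0 := by ext; simp

theorem latt_neg (k : Fin d → ℤ) : latt (-k) = -latt k := by ext; simp

theorem latt_add (k l : Fin d → ℤ) : latt (k + l) = latt k + latt l := by ext; simp

section Mesh

variable {ι : Type*} (M : Mesh d ι)

/-- An element of the periodic mesh. -/
def cell (p : ι × (Fin d → ℤ)) : Set (E d) := {x | x - latt p.2 ∈ M.elem p.1}

theorem closure_cell (p : ι × (Fin d → ℤ)) :
    closure (cell M p) = {x | x - latt p.2 ∈ closure (M.elem p.1)} :=
  ((Homeomorph.subRight (latt p.2)).preimage_closure (M.elem p.1)).symm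

theorem cell_zero (i : ι) : cell M (i, 0) = M.elem i := by
  ext x; simp [cell, latt_zero]

theorem isOpen_cell (p : ι × (Fin d → ℤ)) : IsOpen (cell M p) :=
  (M.polytope p.1).isOpen.preimage (continuous_id.sub continuous_const)

theorem convex_cell (p : ι × (Fin d → ℤ)) : Convex ℝ (cell M p) := by
  have := (M.polytope p.1).convex.translate_preimage_left (-latt p.2)
  simpa [cell, sub_eq_add_neg, Set.preimage] using this

theorem nonempty_cell (p : ι × (Fin d → ℤ)) : (cell M p).Nonempty := by
  obtain ⟨x, hx⟩ := (M.polytope p.1).1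
  exact ⟨x + latt p.2, by simpa [cell] using hx⟩

/-- The coordinates of a point of a cell lie strictly between consecutive integers, which determines
the translation; the rest is disjointness of the elements. -/
theorem disjoint_cell {p q : ι × (Fin d → ℤ)} (hpq : p ≠ q) :
    Disjoint (cell M p) (cell M q) := by
  rw [Set.disjoint_left]
  intro x hp hq
  have hk : p.2 = q.2 := by
    ext j
    have h1 := M.subset _ hp j
    have h2 := M.subset _ hq j
    simp only [PiLp.sub_apply, latt_apply] at h1 h2
    have h3 : (p.2 j : ℝ) < q.2 j + 1 := by linarith
    have h4 : (q.2 j : ℝ) < p.2 j + 1 := by linarith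
    norm_cast at h3 h4
    omega
  have hi : p.1 ≠ q.1 := fun h => hpq (Prod.ext h hk)
  have hq' : x - latt p.2 ∈ M.elem q.1 := hk ▸ hq
  exact Set.disjoint_left.1 (M.disjoint _ _ hi) hp hq'

theorem mem_closure_cell_bounds {p : ι × (Fin d → ℤ)} {x : E d} (hx : x ∈ closure (cell M p))
    (j : Fin d) : (p.2 j : ℝ) ≤ x j ∧ x j ≤ p.2 j + 1 := by
  rw [closure_cell] at hx
  have h1 := closure_mono (M.subset p.1) hx
  rw [closure_cube] at h1
  have := h1 j
  simp only [PiLp.sub_apply, latt_apply] at this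
  constructor <;> linarith

theorem exists_mem_closure_cell (x : E d) : ∃ p, x ∈ closure (cell M p) := by
  let k : Fin d → ℤ := fun j => ⌊x j⌋
  have h1 : x - latt k ∈ closure (cube d) := by
    rw [closure_cube]
    intro j
    simp only [PiLp.sub_apply, latt_apply, k]
    have h1 := Int.floor_le (x j)
    have h2 := Int.lt_floor_add_one (x j)
    constructor <;> linarith
  rw [← M.cover, Set.mem_iUnion] at h1
  obtain ⟨i, hi⟩ := h1
  exact ⟨(i, k), by rw [closure_cell]; exact hi⟩

theorem isNbr_iff {i : ι} {x : E d} {p : ι × (Fin d → ℤ)} :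
    IsNbr M i x p ↔ p ≠ (i, 0) ∧ x ∈ closure (cell M p) := by
  rw [closure_cell]; rfl

/-- The part of `∂κ_i` on which `p` is the only neighbour. -/
def facePart (i : ι) (p : ι × (Fin d → ℤ)) : Set (E d) :=
  {x | x ∈ closure (M.elem i) ∧ IsNbr M i x p ∧ ∀ q, IsNbr M i x q → q = p}

theorem facePart_subset_frontier (i : ι) (p : ι × (Fin d → ℤ)) :
    facePart M i p ⊆ frontier (M.elem i) := by
  rintro x ⟨hx, hp, -⟩
  rw [(M.polytope i).isOpen.frontier_eq]
  refine ⟨hx, fun hxi => ?_⟩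
  rw [isNbr_iff] at hp
  have := (disjoint_cell M hp.1.symm).closure_right (isOpen_cell M _)
  rw [cell_zero] at this
  exact Set.disjoint_left.1 this hxi hp.2

variable [Finite ι]

theorem locallyFinite_closure_cell : LocallyFinite fun p => closure (cell M p) := by
  intro x
  refine ⟨Metric.ball x 1, Metric.ball_mem_nhds x one_pos, ?_⟩
  have hf : (Set.univ ×ˢ Set.Icc (fun j => ⌊x j⌋ - 3) (fun j => ⌊x j⌋ + 3) :
      Set (ι × (Fin d → ℤ))).Finite := Set.finite_univ.prod (Set.finite_Icc _ _)
  refine hf.subset ?_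
  rintro p ⟨y, hy, hyx⟩
  have hb : ∀ j, (⌊x j⌋ : ℤ) - 3 ≤ p.2 j ∧ p.2 j ≤ ⌊x j⌋ + 3 := by
    intro j
    have h1 := mem_closure_cell_bounds M hy j
    have h2 : |y j - x j| < 1 := by
      have := PiLp.norm_apply_le (y - x) j
      rw [Metric.mem_ball, dist_eq_norm] at hyx
      exact this.trans_lt hyx
    rw [abs_lt] at h2
    have h3 := Int.floor_le (x j)
    have h4 := Int.lt_floor_add_one (x j)
    have h5 : ((⌊x j⌋ : ℤ) : ℝ) - 3 ≤ p.2 j := by linarith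
    have h6 : (p.2 j : ℝ) ≤ ⌊x j⌋ + 3 := by linarith
    exact ⟨by exact_mod_cast h5, by exact_mod_cast h6⟩
  exact ⟨Set.mem_univ _, fun j => (hb j).1, fun j => (hb j).2⟩

/-- The union of some closed cells is closed. -/
theorem isClosed_biUnion_closure_cell (P : ι × (Fin d → ℤ) → Prop) :
    IsClosed (⋃ p : {p // P p}, closure (cell M p)) :=
  ((locallyFinite_closure_cell M).comp_injective Subtype.val_injective).isClosed_iUnion
    fun _ => isClosed_closure

/-- A point outside the other closed cells is near it surrounded by the remaining ones. -/
theorem exists_isNbr {i : ι} {x : E d} (hx : x ∈ frontier (M.elem i)) : ∃ p, IsNbr M i x p := by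
  by_contra! hn
  have hP := isClosed_biUnion_closure_cell M (fun p => p ≠ (i, 0))
  have hxP : x ∈ (⋃ p : {p : ι × (Fin d → ℤ) // p ≠ (i, 0)}, closure (cell M p))ᶜ := by
    simp only [Set.mem_compl_iff, Set.mem_iUnion, not_exists]
    rintro ⟨p, hp⟩ hx
    rw [closure_cell] at hx
    exact hn p ⟨hp, hx⟩
  -- The closed cells cover the space, so the complement of all the others is an open subset of the
  -- closure of the element. By convexity the interior of that closure is the element itself, which
  -- contains no boundary point.
  have hsub : (⋃ p : {p : ι × (Fin d → ℤ) // p ≠ (i, 0)}, closure (cell M p))ᶜ ⊆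
      closure (M.elem i) := by
    intro y hy
    obtain ⟨p, hp⟩ := exists_mem_closure_cell M y
    by_cases hpi : p = (i, 0)
    · rwa [hpi, cell_zero] at hp
    · exact absurd (Set.mem_iUnion.2 ⟨⟨p, hpi⟩, hp⟩) hy
  have hint := interior_maximal hsub hP.isOpen_compl hxP
  have hpol := M.polytope i
  rw [hpol.convex.interior_closure_eq_interior_of_nonempty_interior
    (by rw [hpol.isOpen.interior_eq]; exact hpol.1), hpol.isOpen.interior_eq] at hint
  have hx' : x ∈ closure (M.elem i) \ M.elem i := hpol.isOpen.frontier_eq ▸ hx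
  exact hx'.2 hint

end Mesh

/-! ### Boundary integrals over the mesh -/

section MeshBoundary

variable {ι : Type*} (M : Mesh d ι)

theorem facePart_eq (i : ι) (p : ι × (Fin d → ℤ)) : facePart M i p =
    (closure (M.elem i) ∩ {x | IsNbr M i x p}) ∩
      ⋂ q : {q : ι × (Fin d → ℤ) // q ≠ p}, {x | IsNbr M i x q}ᶜ := by
  ext x
  simp only [facePart, Set.mem_inter_iff, Set.mem_iInter, Set.mem_compl_iff, Subtype.forall,
    and_assoc]
  refine and_congr_right fun _ => and_congr_right fun _ => ?_
  exact forall_congr' fun q => by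
    change (IsNbr M i x q → _) ↔ (q ≠ p → ¬ IsNbr M i x q)
    tauto

theorem measurableSet_isNbr (i : ι) (p : ι × (Fin d → ℤ)) : MeasurableSet {x | IsNbr M i x p} := by
  by_cases h : p = (i, 0)
  · simp [IsNbr, h]
  · have : {x | IsNbr M i x p} = closure (cell M p) := by
      ext x
      change IsNbr M i x p ↔ _
      rw [isNbr_iff]
      simp [h]
    rw [this]
    exact isClosed_closure.measurableSet

/-- Translation by `-latt k` exchanges the roles of the two cells at the face and carries uniqueness
of the neighbour along. -/
theorem facePart_symm {i j : ι} {k : Fin d → ℤ} {x : E d} (hx : x ∈ facePart M i (j, k)) :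
    x - latt k ∈ facePart M j (i, -k) := by
  obtain ⟨h1, ⟨h2, h3⟩, h4⟩ := hx
  refine ⟨h3, ⟨?_, ?_⟩, ?_⟩
  · intro h
    simp only [Prod.mk.injEq, neg_eq_zero] at h
    exact h2 (by rw [h.1, h.2])
  · simpa [latt_neg] using h1
  · rintro ⟨l, m⟩ ⟨h5, h6⟩
    by_cases hq : ((l, k + m) : ι × (Fin d → ℤ)) = (i, 0)
    · simp only [Prod.mk.injEq] at hq
      rw [hq.1, eq_neg_of_add_eq_zero_right hq.2]
    · have := h4 (l, k + m) ⟨hq, by simpa [latt_add, sub_sub] using h6⟩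
      simp only [Prod.mk.injEq, add_eq_left] at this
      exact absurd (by rw [this.1, this.2]) h5

theorem preimage_facePart (i j : ι) (k : Fin d → ℤ) :
    (fun x => x - latt k) ⁻¹' facePart M j (i, -k) = facePart M i (j, k) := by
  ext x
  refine ⟨fun h => ?_, facePart_symm M⟩
  have := facePart_symm M (Set.mem_preimage.1 h)
  simpa [latt_neg] using this

theorem nbrVal_eq {f : ι → E d → ℝ} {i : ι} {p : ι × (Fin d → ℤ)} {x : E d}
    (hx : x ∈ facePart M i p) : nbrVal M f i x = f p.1 (x - latt p.2) := by
  have h : ∃! p, IsNbr M i x p := ⟨p, hx.2.1, hx.2.2⟩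
  rw [nbrVal, dif_pos h, hx.2.2 _ h.choose_spec.1]

theorem disjoint_facePart {i : ι} {p q : ι × (Fin d → ℤ)} (hpq : p ≠ q) :
    Disjoint (facePart M i p) (facePart M i q) :=
  Set.disjoint_left.2 fun _ hp hq => hpq (hq.2.2 p hp.2.1)

theorem restrict_facePart_le (i : ι) (p : ι × (Fin d → ℤ)) :
    (μHE[d - 1] : Measure (E d)).restrict (facePart M i p) ≤ surf (M.elem i) :=
  Measure.restrict_mono_set _ (facePart_subset_frontier M i p)

theorem gammaHat_nonneg {γ : ι → ℝ} (hγ : ∀ i, 0 ≤ γ i) (i : ι) : 0 ≤ gammaHat M γ i := by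
  refine Real.sSup_nonneg ?_
  rintro _ ⟨p, -, -, rfl⟩
  have := hγ i
  have := hγ p.1
  positivity

variable [Fintype ι]

theorem measurableSet_facePart (i : ι) (p : ι × (Fin d → ℤ)) : MeasurableSet (facePart M i p) := by
  rw [facePart_eq]
  exact (isClosed_closure.measurableSet.inter (measurableSet_isNbr M i p)).inter
    (MeasurableSet.iInter fun q => (measurableSet_isNbr M i q).compl)

theorem measurePreserving_facePart (i j : ι) (k : Fin d → ℤ) :
    MeasurePreserving (fun x => x - latt k) ((μHE[d - 1]).restrict (facePart M i (j, k)))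
      ((μHE[d - 1] : Measure (E d)).restrict (facePart M j (i, -k))) := by
  have h := measurePreserving_sub_right (μHE[d - 1] : Measure (E d)) (latt k)
  have := h.restrict_preimage (measurableSet_facePart M j (i, -k))
  rwa [preimage_facePart] at this

theorem surf_restrict_facePart (i : ι) (p : ι × (Fin d → ℤ)) :
    (surf (M.elem i)).restrict (facePart M i p) = (μHE[d - 1]).restrict (facePart M i p) := by
  rw [surf, Measure.restrict_restrict (measurableSet_facePart M i p),
    Set.inter_eq_left.2 (facePart_subset_frontier M i p)]

/-- The index set of the neighbours of the elements. -/
def nbrs (d : ℕ) (ι : Type*) [Fintype ι] : Finset (ι × (Fin d → ℤ)) :=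
  Finset.univ ×ˢ Finset.Icc (-1) 1

theorem mem_nbrs {i : ι} {p : ι × (Fin d → ℤ)} {x : E d} (hx : x ∈ facePart M i p) :
    p ∈ nbrs d ι := by
  have h1 : x ∈ closure (cell M (i, 0)) := by rw [cell_zero]; exact hx.1
  have h2 := ((isNbr_iff M).1 hx.2.1).2
  have h : ∀ j, -1 ≤ p.2 j ∧ p.2 j ≤ 1 := fun j => by
    have h3 := mem_closure_cell_bounds M h1 j
    have h4 := mem_closure_cell_bounds M h2 j
    simp only [Pi.zero_apply, Int.cast_zero] at h3
    have h5 : (-1 : ℝ) ≤ p.2 j := by linarith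
    have h6 : (p.2 j : ℝ) ≤ 1 := by linarith
    exact ⟨by exact_mod_cast h5, by exact_mod_cast h6⟩
  simp only [nbrs, Finset.mem_product, Finset.mem_univ, true_and, Finset.mem_Icc]
  exact ⟨fun j => (h j).1, fun j => (h j).2⟩

/-- Almost every point of `∂κ_i` has exactly one neighbour. -/
theorem ae_exists_mem_facePart (i : ι) :
    ∀ᵐ x ∂(surf (M.elem i)), ∃ p ∈ nbrs d ι, x ∈ facePart M i p := by
  have h1 : ∀ᵐ x ∂(surf (M.elem i)), x ∈ frontier (M.elem i) :=
    ae_restrict_mem isClosed_frontier.measurableSet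
  -- Two different neighbours at one point would place it in the closures of three disjoint convex
  -- cells. This is a null set, and there are only countably many pairs of cells.
  have h2 : ∀ᵐ x ∂(surf (M.elem i)), ∀ p q : ι × (Fin d → ℤ), p ≠ (i, 0) → q ≠ (i, 0) → p ≠ q →
      ¬ (x ∈ closure (cell M (i, 0)) ∩ closure (cell M p) ∩ closure (cell M q)) := by
    rw [ae_all_iff]; intro p
    rw [ae_all_iff]; intro q
    by_cases hp : p = (i, 0)
    · exact .of_forall fun _ h => absurd hp h
    by_cases hq : q = (i, 0)
    · exact .of_forall fun _ _ h => absurd hq h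
    by_cases hpq : p = q
    · exact .of_forall fun _ _ _ h => absurd hpq h
    have h0 := euclideanHausdorffMeasure_inter_closure (isOpen_cell M (i, 0)) (convex_cell M _)
      (nonempty_cell M _) (isOpen_cell M p) (convex_cell M _) (nonempty_cell M _)
      (isOpen_cell M q) (convex_cell M _) (nonempty_cell M _)
      (disjoint_cell M (Ne.symm hp)) (disjoint_cell M (Ne.symm hq)) (disjoint_cell M hpq)
    have : ∀ᵐ x ∂(surf (M.elem i)),
        x ∉ closure (cell M (i, 0)) ∩ closure (cell M p) ∩ closure (cell M q) :=
      ae_restrict_of_ae (measure_eq_zero_iff_ae_notMem.1 h0)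
    filter_upwards [this] with x hx _ _ _
    exact hx
  filter_upwards [h1, h2] with x hx hx2
  obtain ⟨p, hp⟩ := exists_isNbr M hx
  have hxi : x ∈ closure (M.elem i) := frontier_subset_closure hx
  have hxp : x ∈ facePart M i p := by
    refine ⟨hxi, hp, fun q hq => ?_⟩
    by_contra hne
    rw [isNbr_iff] at hp hq
    exact hx2 p q hp.1 hq.1 (Ne.symm hne) ⟨⟨by rwa [cell_zero], hp.2⟩, hq.2⟩
  exact ⟨p, mem_nbrs M hxp, hxp⟩

theorem surf_eq_restrict (i : ι) : surf (M.elem i) =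
    (μHE[d - 1]).restrict (⋃ p ∈ nbrs d ι, facePart M i p) := by
  have hm : MeasurableSet (⋃ p ∈ nbrs d ι, facePart M i p) :=
    Finset.measurableSet_biUnion _ fun p _ => measurableSet_facePart M i p
  have h := Measure.restrict_eq_self_of_ae_mem (μ := surf (M.elem i))
    (s := ⋃ p ∈ nbrs d ι, facePart M i p) (by
      filter_upwards [ae_exists_mem_facePart M i] with x hx
      simpa using hx)
  rw [← h, surf, Measure.restrict_restrict hm, Set.inter_eq_left.2]
  exact Set.iUnion₂_subset fun p _ => facePart_subset_frontier M i p

theorem integral_surf_eq_sum {f : E d → ℝ} (i : ι) (hf : Integrable f (surf (M.elem i))) :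
    ∫ x, f x ∂(surf (M.elem i)) =
      ∑ j, ∑ k ∈ Finset.Icc (-1) 1, ∫ x in facePart M i (j, k), f x ∂μHE[d - 1] := by
  rw [surf_eq_restrict, integral_biUnion_finset _ (fun p _ => measurableSet_facePart M i p)
    (fun p _ q _ hpq => disjoint_facePart M hpq)
    (fun p _ => hf.mono_measure (restrict_facePart_le M i p)), nbrs, Finset.sum_product]

/-- A property that holds almost everywhere on the boundaries holds almost everywhere on the
other sides. -/
theorem ae_nbr {P : ι → E d → Prop} (hP : ∀ j, ∀ᵐ x ∂(surf (M.elem j)), P j x) (i : ι) :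
    ∀ᵐ x ∂(surf (M.elem i)), ∀ p, x ∈ facePart M i p → P p.1 (x - latt p.2) := by
  rw [ae_all_iff]
  rintro ⟨j, k⟩
  have h1 : ∀ᵐ x ∂(μHE[d - 1]).restrict (facePart M j (i, -k)), P j x :=
    ae_mono (restrict_facePart_le M j _) (hP j)
  have h2 := (measurePreserving_facePart M i j k).quasiMeasurePreserving.ae h1
  rw [← surf_restrict_facePart, ae_restrict_iff' (measurableSet_facePart M i _)] at h2
  exact h2

theorem nbrVal_congr {f g : ι → E d → ℝ} (h : ∀ j, f j =ᵐ[surf (M.elem j)] g j) (i : ι) :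
    nbrVal M f i =ᵐ[surf (M.elem i)] nbrVal M g i := by
  filter_upwards [ae_nbr M h i, ae_exists_mem_facePart M i] with x hx ⟨p, _, hp⟩
  rw [nbrVal_eq M hp, nbrVal_eq M hp, hx p hp]

theorem nbrVal_nbrVal (f : ι → E d → ℝ) (i : ι) :
    nbrVal M (nbrVal M f) i =ᵐ[surf (M.elem i)] f i := by
  filter_upwards [ae_exists_mem_facePart M i] with x ⟨⟨j, k⟩, _, hp⟩
  rw [nbrVal_eq M hp, nbrVal_eq M (facePart_symm M hp)]
  simp [latt_neg]

theorem memLp_nbrVal {f : ι → E d → ℝ} (hf : ∀ j, MemLp (f j) 2 (surf (M.elem j))) (i : ι) :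
    MemLp (nbrVal M f i) 2 (surf (M.elem i)) := by
  have h1 : ∀ p : ι × (Fin d → ℤ),
      MemLp ((facePart M i p).indicator fun x => f p.1 (x - latt p.2)) 2 (surf (M.elem i)) := by
    rintro ⟨j, k⟩
    rw [memLp_indicator_iff_restrict (measurableSet_facePart M i _), surf_restrict_facePart]
    exact ((hf j).mono_measure (restrict_facePart_le M j (i, -k))).comp_measurePreserving
      (measurePreserving_facePart M i j k)
  refine (memLp_finsetSum (nbrs d ι) fun p _ => h1 p).ae_eq ?_
  filter_upwards [ae_exists_mem_facePart M i] with x ⟨p, hpn, hp⟩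
  rw [nbrVal_eq M hp, Finset.sum_eq_single_of_mem p hpn, Set.indicator_of_mem hp]
  intro q _ hq
  exact Set.indicator_of_notMem (fun h => hq (hp.2.2 q h.2.1)) _

/-- Passing to the other side is symmetric for the boundary scalar products. -/
theorem sum_integral_mul_nbrVal {f g : ι → E d → ℝ} (hf : ∀ j, MemLp (f j) 2 (surf (M.elem j)))
    (hg : ∀ j, MemLp (g j) 2 (surf (M.elem j))) :
    ∑ i, ∫ x, f i x * nbrVal M g i x ∂(surf (M.elem i)) =
      ∑ i, ∫ x, nbrVal M f i x * g i x ∂(surf (M.elem i)) := by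
  have h1 : ∀ i, ∫ x, f i x * nbrVal M g i x ∂(surf (M.elem i)) =
      ∑ j, ∑ k ∈ Finset.Icc (-1) 1,
        ∫ x in facePart M i (j, k), f i x * g j (x - latt k) ∂μHE[d - 1] := fun i => by
    rw [integral_surf_eq_sum M i (integrable_mul_of_memLp (hf i) (memLp_nbrVal M hg i))]
    refine Finset.sum_congr rfl fun j _ => Finset.sum_congr rfl fun k _ => ?_
    refine setIntegral_congr_fun (measurableSet_facePart M i _) fun x hx => ?_
    simp only [nbrVal_eq M hx]
  -- Reindexing by `k ↦ -k` matches the face of `i` towards `(j, k)` with the face of `j` towards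
  -- `(i, -k)`; the two are translates of each other by `latt k`.
  have h2 : ∀ j, ∫ x, nbrVal M f j x * g j x ∂(surf (M.elem j)) =
      ∑ i, ∑ k ∈ Finset.Icc (-1) 1,
        ∫ x in facePart M j (i, -k), f i (x + latt k) * g j x ∂μHE[d - 1] := fun j => by
    rw [integral_surf_eq_sum M j (integrable_mul_of_memLp (memLp_nbrVal M hf j) (hg j))]
    refine Finset.sum_congr rfl fun i _ => ?_
    refine Finset.sum_nbij' (fun k => -k) (fun k => -k) ?_ ?_ (by simp) (by simp) ?_
    · intro k hk
      rw [Finset.mem_Icc] at hk ⊢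
      exact ⟨neg_le_neg hk.2, neg_le.2 hk.1⟩
    · intro k hk
      rw [Finset.mem_Icc] at hk ⊢
      exact ⟨neg_le_neg hk.2, neg_le.2 hk.1⟩
    · intro k _
      rw [neg_neg]
      refine setIntegral_congr_fun (measurableSet_facePart M j _) fun x hx => ?_
      simp only [nbrVal_eq M hx, latt_neg, sub_eq_add_neg]
  simp only [h1, h2]
  rw [Finset.sum_comm]
  refine Finset.sum_congr rfl fun j _ => Finset.sum_congr rfl fun i _ =>
    Finset.sum_congr rfl fun k _ => ?_
  rw [← (measurePreserving_facePart M i j k).integral_comp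
    (Homeomorph.subRight (latt k)).measurableEmbedding]
  simp

theorem bddAbove_gammaHat (γ : ι → ℝ) (i : ι) :
    BddAbove {r | ∃ p : ι × (Fin d → ℤ), p ≠ (i, 0) ∧
      surf (M.elem i) {x | x - latt p.2 ∈ closure (M.elem p.1)} ≠ 0 ∧ r = (γ i + γ p.1) / 2} := by
  refine ((Set.finite_range fun j => (γ i + γ j) / 2).subset ?_).bddAbove
  rintro _ ⟨p, -, -, rfl⟩
  exact ⟨p.1, rfl⟩

/-- Almost everywhere on `∂κ_i` the average of `γ` is at most `γ̂_κ`. -/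
theorem ae_average_le_gammaHat (γ : ι → ℝ) (i : ι) :
    ∀ᵐ x ∂(surf (M.elem i)), (γ i + nbrVal M (fun j _ => γ j) i x) / 2 ≤ gammaHat M γ i := by
  -- The maximum in `gammaHat` sees only neighbours that share boundary of positive measure. The
  -- points reached by any of the other, countably many, cells are discarded here.
  have h1 : ∀ᵐ x ∂(surf (M.elem i)), ∀ p : ι × (Fin d → ℤ),
      surf (M.elem i) {x | x - latt p.2 ∈ closure (M.elem p.1)} = 0 →
        x ∉ {x | x - latt p.2 ∈ closure (M.elem p.1)} := by
    rw [ae_all_iff]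
    intro p
    by_cases h : surf (M.elem i) {x | x - latt p.2 ∈ closure (M.elem p.1)} = 0
    · filter_upwards [measure_eq_zero_iff_ae_notMem.1 h] with x hx _
      exact hx
    · exact .of_forall fun _ h' => absurd h' h
  filter_upwards [h1, ae_exists_mem_facePart M i] with x hx ⟨p, _, hp⟩
  rw [nbrVal_eq M hp]
  exact le_csSup (bddAbove_gammaHat M γ i) ⟨p, hp.2.1.1, fun h => hx p h hp.2.1.2, rfl⟩

end MeshBoundary

/-! ### Periodic functions -/

theorem convex_cube : Convex ℝ (cube d) := by
  intro x hx y hy a b ha hb hab j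
  simp only [PiLp.add_apply, PiLp.smul_apply, smul_eq_mul]
  have := (convex_Ioo (0 : ℝ) 1) ⟨(hx j).1, (hx j).2⟩ ⟨(hy j).1, (hy j).2⟩ ha hb hab
  simpa using this

theorem isBounded_cube : Bornology.IsBounded (cube d) := by
  have h1 : cube d = PiLp.homeomorph 2 (fun _ : Fin d => ℝ) ⁻¹'
      Set.univ.pi fun _ => Set.Ioo (0 : ℝ) 1 := by
    ext x; simp [cube]; rfl
  refine (Bornology.IsBounded.subset (t := PiLp.homeomorph 2 (fun _ : Fin d => ℝ) ⁻¹'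
      Set.univ.pi fun _ => Set.Icc (0 : ℝ) 1) ?_ ?_)
  · refine IsCompact.isBounded ((PiLp.homeomorph 2 (fun _ : Fin d => ℝ)).isCompact_preimage.2 ?_)
    exact isCompact_univ_pi fun _ => isCompact_Icc
  · rw [h1]
    exact Set.preimage_mono (Set.pi_mono fun _ _ => Set.Ioo_subset_Icc_self)

/-- A periodic function that is square integrable over a period is locally square integrable. -/
theorem memLp_restrict_of_periodic {F : Type*} [NormedAddCommGroup F] {f : E d → F}
    (hm : AEStronglyMeasurable f volume) (hf : MemLp f 2 (volume.restrict (cube d)))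
    (hp : ∀ k : Fin d → ℤ, (fun x => f (x + latt k)) =ᵐ[volume] f) {B : Set (E d)}
    (hB : Bornology.IsBounded B) : MemLp f 2 (volume.restrict B) := by
  rw [memLp_two_iff_integrable_sq_norm hm.restrict]
  -- The closed cube is used because its translates cover the space, whereas those of the open cube
  -- miss the coordinates that are integers.
  have h1 : IntegrableOn (fun x => ‖f x‖ ^ 2) (closure (cube d)) := by
    have e : volume.restrict (closure (cube d)) = volume.restrict (cube d) :=
      Measure.restrict_congr_set (closure_ae_eq_of_null_frontier
        (convex_cube.addHaar_frontier volume))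
    rw [IntegrableOn, e]
    exact (memLp_two_iff_integrable_sq_norm hm.restrict).1 hf
  have h2 : ∀ k : Fin d → ℤ, IntegrableOn (fun x => ‖f x‖ ^ 2)
      ((fun x => x + latt k) ⁻¹' closure (cube d)) := by
    intro k
    have := ((measurePreserving_add_right volume (latt k)).integrableOn_comp_preimage
      (Homeomorph.addRight (latt k)).measurableEmbedding).2 h1
    refine this.congr (ae_restrict_of_ae ?_)
    filter_upwards [hp k] with x hx
    simp only [Function.comp_apply, hx]
  obtain ⟨R, hR⟩ := hB.exists_norm_le
  refine ((integrableOn_finset_iUnion (s := Finset.Icc (fun _ : Fin d => -⌈R⌉ - 1)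
    (fun _ => ⌈R⌉ + 1))).2 fun k _ => h2 k).mono_set fun x hx => ?_
  have hb : ∀ j, |x j| ≤ R := fun j => (PiLp.norm_apply_le x j).trans (hR x hx)
  refine Set.mem_iUnion₂.2 ⟨fun j => -⌊x j⌋, ?_, ?_⟩
  · rw [Finset.mem_Icc]
    have h3 : ∀ j, -⌈R⌉ - 1 ≤ -⌊x j⌋ ∧ -⌊x j⌋ ≤ ⌈R⌉ + 1 := fun j => by
      have h4 := abs_le.1 (hb j)
      have h5 := Int.floor_le (x j)
      have h6 := Int.lt_floor_add_one (x j)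
      have h7 := Int.le_ceil R
      have h8 : ((⌊x j⌋ : ℤ) : ℝ) ≤ ⌈R⌉ := by linarith
      have h9 : -(⌈R⌉ : ℝ) < ⌊x j⌋ + 1 := by linarith
      norm_cast at h8 h9
      constructor <;> omega
    exact ⟨fun j => (h3 j).1, fun j => (h3 j).2⟩
  · rw [Set.mem_preimage, closure_cube]
    intro j
    have h5 := Int.floor_le (x j)
    have h6 := Int.lt_floor_add_one (x j)
    simp only [PiLp.add_apply, latt_apply, Int.cast_neg]
    constructor <;> linarith

section Periodic

variable {u : E d → ℝ}

/-- Periodicity of the gradient is not part of the definition. It holds almost everywhere because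
the translated gradient is a weak gradient of the same function. -/
theorem MemH1Per.memH1 (hu : MemH1Per u) {B : Set (E d)} (hB : Bornology.IsBounded B) :
    MemH1 B u := by
  obtain ⟨hp, hu2, G, hG, hG2⟩ := hu
  have hm : ∀ {F : Type} [NormedAddCommGroup F] {f : E d → F},
      LocallyIntegrableOn f Set.univ volume → AEStronglyMeasurable f volume := fun hf =>
    (locallyIntegrableOn_univ.1 hf).aestronglyMeasurable
  refine ⟨memLp_restrict_of_periodic (hm hG.1) hu2 (fun k => .of_forall fun x => hp k x) hB,
    G, hG.mono isOpen_univ (Set.subset_univ _),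
    memLp_restrict_of_periodic (hm hG.2.1) hG2 (fun k => ?_) hB⟩
  have h1 := hG.comp_add isOpen_univ (latt k)
  simp only [hp, Set.preimage_univ] at h1
  have h2 := h1.ae_eq isOpen_univ hG
  rwa [Measure.restrict_univ] at h2

theorem wgrad_mono_ae {U B : Set (E d)} (hB : IsOpen B) (hU : IsOpen U) (hUB : U ⊆ B)
    (hu : MemH1 B u) : wgrad U u =ᵐ[volume.restrict U] wgrad B u :=
  wgrad_ae_eq hU (hu.isWeakGrad.mono hB hUB)

theorem ApproxH1.mono {U B : Set (E d)} (hB : IsOpen B) (hU : IsOpen U) (hUB : U ⊆ B)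
    (hu : MemH1 B u) {φ : ℕ → E d → ℝ} (hφ : ApproxH1 B u φ) : ApproxH1 U u φ := by
  refine ⟨hφ.contDiff, ?_, ?_⟩
  · exact tendsto_of_tendsto_of_tendsto_of_le_of_le tendsto_const_nhds hφ.tendsto
      (fun _ => bot_le) fun n => eLpNorm_mono_measure _ (Measure.restrict_mono_set _ hUB)
  · refine tendsto_of_tendsto_of_tendsto_of_le_of_le tendsto_const_nhds hφ.tendsto_gradient
      (fun _ => bot_le) fun n => ?_
    refine le_trans (le_of_eq (eLpNorm_congr_ae ?_))
      (eLpNorm_mono_measure _ (Measure.restrict_mono_set volume hUB))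
    filter_upwards [wgrad_mono_ae hB hU hUB hu] with x hx
    rw [hx]

theorem eLpNorm_comp_add {F : Type*} [NormedAddCommGroup F] {f : E d → F} {U : Set (E d)}
    (hU : MeasurableSet U) (a : E d) (hf : AEStronglyMeasurable f (volume.restrict U)) :
    eLpNorm (fun x => f (x + a)) 2 (volume.restrict ((fun x => x + a) ⁻¹' U)) =
      eLpNorm f 2 (volume.restrict U) :=
  eLpNorm_comp_measurePreserving hf
    ((measurePreserving_add_right volume a).restrict_preimage hU)

theorem ApproxH1.comp_add {U : Set (E d)} (hU : IsOpen U) (hu : MemH1 U u) {φ : ℕ → E d → ℝ}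
    (hφ : ApproxH1 U u φ) (a : E d) :
    ApproxH1 ((fun x => x + a) ⁻¹' U) (fun x => u (x + a)) (fun n x => φ n (x + a)) := by
  have hU' : IsOpen ((fun x => x + a) ⁻¹' U) := hU.preimage (by fun_prop)
  refine ⟨fun n => (hφ.contDiff n).comp (contDiff_id.add contDiff_const), ?_, ?_⟩
  · refine hφ.tendsto.congr fun n => ?_
    exact (eLpNorm_comp_add hU.measurableSet a
      ((hφ.contDiff n).continuous.aestronglyMeasurable.sub hu.1.1)).symm
  · refine hφ.tendsto_gradient.congr fun n => ?_
    refine (eLpNorm_comp_add hU.measurableSet a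
      ((continuous_gradient (hφ.contDiff n)).aestronglyMeasurable.sub
        (hu.memLp_wgrad hU).1)).symm.trans (eLpNorm_congr_ae ?_)
    filter_upwards [wgrad_ae_eq hU' (hu.isWeakGrad.comp_add hU a)] with x hx
    rw [hx, gradient_comp_add_right]
    rfl

theorem MemH1.comp_add {U : Set (E d)} (hU : IsOpen U) (hu : MemH1 U u) (a : E d) :
    MemH1 ((fun x => x + a) ⁻¹' U) (fun x => u (x + a)) := by
  have hmp := (measurePreserving_add_right (volume : Measure (E d)) a).restrict_preimage
    hU.measurableSet
  exact ⟨hu.1.comp_measurePreserving hmp, _, hu.isWeakGrad.comp_add hU a,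
    (hu.memLp_wgrad hU).comp_measurePreserving hmp⟩

variable {ι : Type*} [Fintype ι] (M : Mesh d ι)

/-- The traces of a periodic `H¹` function from both sides coincide. -/
theorem MemH1Per.trace_eq_nbr (hu : MemH1Per u) (i : ι) (p : ι × (Fin d → ℤ)) :
    ∀ᵐ x ∂(μHE[d - 1] : Measure (E d)).restrict (facePart M i p),
      trace (M.elem i) u x = trace (M.elem p.1) u (x - latt p.2) := by
  obtain ⟨j, k⟩ := p
  have hi := M.polytope i
  have hj := M.polytope j
  have hbd : Bornology.IsBounded (M.elem i ∪ cell M (j, k)) := by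
    refine hi.isBounded.union ?_
    obtain ⟨R, hR⟩ := hj.isBounded.exists_norm_le
    refine isBounded_iff_forall_norm_le.2 ⟨R + ‖latt k‖, fun x hx => ?_⟩
    have h1 := hR _ hx
    have h2 := norm_add_le (x - latt k) (latt k)
    rw [sub_add_cancel] at h2
    linarith
  -- One ball contains both cells. Smooth functions that approximate `u` on this ball approximate it
  -- on both cells, so their values on the common face converge to both traces.
  obtain ⟨R, hRpos, hR⟩ := hbd.subset_ball_lt 0 (0 : E d)
  have hB := hu.memH1 (Metric.isBounded_ball (x := (0 : E d)) (r := R))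
  obtain ⟨φ, h1, h2, h3⟩ := exists_contDiff_tendsto Metric.isOpen_ball
    (convex_ball (0 : E d) R) (Metric.nonempty_ball.2 hRpos) hB
  have hφ : ApproxH1 _ u φ := ⟨h1, h2, h3⟩
  have hφi := hφ.mono Metric.isOpen_ball hi.isOpen (Set.subset_union_left.trans hR) hB
  have hcell := hφ.mono Metric.isOpen_ball (isOpen_cell M (j, k))
    (Set.subset_union_right.trans hR) hB
  have hBc := hB.mono Metric.isOpen_ball (Set.subset_union_right.trans hR)
  have hφj := hcell.comp_add (isOpen_cell M (j, k)) hBc (latt k)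
  have e1 : (fun x => x + latt k) ⁻¹' cell M (j, k) = M.elem j := by
    ext x; simp [cell]
  simp only [e1, hu.1] at hφj
  have hui := hB.mono Metric.isOpen_ball (Set.subset_union_left.trans hR)
  have huj := hBc.comp_add (isOpen_cell M (j, k)) (latt k)
  simp only [e1, hu.1] at huj
  have l1 := hφi.tendsto_trace hi hui
  have l2 := hφj.tendsto_trace hj huj
  have mp := measurePreserving_facePart M i j k
  have mtj := (hj.memLp_trace huj).mono_measure (restrict_facePart_le M j (i, -k))
  refine ae_eq_of_tendsto_eLpNorm (f := φ) (fun n => (h1 n).continuous.aestronglyMeasurable)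
    ((hi.memLp_trace hui).mono_measure (restrict_facePart_le M i (j, k))).1
    (mtj.1.comp_measurePreserving mp) ?_ ?_
  · exact tendsto_of_tendsto_of_tendsto_of_le_of_le tendsto_const_nhds l1
      (fun _ => bot_le) fun n => eLpNorm_mono_measure _ (restrict_facePart_le M i (j, k))
  · refine tendsto_of_tendsto_of_tendsto_of_le_of_le tendsto_const_nhds l2
      (fun _ => bot_le) fun n => ?_
    refine le_trans (le_of_eq ?_) (eLpNorm_mono_measure _ (restrict_facePart_le M j (i, -k)))
    have hc : Continuous fun x => φ n (x + latt k) :=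
      (h1 n).continuous.comp (continuous_id.add continuous_const)
    refine Eq.trans (eLpNorm_congr_ae (.of_forall fun x => ?_))
      (eLpNorm_comp_measurePreserving (hc.aestronglyMeasurable.sub mtj.1) mp)
    simp

theorem MemH1Per.jump_eq_zero (hu : MemH1Per u) (i : ι) :
    jump M (fun _ => u) i =ᵐ[surf (M.elem i)] 0 := by
  have h : ∀ᵐ x ∂(surf (M.elem i)), ∀ p, x ∈ facePart M i p →
      trace (M.elem i) u x = trace (M.elem p.1) u (x - latt p.2) := by
    rw [ae_all_iff]
    intro p
    have := hu.trace_eq_nbr M i p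
    rwa [← surf_restrict_facePart, ae_restrict_iff' (measurableSet_facePart M i _)] at this
  filter_upwards [h, ae_exists_mem_facePart M i] with x hx ⟨p, _, hp⟩
  rw [jump, nbrVal_eq M hp, hx p hp, sub_self]
  rfl

end Periodic

/-! ### Periodization -/

/-- The periodization of a function. -/
def periodize (φ : E d → ℝ) (x : E d) : ℝ := ∑ᶠ k : Fin d → ℤ, φ (x + latt k)

theorem periodize_add_latt (φ : E d → ℝ) (k : Fin d → ℤ) (x : E d) :
    periodize φ (x + latt k) = periodize φ x := by
  rw [periodize, periodize,
    ← finsum_comp_equiv (Equiv.addLeft k) (f := fun m => φ (x + latt m))]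
  simp only [Equiv.coe_addLeft, latt_add, add_assoc]

theorem locallyFinite_support_latt {φ : E d → ℝ} (hc : HasCompactSupport φ) :
    LocallyFinite fun k : Fin d → ℤ => Function.support fun x => φ (x + latt k) := by
  intro x
  refine ⟨Metric.ball x 1, Metric.ball_mem_nhds x one_pos, ?_⟩
  obtain ⟨R, hR⟩ := hc.isCompact.isBounded.exists_norm_le
  refine (Set.finite_Icc (fun _ : Fin d => -⌈R + ‖x‖ + 1⌉) fun _ => ⌈R + ‖x‖ + 1⌉).subset ?_
  rintro k ⟨y, hy, hyx⟩
  have h1 := hR _ (subset_tsupport _ hy)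
  rw [Metric.mem_ball, dist_eq_norm] at hyx
  have hb : ∀ j, -⌈R + ‖x‖ + 1⌉ ≤ k j ∧ k j ≤ ⌈R + ‖x‖ + 1⌉ := fun j => by
    have h2 : |(k j : ℝ)| ≤ ‖latt k‖ := PiLp.norm_apply_le (latt k) j
    have h3 : ‖latt k‖ ≤ ‖y + latt k‖ + ‖y - x‖ + ‖x‖ := by
      have e : latt k = (y + latt k) - (y - x) - x := by abel
      calc ‖latt k‖ = ‖(y + latt k) - (y - x) - x‖ := by rw [← e]
        _ ≤ _ := (norm_sub_le _ _).trans (add_le_add_left (norm_sub_le _ _) _)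
    have h4 := Int.le_ceil (R + ‖x‖ + 1)
    have h5 := abs_le.1 h2
    have h6 : (-⌈R + ‖x‖ + 1⌉ : ℝ) ≤ k j := by linarith
    have h7 : (k j : ℝ) ≤ ⌈R + ‖x‖ + 1⌉ := by linarith
    exact ⟨by exact_mod_cast h6, by exact_mod_cast h7⟩
  exact ⟨fun j => (hb j).1, fun j => (hb j).2⟩

theorem contDiff_periodize {φ : E d → ℝ} (hφ : ContDiff ℝ ∞ φ) (hc : HasCompactSupport φ) :
    ContDiff ℝ ∞ (periodize φ) := by
  rw [← contMDiff_iff_contDiff]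
  exact contMDiff_finsum (fun k => contMDiff_iff_contDiff.2
    (hφ.comp (contDiff_id.add contDiff_const))) (locallyFinite_support_latt hc)

theorem periodize_eq_sum {φ : E d → ℝ} {x : E d} {s : Finset (Fin d → ℤ)}
    (h : ∀ k, φ (x + latt k) ≠ 0 → k ∈ s) : periodize φ x = ∑ k ∈ s, φ (x + latt k) :=
  finsum_eq_sum_of_support_subset _ fun k hk => h k hk

theorem memH1Per_of_contDiff {w : E d → ℝ} (hw : ContDiff ℝ ∞ w)
    (hp : ∀ (k : Fin d → ℤ) x, w (x + latt k) = w x) : MemH1Per w := by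
  have := isFiniteMeasure_restrict_of_isBounded (isBounded_cube (d := d))
  exact ⟨hp, memLp_restrict_of_continuous isBounded_cube hw.continuous, _,
    isWeakGrad_gradient _ hw, memLp_restrict_of_continuous isBounded_cube (continuous_gradient hw)⟩

/-! ### The strong equation on the elements and continuity of the normal derivative -/

section Eigen

variable {ι : Type*} (M : Mesh d ι) {V : E d → ℝ} {lam : ℝ} {u : E d → ℝ}

theorem mem_closure_cell_of_add {l : ι} {k : Fin d → ℤ} {x : E d} (hx : x ∈ closure (M.elem l)) :
    x + latt k ∈ closure (cell M (l, k)) := by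
  rw [closure_cell]
  simpa using hx

theorem facePart_subset_other_cells (i : ι) (p : ι × (Fin d → ℤ)) :
    facePart M i p ⊆ {x : E d | ∀ q, x ∈ closure (cell M q) → q = (i, 0) ∨ q = p} := by
  intro x hx q hq
  by_cases h : q = (i, 0)
  · exact Or.inl h
  · exact Or.inr (hx.2.2 q ((isNbr_iff M).2 ⟨h, hq⟩))

theorem memLp_potential_mul {f : E d → ℝ} (hVc : ContinuousOn V (cube d))
    (hVb : ∃ C : ℝ, ∀ x ∈ cube d, |V x| ≤ C) {U : Set (E d)} (hU : MeasurableSet U)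
    (hUc : U ⊆ cube d) (hf : MemLp f 2 (volume.restrict U)) :
    MemLp (fun x => V x * f x) 2 (volume.restrict U) := by
  obtain ⟨C, hC⟩ := hVb
  refine hf.of_le_mul (c := C) (((hVc.mono hUc).aestronglyMeasurable hU).mul hf.1) ?_
  filter_upwards [ae_restrict_mem hU] with x hx
  rw [norm_mul]
  exact mul_le_mul_of_nonneg_right (hC x (hUc hx)) (norm_nonneg _)

/-- The residual of the eigenfunction on an element. -/
def eigenResidual (U : Set (E d)) (V : E d → ℝ) (lam : ℝ) (u : E d → ℝ) (x : E d) : ℝ :=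
  (wlap U u x - V x * u x) + lam * u x

theorem memLp_eigenResidual (hVc : ContinuousOn V (cube d))
    (hVb : ∃ C : ℝ, ∀ x ∈ cube d, |V x| ≤ C) (hn : ∀ i, MemH1Normal (M.elem i) u) (i : ι) :
    MemLp (eigenResidual (M.elem i) V lam u) 2 (volume.restrict (M.elem i)) :=
  ((hn i).memLp_wlap.sub (memLp_potential_mul hVc hVb (M.polytope i).isOpen.measurableSet
    (M.subset i) (hn i).1.1)).add ((hn i).1.1.const_mul lam)

variable [Fintype ι]

theorem integral_cube_eq_sum {f : E d → ℝ} (hf : IntegrableOn f (cube d)) :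
    ∫ x in cube d, f x = ∑ i, ∫ x in M.elem i, f x := by
  have e : volume.restrict (cube d) = volume.restrict (⋃ i, M.elem i) := by
    refine Measure.restrict_congr_set (EventuallyLE.antisymm ?_
      (LE.le.eventuallyLE (Set.iUnion_subset M.subset)))
    have h0 : ∀ᵐ x : E d, ∀ i, x ∉ frontier (M.elem i) := by
      rw [ae_all_iff]
      exact fun i => measure_eq_zero_iff_ae_notMem.1
        ((M.polytope i).convex.addHaar_frontier volume)
    filter_upwards [h0] with x hx hxc
    have h1 : x ∈ ⋃ i, closure (M.elem i) := M.cover ▸ subset_closure hxc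
    obtain ⟨i, hi⟩ := Set.mem_iUnion.1 h1
    refine Set.mem_iUnion.2 ⟨i, ?_⟩
    by_contra hxi
    exact hx i ((M.polytope i).isOpen.frontier_eq ▸ ⟨hi, hxi⟩)
  rw [e, integral_iUnion_fintype (fun i => (M.polytope i).isOpen.measurableSet)
    (fun i j hij => M.disjoint i j hij) (fun i => hf.mono_set (M.subset i))]

/-- The eigenvalue equation tested with a smooth periodic function, after elementwise
integration by parts. -/
theorem IsEigenpair.sum_normalDeriv (hu : IsEigenpair V lam u) (hVc : ContinuousOn V (cube d))
    (hVb : ∃ C : ℝ, ∀ x ∈ cube d, |V x| ≤ C) (hn : ∀ i, MemH1Normal (M.elem i) u)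
    {w : E d → ℝ} (hw : ContDiff ℝ ∞ w) (hp : ∀ (k : Fin d → ℤ) x, w (x + latt k) = w x) :
    ∑ i, ∫ x, normalDeriv (M.elem i) u x * w x ∂(surf (M.elem i)) =
      ∑ i, ∫ x in M.elem i, eigenResidual (M.elem i) V lam u x * w x := by
  have hfin := isFiniteMeasure_restrict_of_isBounded (isBounded_cube (d := d))
  have h := hu.2.2 w (memH1Per_of_contDiff hw hp)
  have hu1 := hu.1.memH1 (isBounded_cube (d := d))
  have hw1 := memH1_of_contDiff isBounded_cube hw
  have mw : MemLp w 2 (volume.restrict (cube d)) := hw1.1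
  rw [integral_cube_eq_sum M (integrable_inner_of_memLp (hu1.memLp_wgrad isOpen_cube)
      (hw1.memLp_wgrad isOpen_cube)),
    integral_cube_eq_sum M (integrable_mul_of_memLp (memLp_potential_mul hVc hVb
      isOpen_cube.measurableSet subset_rfl hu1.1) mw),
    integral_cube_eq_sum M (integrable_mul_of_memLp hu1.1 mw),
    Finset.mul_sum, ← Finset.sum_add_distrib, ← sub_eq_zero, ← Finset.sum_sub_distrib] at h
  rw [← sub_eq_zero, ← Finset.sum_sub_distrib, ← h]
  refine Finset.sum_congr rfl fun i _ => ?_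
  have hi := M.polytope i
  have e1 : ∫ x in M.elem i, inner ℝ (wgrad (cube d) u x) (wgrad (cube d) w x) =
      ∫ x in M.elem i, inner ℝ (wgrad (M.elem i) u x) (gradient w x) := by
    refine integral_congr_ae ?_
    filter_upwards [wgrad_mono_ae isOpen_cube hi.isOpen (M.subset i) hu1,
      wgrad_mono_ae isOpen_cube hi.isOpen (M.subset i) hw1, wgrad_of_contDiff hi.isOpen hw]
      with x h1 h2 h3
    rw [h1, ← h2, h3]
  have mwi := mw.mono_measure (Measure.restrict_mono_set volume (M.subset i))
  have m1 := (hn i).memLp_wlap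
  have m2 := memLp_potential_mul hVc hVb hi.isOpen.measurableSet (M.subset i) (hn i).1.1
  have m3 := (hn i).1.1
  have e2 : ∫ x in M.elem i, eigenResidual (M.elem i) V lam u x * w x =
      (∫ x in M.elem i, wlap (M.elem i) u x * w x) - (∫ x in M.elem i, V x * u x * w x)
        + lam * ∫ x in M.elem i, u x * w x := by
    have i1 := integrable_mul_of_memLp m1 mwi
    have i2 := integrable_mul_of_memLp m2 mwi
    have i3 := (integrable_mul_of_memLp m3 mwi).const_mul lam
    rw [← integral_const_mul, ← integral_sub i1 i2]
    refine Eq.trans ?_ (integral_add (i1.sub i2) i3)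
    refine integral_congr_ae (.of_forall fun x => ?_)
    simp only [eigenResidual]
    ring
  rw [e1, e2, ← (hn i).integral_smooth hi hw]
  ring

/-- The eigenvalue equation holds almost everywhere on the elements. -/
theorem IsEigenpair.eigenResidual_eq_zero (hu : IsEigenpair V lam u)
    (hVc : ContinuousOn V (cube d)) (hVb : ∃ C : ℝ, ∀ x ∈ cube d, |V x| ≤ C)
    (hn : ∀ i, MemH1Normal (M.elem i) u) (i : ι) :
    eigenResidual (M.elem i) V lam u =ᵐ[volume.restrict (M.elem i)] 0 := by
  classical
  have hi := M.polytope i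
  have hm := memLp_eigenResidual M (lam := lam) hVc hVb hn i
  have := hi.isOpen.ae_eq_zero_of_integral_contDiff_smul_eq_zero (μ := volume)
    (locallyIntegrableOn_of_locallyIntegrable_restrict (hm.locallyIntegrable (by norm_num)))
    fun φ hφ hc hs => by
      -- The support of `φ` lies in the open element `i`, which no other closed cell of the periodic
      -- mesh meets. Periodizing therefore adds nothing on the closed elements, and all boundary
      -- terms vanish.
      have hper : ∀ l, ∀ x ∈ closure (M.elem l), periodize φ x = if l = i then φ x else 0 := by
        intro l x hx
        rw [periodize_eq_sum (s := if l = i then {0} else ∅)]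
        · split_ifs <;> simp [latt_zero]
        · intro k hk
          have h1 : x + latt k ∈ cell M (i, 0) := by
            rw [cell_zero]
            exact hs (subset_tsupport _ hk)
          by_cases hlk : ((l, k) : ι × (Fin d → ℤ)) = (i, 0)
          · simp only [Prod.mk.injEq] at hlk
            simp [hlk.1, hlk.2]
          · exact absurd (mem_closure_cell_of_add M hx) (Set.disjoint_left.1
              ((disjoint_cell M (Ne.symm hlk)).closure_right (isOpen_cell M _)) h1)
      have h := hu.sum_normalDeriv M hVc hVb hn (contDiff_periodize hφ hc)
        (periodize_add_latt φ)
      have e1 : ∀ l, ∫ x, normalDeriv (M.elem l) u x * periodize φ x ∂(surf (M.elem l)) = 0 := by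
        intro l
        have : ∫ x, normalDeriv (M.elem l) u x * periodize φ x ∂(surf (M.elem l)) =
            ∫ x, normalDeriv (M.elem l) u x * (if l = i then φ x else 0) ∂(surf (M.elem l)) :=
          setIntegral_congr_fun isClosed_frontier.measurableSet fun x hx => by
            simp only [hper l x (frontier_subset_closure hx)]
        rw [this]
        split_ifs with hl
        · subst hl
          exact integral_surf_mul_eq_zero hi.isOpen hs
        · simp
      have e2 : ∀ l, ∫ x in M.elem l, eigenResidual (M.elem l) V lam u x * periodize φ x =
          if l = i then ∫ x in M.elem i, eigenResidual (M.elem i) V lam u x * φ x else 0 := by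
        intro l
        have : ∫ x in M.elem l, eigenResidual (M.elem l) V lam u x * periodize φ x =
            ∫ x in M.elem l, eigenResidual (M.elem l) V lam u x * (if l = i then φ x else 0) :=
          setIntegral_congr_fun (M.polytope l).isOpen.measurableSet fun x hx => by
            simp only [hper l x (subset_closure hx)]
        rw [this]
        split_ifs with hl
        · subst hl; rfl
        · simp
      simp only [e1, e2, Finset.sum_const_zero, Finset.sum_ite_eq', Finset.mem_univ, if_true] at h
      have e : ∫ x, φ x • eigenResidual (M.elem i) V lam u x =
          ∫ x in M.elem i, φ x • eigenResidual (M.elem i) V lam u x := by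
        refine (setIntegral_eq_integral_of_forall_compl_eq_zero fun x hx => ?_).symm
        rw [image_eq_zero_of_notMem_tsupport fun h => hx (hs h), zero_smul]
      rw [e, h]
      simp only [smul_eq_mul, mul_comm]
  rw [EventuallyEq, ae_restrict_iff' hi.isOpen.measurableSet]
  exact this

/-- The set of the points that only the closed cells `(i, 0)` and `p` reach. -/
theorem isOpen_compl_other_cells (i : ι) (p : ι × (Fin d → ℤ)) :
    IsOpen {x : E d | ∀ q, x ∈ closure (cell M q) → q = (i, 0) ∨ q = p} := by
  have h := (isClosed_biUnion_closure_cell M fun q => ¬ (q = (i, 0) ∨ q = p)).isOpen_compl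
  convert h using 1
  ext x
  simp only [Set.mem_compl_iff, Set.mem_iUnion, not_exists, Subtype.forall]
  exact forall_congr' fun q => by
    tauto

/-- Data supported near one face only see that face. -/
theorem integral_surf_eq_facePart {i : ι} {p : ι × (Fin d → ℤ)} {f φ : E d → ℝ}
    (hφ : ∀ x, φ x ≠ 0 → ∀ q, x ∈ closure (cell M q) → q = (i, 0) ∨ q = p) :
    ∫ x, f x * φ x ∂(surf (M.elem i)) = ∫ x in facePart M i p, f x * φ x ∂μHE[d - 1] := by
  rw [← surf_restrict_facePart]
  refine (setIntegral_eq_integral_of_ae_compl_eq_zero ?_).symm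
  filter_upwards [ae_exists_mem_facePart M i] with x ⟨q, _, hq⟩ hx
  by_contra hne
  have h1 := hφ x (right_ne_zero_of_mul hne) q ((isNbr_iff M).1 hq.2.1).2
  rcases h1 with h1 | h1
  · exact hq.2.1.1 h1
  · exact hx (h1 ▸ hq)

/-- Test the eigenvalue equation with the periodization of a bump that meets only the two closed
cells at one face. The volume terms vanish by the strong equation, and the normal derivatives from
the two sides remain. -/
theorem IsEigenpair.integral_facePart_eq_zero (hu : IsEigenpair V lam u)
    (hVc : ContinuousOn V (cube d)) (hVb : ∃ C : ℝ, ∀ x ∈ cube d, |V x| ≤ C)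
    (hn : ∀ i, MemH1Normal (M.elem i) u) {i : ι} {p : ι × (Fin d → ℤ)} (hpi : p ≠ (i, 0))
    {φ : E d → ℝ} (hφ : ContDiff ℝ ∞ φ) (hc : HasCompactSupport φ)
    (hs : ∀ x, φ x ≠ 0 → ∀ q, x ∈ closure (cell M q) → q = (i, 0) ∨ q = p) :
    (∫ x in facePart M i p, normalDeriv (M.elem i) u x * φ x ∂μHE[d - 1]) +
      ∫ x in facePart M i p, normalDeriv (M.elem p.1) u (x - latt p.2) * φ x ∂μHE[d - 1] = 0 := by
  classical
  -- An element may be its own neighbour through a nonzero translation, so `i = j` is possible; the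
  -- periodization therefore carries two separate terms.
  obtain ⟨j, k⟩ := p
  have hper : ∀ l, ∀ x ∈ closure (M.elem l), periodize φ x =
      (if l = i then φ x else 0) + if l = j then φ (x + latt k) else 0 := by
    intro l x hx
    rw [periodize_eq_sum (s := (if l = i then {0} else ∅) ∪ if l = j then {k} else ∅)]
    · rw [Finset.sum_union]
      · congr 1 <;> split_ifs <;> simp [latt_zero]
      · split_ifs with h1 h2
        · rw [Finset.disjoint_singleton]
          intro h
          exact hpi (by rw [← h1, ← h2, ← h])
        all_goals simp
    · intro m hm
      have := hs _ hm _ (mem_closure_cell_of_add M hx)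
      simp only [Prod.mk.injEq] at this
      rcases this with ⟨h1, h2⟩ | ⟨h1, h2⟩ <;> simp [h1, h2]
  have h := hu.sum_normalDeriv M hVc hVb hn (contDiff_periodize hφ hc) (periodize_add_latt φ)
  have hr : ∀ l, ∫ x in M.elem l, eigenResidual (M.elem l) V lam u x * periodize φ x = 0 := by
    intro l
    refine integral_eq_zero_of_ae ?_
    filter_upwards [hu.eigenResidual_eq_zero M hVc hVb hn l] with x hx
    simp [hx]
  have hφk : Continuous fun x => φ (x + latt k) :=
    hφ.continuous.comp (continuous_id.add continuous_const)
  have e1 : ∀ l, ∫ x, normalDeriv (M.elem l) u x * periodize φ x ∂(surf (M.elem l)) =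
      (if l = i then ∫ x, normalDeriv (M.elem i) u x * φ x ∂(surf (M.elem i)) else 0) +
      if l = j then ∫ x, normalDeriv (M.elem j) u x * φ (x + latt k) ∂(surf (M.elem j))
        else 0 := by
    intro l
    have i1 := integrable_mul_of_memLp (hn l).memLp_normalDeriv
      ((M.polytope l).memLp_surf hφ.continuous)
    have i2 := integrable_mul_of_memLp (hn l).memLp_normalDeriv ((M.polytope l).memLp_surf hφk)
    have : ∫ x, normalDeriv (M.elem l) u x * periodize φ x ∂(surf (M.elem l)) =
        ∫ x, ((if l = i then normalDeriv (M.elem l) u x * φ x else 0) +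
          if l = j then normalDeriv (M.elem l) u x * φ (x + latt k) else 0) ∂(surf (M.elem l)) :=
      setIntegral_congr_fun isClosed_frontier.measurableSet fun x hx => by
        simp only [hper l x (frontier_subset_closure hx), mul_add, mul_ite, mul_zero]
    rw [this]
    by_cases h1 : l = i <;> by_cases h2 : l = j
    · subst h1; subst h2
      simp only [if_true]
      exact integral_add i1 i2
    · subst h1; simp [h2]
    · subst h2; simp [h1]
    · simp [h1, h2]
  simp only [hr, e1, Finset.sum_const_zero, Finset.sum_add_distrib, Finset.sum_ite_eq',
    Finset.mem_univ, if_true] at h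
  rw [integral_surf_eq_facePart M hs, integral_surf_eq_facePart M (p := (i, -k))] at h
  · rw [← h]
    congr 1
    rw [← (measurePreserving_facePart M i j k).integral_comp
      (Homeomorph.subRight (latt k)).measurableEmbedding]
    simp
  · intro x hx q hq
    have h1 : x + latt k ∈ closure (cell M (q.1, q.2 + k)) := by
      rw [closure_cell] at hq ⊢
      simpa [latt_add, add_sub_add_right_eq_sub] using hq
    have := hs _ hx _ h1
    simp only [Prod.mk.injEq] at this
    rcases this with ⟨h2, h3⟩ | ⟨h2, h3⟩
    · right; exact Prod.ext h2 (eq_neg_of_add_eq_zero_left h3)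
    · left; exact Prod.ext h2 (by simpa using h3)

/-- The gradient of the eigenfunction has no jumps. -/
theorem IsEigenpair.jumpGrad_eq_zero (hu : IsEigenpair V lam u)
    (hVc : ContinuousOn V (cube d)) (hVb : ∃ C : ℝ, ∀ x ∈ cube d, |V x| ≤ C)
    (hn : ∀ i, MemH1Normal (M.elem i) u) (i : ι) :
    jumpGrad M (fun _ => u) i =ᵐ[surf (M.elem i)] 0 := by
  have hG : MemLp (jumpGrad M (fun _ => u) i) 2 (surf (M.elem i)) :=
    (hn i).memLp_normalDeriv.add (memLp_nbrVal M (fun j => (hn j).memLp_normalDeriv) i)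
  have key : ∀ p : ι × (Fin d → ℤ), ∀ᵐ x ∂(surf (M.elem i)), x ∈ facePart M i p →
      jumpGrad M (fun _ => u) i x = 0 := by
    intro p
    by_cases hpi : p = (i, 0)
    · exact .of_forall fun x hx => absurd hpi hx.2.1.1
    rw [← ae_restrict_iff' (measurableSet_facePart M i p), surf_restrict_facePart]
    have hle := restrict_facePart_le M i p
    have hO := isOpen_compl_other_cells M i p
    have hfin := (M.polytope i).isFiniteMeasure_surf
    have hfin' : IsFiniteMeasure ((μHE[d - 1] : Measure (E d)).restrict (facePart M i p)) :=
      ⟨(Measure.le_iff'.1 hle Set.univ).trans_lt (measure_lt_top _ _)⟩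
    have hGp := hG.mono_measure hle
    -- The points reached only by the two closed cells at the face form an open set containing the
    -- face part. Test functions supported in it suffice to show that the jump vanishes there.
    have := hO.ae_eq_zero_of_integral_contDiff_smul_eq_zero
      (μ := (μHE[d - 1]).restrict (facePart M i p))
      ((hGp.locallyIntegrable (by norm_num)).locallyIntegrableOn _) fun φ hφ hc hs => by
        have hs' : ∀ x, φ x ≠ 0 → ∀ q, x ∈ closure (cell M q) → q = (i, 0) ∨ q = p :=
          fun x hx => hs (subset_tsupport _ hx)
        have h := hu.integral_facePart_eq_zero M hVc hVb hn hpi hφ hc hs'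
        have mφ : MemLp φ 2 ((μHE[d - 1]).restrict (facePart M i p)) :=
          ((M.polytope i).memLp_surf hφ.continuous).mono_measure hle
        have e : ∫ x in facePart M i p, normalDeriv (M.elem p.1) u (x - latt p.2) * φ x
            ∂μHE[d - 1] = ∫ x in facePart M i p,
              nbrVal M (fun j => normalDeriv (M.elem j) u) i x * φ x ∂μHE[d - 1] :=
          setIntegral_congr_fun (measurableSet_facePart M i p) fun x hx => by
            simp only [nbrVal_eq M hx]
        rw [e, ← integral_add
          (integrable_mul_of_memLp ((hn i).memLp_normalDeriv.mono_measure hle) mφ)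
          (integrable_mul_of_memLp
            ((memLp_nbrVal M (fun j => (hn j).memLp_normalDeriv) i).mono_measure hle) mφ)] at h
        rw [← h]
        refine integral_congr_ae (.of_forall fun x => ?_)
        simp only [jumpGrad, smul_eq_mul]
        ring
    filter_upwards [this, ae_restrict_mem (measurableSet_facePart M i p)] with x hx hxp
    exact hx (facePart_subset_other_cells M i p hxp)
  filter_upwards [ae_all_iff.2 key, ae_exists_mem_facePart M i] with x hx ⟨p, _, hp⟩
  exact hx p hp

end Eigen

/-! ### Jumps -/

theorem MemH1Normal.sub {U : Set (E d)} {v w : E d → ℝ} (h : IsOpenPolytope U)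
    (hv : MemH1Normal U v) (hw : MemH1Normal U w) : MemH1Normal U (fun x => v x - w x) := by
  simpa [sub_eq_add_neg] using hv.add h (hw.const_mul h (-1))

theorem MemH1Normal.wlap_sub {U : Set (E d)} {v w : E d → ℝ} (h : IsOpenPolytope U)
    (hv : MemH1Normal U v) (hw : MemH1Normal U w) :
    wlap U (fun x => v x - w x) =ᵐ[volume.restrict U] fun x => wlap U v x - wlap U w x := by
  have e : (fun x => v x - w x) = fun x => v x + -1 * w x := by ext; ring
  rw [e]
  filter_upwards [hv.wlap_add h (hw.const_mul h (-1)), hw.wlap_const_mul h (-1)] with x h1 h2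
  rw [h1, h2]
  ring

theorem MemH1Normal.normalDeriv_sub {U : Set (E d)} {v w : E d → ℝ} (h : IsOpenPolytope U)
    (hv : MemH1Normal U v) (hw : MemH1Normal U w) :
    normalDeriv U (fun x => v x - w x) =ᵐ[surf U]
      fun x => normalDeriv U v x - normalDeriv U w x := by
  have e : (fun x => v x - w x) = fun x => v x + -1 * w x := by ext; ring
  rw [e]
  filter_upwards [hv.normalDeriv_add h (hw.const_mul h (-1)), hw.normalDeriv_const_mul h (-1)]
    with x h1 h2
  rw [h1, h2]
  ring

theorem trace_sub {U : Set (E d)} {v w : E d → ℝ} (h : IsOpenPolytope U)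
    (hv : MemH1 U v) (hw : MemH1 U w) :
    trace U (fun x => v x - w x) =ᵐ[surf U] fun x => trace U v x - trace U w x := by
  have e : (fun x => v x - w x) = fun x => v x + -1 * w x := by ext; ring
  rw [e]
  filter_upwards [trace_add h hv (hw.const_mul h.isOpen (-1)), trace_const_mul h (-1) hw]
    with x h1 h2
  rw [h1, h2]
  ring

section Jump

variable {ι : Type*} [Fintype ι] (M : Mesh d ι) {v w : ι → E d → ℝ}

theorem jump_sub (hv : ∀ i, MemH1 (M.elem i) (v i)) (hw : ∀ i, MemH1 (M.elem i) (w i)) (i : ι) :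
    jump M (fun i x => v i x - w i x) i =ᵐ[surf (M.elem i)]
      fun x => jump M v i x - jump M w i x := by
  have h := fun j => trace_sub (M.polytope j) (hv j) (hw j)
  filter_upwards [h i, nbrVal_congr M h i, ae_exists_mem_facePart M i] with x h1 h2 ⟨p, _, hp⟩
  rw [jump, jump, jump, h1, h2]
  simp only [nbrVal_eq M hp]
  ring

theorem jumpGrad_sub (hv : ∀ i, MemH1Normal (M.elem i) (v i))
    (hw : ∀ i, MemH1Normal (M.elem i) (w i)) (i : ι) :
    jumpGrad M (fun i x => v i x - w i x) i =ᵐ[surf (M.elem i)]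
      fun x => jumpGrad M v i x - jumpGrad M w i x := by
  have h := fun j => (hv j).normalDeriv_sub (M.polytope j) (hw j)
  filter_upwards [h i, nbrVal_congr M h i, ae_exists_mem_facePart M i] with x h1 h2 ⟨p, _, hp⟩
  rw [jumpGrad, jumpGrad, jumpGrad, h1, h2]
  simp only [nbrVal_eq M hp]
  ring

theorem memLp_jump (hv : ∀ i, MemH1 (M.elem i) (v i)) (i : ι) :
    MemLp (jump M v i) 2 (surf (M.elem i)) :=
  ((M.polytope i).memLp_trace (hv i)).sub
    (memLp_nbrVal M (fun j => (M.polytope j).memLp_trace (hv j)) i)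

theorem memLp_jumpGrad (hv : ∀ i, MemH1Normal (M.elem i) (v i)) (i : ι) :
    MemLp (jumpGrad M v i) 2 (surf (M.elem i)) :=
  (hv i).memLp_normalDeriv.add (memLp_nbrVal M (fun j => (hv j).memLp_normalDeriv) i)

/-- The jump is recorded as the coefficient of the exterior normal, so it changes sign when seen
from the other side. -/
theorem nbrVal_jump (i : ι) :
    nbrVal M (jump M v) i =ᵐ[surf (M.elem i)] fun x => - jump M v i x := by
  filter_upwards [nbrVal_nbrVal M (fun j => trace (M.elem j) (v j)) i,
    ae_exists_mem_facePart M i] with x h1 ⟨p, _, hp⟩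
  rw [nbrVal_eq M hp] at h1
  rw [nbrVal_eq M hp, jump, jump, h1, nbrVal_eq M hp]
  ring

theorem bdInner_congr {U : Set (E d)} {f f' g g' : E d → ℝ} (hf : f =ᵐ[surf U] f')
    (hg : g =ᵐ[surf U] g') : bdInner U f g = bdInner U f' g' := by
  refine integral_congr_ae ?_
  filter_upwards [hf, hg] with x h1 h2
  rw [h1, h2]

theorem abs_bdInner_le {U : Set (E d)} {f g : E d → ℝ} (hf : MemLp f 2 (surf U))
    (hg : MemLp g 2 (surf U)) : |bdInner U f g| ≤ bdNorm U f * bdNorm U g :=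
  abs_integral_mul_le hf hg

theorem bdInner_sub_right {U : Set (E d)} {f g g' : E d → ℝ} (hf : MemLp f 2 (surf U))
    (hg : MemLp g 2 (surf U)) (hg' : MemLp g' 2 (surf U)) :
    bdInner U f (fun x => g x - g' x) = bdInner U f g - bdInner U f g' := by
  simp only [bdInner, mul_sub]
  exact integral_sub (integrable_mul_of_memLp hf hg) (integrable_mul_of_memLp hf hg')

theorem bdInner_add_left {U : Set (E d)} {f f' g : E d → ℝ} (hf : MemLp f 2 (surf U))
    (hf' : MemLp f' 2 (surf U)) (hg : MemLp g 2 (surf U)) :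
    bdInner U (fun x => f x + f' x) g = bdInner U f g + bdInner U f' g := by
  simp only [bdInner, add_mul]
  exact integral_add (integrable_mul_of_memLp hf hg) (integrable_mul_of_memLp hf' hg)

theorem bdInner_neg_left {U : Set (E d)} {f g : E d → ℝ} :
    bdInner U (fun x => - f x) g = - bdInner U f g := by
  simp only [bdInner, neg_mul, integral_neg]

theorem bdInner_neg_right {U : Set (E d)} {f g : E d → ℝ} :
    bdInner U f (fun x => - g x) = - bdInner U f g := by
  simp only [bdInner, mul_neg, integral_neg]

/-- The boundary terms of an elementwise integration by parts, in terms of jumps. -/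
theorem sum_bdInner_normalDeriv_trace (hv : ∀ i, MemH1Normal (M.elem i) (v i))
    (hw : ∀ i, MemH1 (M.elem i) (w i)) :
    ∑ i, bdInner (M.elem i) (normalDeriv (M.elem i) (v i)) (trace (M.elem i) (w i)) =
      1 / 2 * ∑ i, bdInner (M.elem i) (jumpGrad M v i) (trace (M.elem i) (w i)) +
      1 / 2 * ∑ i, bdInner (M.elem i) (normalDeriv (M.elem i) (v i)) (jump M w i) := by
  have mg := fun i => (hv i).memLp_normalDeriv
  have mt := fun i => (M.polytope i).memLp_trace (hw i)
  have h1 : ∀ i, bdInner (M.elem i) (jumpGrad M v i) (trace (M.elem i) (w i)) =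
      bdInner (M.elem i) (normalDeriv (M.elem i) (v i)) (trace (M.elem i) (w i)) +
      bdInner (M.elem i) (nbrVal M (fun j => normalDeriv (M.elem j) (v j)) i)
        (trace (M.elem i) (w i)) := fun i =>
    bdInner_add_left (mg i) (memLp_nbrVal M mg i) (mt i)
  have h2 : ∀ i, bdInner (M.elem i) (normalDeriv (M.elem i) (v i)) (jump M w i) =
      bdInner (M.elem i) (normalDeriv (M.elem i) (v i)) (trace (M.elem i) (w i)) -
      bdInner (M.elem i) (normalDeriv (M.elem i) (v i))
        (nbrVal M (fun j => trace (M.elem j) (w j)) i) := fun i =>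
    bdInner_sub_right (mg i) (mt i) (memLp_nbrVal M mt i)
  -- Pairing with the neighbour's trace equals pairing the neighbour's normal derivative with the
  -- own trace. With this, the mixed terms in the two half sums cancel.
  have h3 : ∑ i, bdInner (M.elem i) (normalDeriv (M.elem i) (v i))
        (nbrVal M (fun j => trace (M.elem j) (w j)) i) =
      ∑ i, bdInner (M.elem i) (nbrVal M (fun j => normalDeriv (M.elem j) (v j)) i)
        (trace (M.elem i) (w i)) := sum_integral_mul_nbrVal M mg mt
  simp only [h1, h2, Finset.sum_add_distrib, Finset.sum_sub_distrib, h3]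
  ring

/-- The average `{γ}` on `∂κ_i`. -/
def average (γ : ι → ℝ) (i : ι) (x : E d) : ℝ := (γ i + nbrVal M (fun j _ => γ j) i x) / 2

theorem memLp_average (γ : ι → ℝ) (i : ι) : MemLp (average M γ i) 2 (surf (M.elem i)) := by
  have hfin := fun j => (M.polytope j).isFiniteMeasure_surf
  have h := memLp_nbrVal M (f := fun j _ => γ j) (fun j => memLp_const (γ j)) i
  have := ((memLp_const (γ i) (p := 2) (μ := surf (M.elem i))).add h).const_mul (1 / 2)
  refine this.ae_eq (.of_forall fun x => ?_)
  simp only [average, Pi.add_apply]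
  ring

/-- Multiplication by `{γ}`, which is almost everywhere between `0` and `γ̂_κ`. -/
theorem memLp_average_mul {γ : ι → ℝ} (hγ : ∀ i, 0 ≤ γ i) {i : ι} {f : E d → ℝ}
    (hf : MemLp f 2 (surf (M.elem i))) :
    MemLp (fun x => average M γ i x * f x) 2 (surf (M.elem i)) ∧
      bdNorm (M.elem i) (fun x => average M γ i x * f x) ≤
        gammaHat M γ i * bdNorm (M.elem i) f := by
  have h0 : ∀ᵐ x ∂(surf (M.elem i)), |average M γ i x| ≤ gammaHat M γ i := by
    filter_upwards [ae_average_le_gammaHat M γ i, ae_exists_mem_facePart M i]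
      with x hx ⟨p, _, hp⟩
    refine abs_le.2 ⟨?_, hx⟩
    have h1 : 0 ≤ average M γ i x := by
      rw [average, nbrVal_eq M hp]
      have := hγ i
      have := hγ p.1
      positivity
    have h2 := h1.trans hx
    linarith
  have hm : MemLp (fun x => average M γ i x * f x) 2 (surf (M.elem i)) := by
    refine hf.of_le_mul (c := gammaHat M γ i) ((memLp_average M γ i).1.mul hf.1) ?_
    filter_upwards [h0] with x hx
    rw [norm_mul]
    exact mul_le_mul_of_nonneg_right hx (norm_nonneg _)
  refine ⟨hm, ?_⟩
  refine Real.sqrt_le_iff.2 ⟨mul_nonneg (gammaHat_nonneg M hγ i) bdNorm_nonneg, ?_⟩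
  rw [mul_pow, bdNorm_sq, ← integral_const_mul]
  refine integral_mono_ae hm.integrable_sq (hf.integrable_sq.const_mul _) ?_
  filter_upwards [h0] with x hx
  simp only [mul_pow]
  refine mul_le_mul_of_nonneg_right ?_ (sq_nonneg _)
  rw [← sq_abs]
  exact pow_le_pow_left₀ (abs_nonneg _) hx 2

/-- The penalty term in terms of averages. -/
theorem sum_mul_bdInner_jump (γ : ι → ℝ)
    (hv : ∀ i, MemH1 (M.elem i) (v i)) (hw : ∀ i, MemH1 (M.elem i) (w i)) :
    ∑ i, γ i * bdInner (M.elem i) (jump M v i) (jump M w i) =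
      2 * ∑ i, bdInner (M.elem i) (fun x => average M γ i x * jump M v i x)
        (trace (M.elem i) (w i)) := by
  have mj := fun i => memLp_jump M hv i
  have mγ := fun i => (mj i).const_mul (γ i)
  have mt := fun i => (M.polytope i).memLp_trace (hw i)
  have h1 : ∀ i, γ i * bdInner (M.elem i) (jump M v i) (jump M w i) =
      bdInner (M.elem i) (fun x => γ i * jump M v i x) (trace (M.elem i) (w i)) -
      bdInner (M.elem i) (fun x => γ i * jump M v i x)
        (nbrVal M (fun j => trace (M.elem j) (w j)) i) := fun i => by
    rw [← bdInner_sub_right (mγ i) (mt i) (memLp_nbrVal M mt i), bdInner, bdInner,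
      ← integral_const_mul]
    refine integral_congr_ae (.of_forall fun x => ?_)
    simp only [jump]
    ring
  have h2 : ∑ i, bdInner (M.elem i) (fun x => γ i * jump M v i x)
        (nbrVal M (fun j => trace (M.elem j) (w j)) i) =
      ∑ i, bdInner (M.elem i) (nbrVal M (fun j x => γ j * jump M v j x) i)
        (trace (M.elem i) (w i)) := sum_integral_mul_nbrVal M mγ mt
  -- On the other side `γ_κ` becomes `γ_κ'` and the jump changes sign, so subtracting the
  -- neighbour's contribution adds the two weights and gives `2{γ}`.
  have h3 : ∀ i, 2 * bdInner (M.elem i) (fun x => average M γ i x * jump M v i x)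
        (trace (M.elem i) (w i)) =
      bdInner (M.elem i) (fun x => γ i * jump M v i x) (trace (M.elem i) (w i)) -
      bdInner (M.elem i) (nbrVal M (fun j x => γ j * jump M v j x) i)
        (trace (M.elem i) (w i)) := fun i => by
    rw [bdInner, bdInner, bdInner, ← integral_sub (integrable_mul_of_memLp (mγ i) (mt i))
      (integrable_mul_of_memLp (memLp_nbrVal M mγ i) (mt i)), ← integral_const_mul]
    refine integral_congr_ae ?_
    filter_upwards [nbrVal_jump M (v := v) i, ae_exists_mem_facePart M i] with x h ⟨p, _, hp⟩
    rw [nbrVal_eq M hp] at h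
    simp only [average, nbrVal_eq M hp, h]
    ring
  simp only [h1, Finset.sum_sub_distrib, h2, Finset.mul_sum, h3]

end Jump

/-! ### The a posteriori estimate -/

section Estimate

variable {ι : Type*} (M : Mesh d ι)

/-- The residual `λ_N v + Δv - V v` on an element. -/
def dgResidual (U : Set (E d)) (V : E d → ℝ) (lamN : ℝ) (v : E d → ℝ) (x : E d) : ℝ :=
  lamN * v x + wlap U v x - V x * v x

variable {V : E d → ℝ} {θ : ℝ} {γ : ι → ℝ} {lam lamN : ℝ} {u : E d → ℝ} {uN : ι → E d → ℝ}
  {W : ι → Submodule ℝ (E d → ℝ)}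

theorem memLp_dgResidual (hVc : ContinuousOn V (cube d))
    (hVb : ∃ C : ℝ, ∀ x ∈ cube d, |V x| ≤ C) {i : ι} {v : E d → ℝ}
    (hv : MemH1Normal (M.elem i) v) :
    MemLp (dgResidual (M.elem i) V lamN v) 2 (volume.restrict (M.elem i)) :=
  ((hv.1.1.const_mul lamN).add hv.memLp_wlap).sub (memLp_potential_mul hVc hVb
    (M.polytope i).isOpen.measurableSet (M.subset i) hv.1.1)

theorem memH1Normal_err (hn : ∀ i, MemH1Normal (M.elem i) u)
    (hN : ∀ i, MemH1Normal (M.elem i) (uN i)) (i : ι) :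
    MemH1Normal (M.elem i) (err u uN i) :=
  (hn i).sub (M.polytope i) (hN i)

variable [Fintype ι]

/-- The discrete equation after elementwise integration by parts. -/
theorem IsDGEigenpair.residual_identity (h : IsDGEigenpair M V θ γ W lamN uN)
    (hVc : ContinuousOn V (cube d)) (hVb : ∃ C : ℝ, ∀ x ∈ cube d, |V x| ≤ C)
    (hW : ∀ i, ∀ v ∈ W i, MemH1Normal (M.elem i) v) {z : ι → E d → ℝ} (hz : ∀ i, z i ∈ W i) :
    ∑ i, (∫ x in M.elem i, dgResidual (M.elem i) V lamN (uN i) x * z i x) -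
      1 / 2 * ∑ i, bdInner (M.elem i) (jumpGrad M uN i) (trace (M.elem i) (z i)) +
      θ / 2 * ∑ i, bdInner (M.elem i) (jump M uN i) (normalDeriv (M.elem i) (z i)) -
      1 / 2 * ∑ i, γ i * bdInner (M.elem i) (jump M uN i) (jump M z i) = 0 := by
  have hu := fun i => hW i _ (h.1 i)
  have hz' := fun i => hW i _ (hz i)
  have h1 := h.2.2 z hz
  have h2 := sum_bdInner_normalDeriv_trace M hu fun i => (hz' i).1
  have h3 : ∀ i, ∫ x in M.elem i, dgResidual (M.elem i) V lamN (uN i) x * z i x =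
      lamN * (∫ x in M.elem i, uN i x * z i x) +
      (∫ x in M.elem i, wlap (M.elem i) (uN i) x * z i x) -
      ∫ x in M.elem i, V x * uN i x * z i x := fun i => by
    have mz := (hz' i).1.1
    have i1 := (integrable_mul_of_memLp (hu i).1.1 mz).const_mul lamN
    have i2 := integrable_mul_of_memLp (hu i).memLp_wlap mz
    have i3 := integrable_mul_of_memLp (memLp_potential_mul hVc hVb
      (M.polytope i).isOpen.measurableSet (M.subset i) (hu i).1.1) mz
    rw [← integral_const_mul, ← integral_add i1 i2]
    refine Eq.trans ?_ (integral_sub (i1.add i2) i3)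
    refine integral_congr_ae (.of_forall fun x => ?_)
    simp only [dgResidual]
    ring
  have h4 := fun i => (hu i).integral_wlap_mul_add (M.polytope i) (hz' i).1
  have h5 : ∑ i, ∫ x in M.elem i, inner ℝ (wgrad (M.elem i) (uN i) x) (wgrad (M.elem i) (z i) x) =
      ∑ i, bdInner (M.elem i) (normalDeriv (M.elem i) (uN i)) (trace (M.elem i) (z i)) -
      ∑ i, ∫ x in M.elem i, wlap (M.elem i) (uN i) x * z i x := by
    rw [← Finset.sum_sub_distrib]
    refine Finset.sum_congr rfl fun i _ => ?_
    rw [← h4 i]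
    ring
  simp only [bilin, brInner, Finset.sum_add_distrib, Finset.sum_sub_distrib,
    Finset.sum_neg_distrib, ← Finset.mul_sum] at h1
  simp only [h3, Finset.sum_add_distrib, Finset.sum_sub_distrib, ← Finset.mul_sum]
  rw [h5, h2] at h1
  linarith

theorem jump_err (hu : IsEigenpair V lam u) (hn : ∀ i, MemH1Normal (M.elem i) u)
    (hN : ∀ i, MemH1Normal (M.elem i) (uN i)) (i : ι) :
    jump M (err u uN) i =ᵐ[surf (M.elem i)] fun x => - jump M uN i x := by
  filter_upwards [jump_sub M (fun j => (hn j).1) (fun j => (hN j).1) i,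
    hu.1.jump_eq_zero M i] with x h1 h2
  exact h1.trans (by rw [h2]; simp)

/-- The energy of the error after elementwise integration by parts. -/
theorem IsEigenpair.error_identity (hu : IsEigenpair V lam u)
    (hVc : ContinuousOn V (cube d)) (hVb : ∃ C : ℝ, ∀ x ∈ cube d, |V x| ≤ C)
    (hn : ∀ i, MemH1Normal (M.elem i) u) (hN : ∀ i, MemH1Normal (M.elem i) (uN i)) :
    ∑ i, l2grad (M.elem i) (err u uN i) ^ 2 +
      ∑ i, (∫ x in M.elem i, V x * err u uN i x * err u uN i x) =
    ∑ i, (∫ x in M.elem i, (lam * u x - lamN * uN i x) * err u uN i x) +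
      ∑ i, (∫ x in M.elem i, dgResidual (M.elem i) V lamN (uN i) x * err u uN i x) -
      1 / 2 * ∑ i, bdInner (M.elem i) (jumpGrad M uN i) (trace (M.elem i) (err u uN i)) -
      1 / 2 * ∑ i, bdInner (M.elem i) (normalDeriv (M.elem i) (err u uN i)) (jump M uN i) := by
  have he := memH1Normal_err M hn hN
  have h1 := sum_bdInner_normalDeriv_trace M he fun i => (he i).1
  have h2 : ∀ i, bdInner (M.elem i) (jumpGrad M (err u uN) i) (trace (M.elem i) (err u uN i)) =
      - bdInner (M.elem i) (jumpGrad M uN i) (trace (M.elem i) (err u uN i)) := fun i => by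
    rw [← bdInner_neg_left]
    refine bdInner_congr ?_ .rfl
    filter_upwards [jumpGrad_sub M hn hN i, hu.jumpGrad_eq_zero M hVc hVb hn i] with x h1 h2
    exact h1.trans (by rw [h2]; simp)
  have h3 : ∀ i, bdInner (M.elem i) (normalDeriv (M.elem i) (err u uN i)) (jump M (err u uN) i) =
      - bdInner (M.elem i) (normalDeriv (M.elem i) (err u uN i)) (jump M uN i) := fun i => by
    rw [← bdInner_neg_right]
    exact bdInner_congr .rfl (jump_err M hu hn hN i)
  simp only [h2, h3, Finset.sum_neg_distrib] at h1
  have h4 : ∀ i, l2grad (M.elem i) (err u uN i) ^ 2 +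
      (∫ x in M.elem i, V x * err u uN i x * err u uN i x) =
      (∫ x in M.elem i, (lam * u x - lamN * uN i x) * err u uN i x) +
      (∫ x in M.elem i, dgResidual (M.elem i) V lamN (uN i) x * err u uN i x) +
      bdInner (M.elem i) (normalDeriv (M.elem i) (err u uN i)) (trace (M.elem i) (err u uN i)) := by
    intro i
    have m0 := (he i).1.1
    have m1 : MemLp (fun x => lam * u x - lamN * uN i x) 2 (volume.restrict (M.elem i)) :=
      ((hn i).1.1.const_mul lam).sub ((hN i).1.1.const_mul lamN)
    have m2 := memLp_dgResidual M (lamN := lamN) hVc hVb (hN i)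
    have m3 := memLp_potential_mul hVc hVb (M.polytope i).isOpen.measurableSet (M.subset i) m0
    rw [← (he i).integral_wlap_mul_add (M.polytope i) (he i).1, l2grad_sq]
    simp only [real_inner_self_eq_norm_sq]
    -- Pointwise, `V e = (λu - λ_N u_N) + (λ_N u_N + Δu_N - V u_N) + Δe`, by the strong equation for
    -- `u`.
    have h5 : ∫ x in M.elem i, V x * err u uN i x * err u uN i x =
        ∫ x in M.elem i, (((lam * u x - lamN * uN i x) * err u uN i x +
          dgResidual (M.elem i) V lamN (uN i) x * err u uN i x) +
          wlap (M.elem i) (err u uN i) x * err u uN i x) := by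
      refine integral_congr_ae ?_
      filter_upwards [(hn i).wlap_sub (M.polytope i) (hN i),
        hu.eigenResidual_eq_zero M hVc hVb hn i] with x h6 h7
      have h8 : wlap (M.elem i) (err u uN i) x = _ := h6
      simp only [eigenResidual, Pi.zero_apply] at h7
      rw [h8]
      simp only [dgResidual, err]
      linear_combination (-(u x - uN i x)) * h7
    have i1 := integrable_mul_of_memLp m1 m0
    have i2 := integrable_mul_of_memLp m2 m0
    have i12 : Integrable (fun x => (lam * u x - lamN * uN i x) * err u uN i x +
          dgResidual (M.elem i) V lamN (uN i) x * err u uN i x) (volume.restrict (M.elem i)) :=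
      i1.add i2
    rw [h5, integral_add i12 (integrable_mul_of_memLp (he i).memLp_wlap m0), integral_add i1 i2]
    ring
  have h5 := Finset.sum_congr (rfl : (Finset.univ : Finset ι) = _) fun i _ => h4 i
  simp only [Finset.sum_add_distrib] at h5
  rw [h5, h1]
  ring

/-- The contribution of an element to the error representation. -/
def localError (V : E d → ℝ) (θ : ℝ) (γ : ι → ℝ) (lamN : ℝ) (e : ι → E d → ℝ)
    (uN z : ι → E d → ℝ) (i : ι) : ℝ :=
  (∫ x in M.elem i, dgResidual (M.elem i) V lamN (uN i) x * (e i x - z i x)) -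
    1 / 2 * bdInner (M.elem i) (jumpGrad M uN i) (trace (M.elem i) fun x => e i x - z i x) -
    1 / 2 * bdInner (M.elem i) (normalDeriv (M.elem i) (e i)) (jump M uN i) -
    θ / 2 * bdInner (M.elem i) (jump M uN i) (normalDeriv (M.elem i) (z i)) -
    bdInner (M.elem i) (fun x => average M γ i x * jump M uN i x)
      (trace (M.elem i) fun x => e i x - z i x)

theorem tnorm_sq {v : ι → E d → ℝ} (hγ : ∀ i, 0 ≤ γ i) (hV : ∀ x ∈ cube d, 0 ≤ V x) :
    tnorm M V γ v ^ 2 = ∑ i, l2grad (M.elem i) (v i) ^ 2 +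
      1 / 2 * ∑ i, γ i * bdInner (M.elem i) (jump M v i) (jump M v i) +
      ∑ i, ∫ x in M.elem i, V x * v i x * v i x := by
  rw [tnorm, Real.sq_sqrt (Finset.sum_nonneg fun i _ => by have := hγ i; positivity)]
  simp only [Finset.sum_add_distrib, Finset.mul_sum]
  congr 1
  · congr 1
    refine Finset.sum_congr rfl fun i _ => ?_
    rw [bdNorm_sq, bdInner]
    simp only [sq]
    ring
  · refine Finset.sum_congr rfl fun i _ => ?_
    rw [l2_sq]
    refine setIntegral_congr_fun (M.polytope i).isOpen.measurableSet fun x hx => ?_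
    simp only [mul_pow, Real.sq_sqrt (hV x (M.subset i hx))]
    ring

/-- The error representation. -/
theorem tnorm_err_sq (hu : IsEigenpair V lam u) (h : IsDGEigenpair M V θ γ W lamN uN)
    (hVc : ContinuousOn V (cube d)) (hVb : ∃ C : ℝ, ∀ x ∈ cube d, |V x| ≤ C)
    (hV : ∀ x ∈ cube d, 0 ≤ V x) (hγ : ∀ i, 0 ≤ γ i)
    (hW : ∀ i, ∀ v ∈ W i, MemH1Normal (M.elem i) v) (hn : ∀ i, MemH1Normal (M.elem i) u)
    {z : ι → E d → ℝ} (hz : ∀ i, z i ∈ W i) :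
    tnorm M V γ (err u uN) ^ 2 =
      ∑ i, (∫ x in M.elem i, (lam * u x - lamN * uN i x) * err u uN i x) +
      ∑ i, localError M V θ γ lamN (err u uN) uN z i := by
  have hN := fun i => hW i _ (h.1 i)
  have hz' := fun i => hW i _ (hz i)
  have he := memH1Normal_err M hn hN
  have hψ : ∀ i, MemH1 (M.elem i) (fun x => err u uN i x - z i x) := fun i =>
    (he i).1.sub (M.polytope i).isOpen (hz' i).1
  have h1 := hu.error_identity M (lamN := lamN) hVc hVb hn hN
  have h2 := h.residual_identity M hVc hVb hW hz
  -- Since the jump of `e` is minus that of `u_N`, the penalty part of the energy is `-½γ(⟦u_N⟧,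
  -- ⟦e⟧)`. The discrete equation contributes the same expression with `z` and the opposite sign, so
  -- only the jump of `e - z` remains, and it is rewritten through `{γ}`.
  have h3 := sum_mul_bdInner_jump M γ (fun i => (hN i).1) hψ
  have h4 : ∀ i, bdInner (M.elem i) (jump M uN i) (jump M (fun i x => err u uN i x - z i x) i) =
      bdInner (M.elem i) (jump M uN i) (jump M (err u uN) i) -
      bdInner (M.elem i) (jump M uN i) (jump M z i) := fun i => by
    rw [← bdInner_sub_right (memLp_jump M (fun i => (hN i).1) i)
      (memLp_jump M (fun i => (he i).1) i) (memLp_jump M (fun i => (hz' i).1) i)]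
    exact bdInner_congr .rfl (jump_sub M (fun i => (he i).1) (fun i => (hz' i).1) i)
  have h5 : ∀ i, bdInner (M.elem i) (jump M (err u uN) i) (jump M (err u uN) i) =
      - bdInner (M.elem i) (jump M uN i) (jump M (err u uN) i) := fun i => by
    rw [← bdInner_neg_left]
    exact bdInner_congr (jump_err M hu hn hN i) .rfl
  have h6 : ∀ i, ∫ x in M.elem i, dgResidual (M.elem i) V lamN (uN i) x *
      (err u uN i x - z i x) =
      (∫ x in M.elem i, dgResidual (M.elem i) V lamN (uN i) x * err u uN i x) -
      ∫ x in M.elem i, dgResidual (M.elem i) V lamN (uN i) x * z i x := fun i => by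
    have m := memLp_dgResidual M (lamN := lamN) hVc hVb (hN i)
    simp only [mul_sub]
    exact integral_sub (integrable_mul_of_memLp m (he i).1.1)
      (integrable_mul_of_memLp m (hz' i).1.1)
  have h7 : ∀ i, bdInner (M.elem i) (jumpGrad M uN i)
      (trace (M.elem i) fun x => err u uN i x - z i x) =
      bdInner (M.elem i) (jumpGrad M uN i) (trace (M.elem i) (err u uN i)) -
      bdInner (M.elem i) (jumpGrad M uN i) (trace (M.elem i) (z i)) := fun i => by
    rw [← bdInner_sub_right (memLp_jumpGrad M hN i) ((M.polytope i).memLp_trace (he i).1)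
      ((M.polytope i).memLp_trace (hz' i).1)]
    exact bdInner_congr .rfl (trace_sub (M.polytope i) (he i).1 (hz' i).1)
  rw [tnorm_sq M hγ hV]
  simp only [localError, h6, h7, Finset.sum_sub_distrib, ← Finset.mul_sum]
  simp only [h4, h5, mul_sub, mul_neg, Finset.sum_sub_distrib, Finset.sum_neg_distrib] at h3 ⊢
  linarith

/-- The convention `0/0 = 0` does no harm: if the gradient of `e` vanishes, so does its normal
derivative. -/
theorem bdNorm_normalDeriv_eq_cDu_mul {U : Set (E d)} {e : E d → ℝ} (h : IsOpenPolytope U)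
    (he : MemH1Normal U e) : bdNorm U (normalDeriv U e) = cDu U e * l2grad U e := by
  by_cases h0 : l2grad U e = 0
  · have h1 : wgrad U e =ᵐ[volume.restrict U] 0 := by
      rw [l2grad_eq_toReal h he.1, ENNReal.toReal_eq_zero_iff] at h0
      have m := he.1.memLp_wgrad h.isOpen
      exact (eLpNorm_eq_zero_iff m.1 (by norm_num)).1 (h0.resolve_right m.2.ne)
    rw [h0, mul_zero, bdNorm_congr (he.normalDeriv_eq_zero h h1)]
    simp [bdNorm]
  · rw [cDu, div_mul_cancel₀ _ h0]

/-- The contribution of an element is bounded by its estimators. -/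
theorem localError_le (hVc : ContinuousOn V (cube d))
    (hVb : ∃ C : ℝ, ∀ x ∈ cube d, |V x| ≤ C) (hγ : ∀ i, 0 ≤ γ i)
    (hW : ∀ i, ∀ v ∈ W i, MemH1Normal (M.elem i) v)
    (h1 : ∀ i, (fun _ => (1 : ℝ)) ∈ W i) (hn : ∀ i, MemH1Normal (M.elem i) u)
    (hN : ∀ i, MemH1Normal (M.elem i) (uN i))
    {z : ι → E d → ℝ} (i : ι) [FiniteDimensional ℝ (W i)] (hz : z i ∈ W i)
    (ho : ∀ w ∈ W i, sinner (M.elem i) (fun x => err u uN i x - z i x) w = 0)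
    (hs : snorm (M.elem i) (fun x => err u uN i x - z i x) ≤ l2grad (M.elem i) (err u uN i))
    (hl : l2grad (M.elem i) (z i) ≤ l2grad (M.elem i) (err u uN i)) :
    localError M V θ γ lamN (err u uN) uN z i ≤
      (etaR M V W lamN uN i + etaF M W uN i + etaJ M W θ γ u uN i) *
        l2grad (M.elem i) (err u uN i) := by
  have hi := M.polytope i
  have he := memH1Normal_err M hn hN i
  have hzn := hW i _ hz
  have hψ : MemH1 (M.elem i) (fun x => err u uN i x - z i x) := he.1.sub hi.isOpen hzn.1
  have mj := memLp_jump M (fun i => (hN i).1) i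
  have mg := memLp_jumpGrad M hN i
  have mt := hi.memLp_trace hψ
  obtain ⟨ma, ha⟩ := memLp_average_mul M hγ mj
  have hL := l2grad_nonneg (U := M.elem i) (v := err u uN i)
  have hA : l2 (M.elem i) (fun x => err u uN i x - z i x) ≤
      cA (M.elem i) (W i) * l2grad (M.elem i) (err u uN i) :=
    (hi.l2_le_cA hψ ho).trans (mul_le_mul_of_nonneg_left hs cA_nonneg)
  have hB : bdNorm (M.elem i) (trace (M.elem i) fun x => err u uN i x - z i x) ≤
      cB (M.elem i) (W i) * l2grad (M.elem i) (err u uN i) :=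
    (hi.bdNorm_le_cB hψ ho).trans (mul_le_mul_of_nonneg_left hs cB_nonneg)
  have hD : bdNorm (M.elem i) (normalDeriv (M.elem i) (z i)) ≤
      cD (M.elem i) (W i) * l2grad (M.elem i) (err u uN i) :=
    (bdNorm_le_cD_mul_l2grad hi (hW i) (h1 i) hz).trans (mul_le_mul_of_nonneg_left hl cD_nonneg)
  have hJ := bdNorm_nonneg (U := M.elem i) (v := jump M uN i)
  have t1 : |∫ x in M.elem i, dgResidual (M.elem i) V lamN (uN i) x * (err u uN i x - z i x)| ≤
      l2 (M.elem i) (dgResidual (M.elem i) V lamN (uN i)) *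
        (cA (M.elem i) (W i) * l2grad (M.elem i) (err u uN i)) :=
    (abs_integral_mul_le (memLp_dgResidual M hVc hVb (hN i)) hψ.1).trans
      (mul_le_mul_of_nonneg_left hA l2_nonneg)
  have t2 := (abs_bdInner_le mg mt).trans (mul_le_mul_of_nonneg_left hB bdNorm_nonneg)
  have t3 := abs_bdInner_le he.memLp_normalDeriv mj
  rw [bdNorm_normalDeriv_eq_cDu_mul hi he] at t3
  have t4 := (abs_bdInner_le mj hzn.memLp_normalDeriv).trans (mul_le_mul_of_nonneg_left hD hJ)
  have t5 := (abs_bdInner_le ma mt).trans (mul_le_mul ha hB bdNorm_nonneg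
    (mul_nonneg (gammaHat_nonneg M hγ i) hJ))
  have t4' : |θ / 2 * bdInner (M.elem i) (jump M uN i) (normalDeriv (M.elem i) (z i))| ≤
      |θ| / 2 * (bdNorm (M.elem i) (jump M uN i) *
        (cD (M.elem i) (W i) * l2grad (M.elem i) (err u uN i))) := by
    rw [abs_mul, abs_div, abs_two]
    exact mul_le_mul_of_nonneg_left t4 (by positivity)
  have e : etaR M V W lamN uN i = cA (M.elem i) (W i) *
    l2 (M.elem i) (dgResidual (M.elem i) V lamN (uN i)) := rfl
  rw [localError, e, etaF, etaJ, cC]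
  have s1 := le_abs_self (∫ x in M.elem i, dgResidual (M.elem i) V lamN (uN i) x *
    (err u uN i x - z i x))
  have s2 := neg_abs_le (bdInner (M.elem i) (jumpGrad M uN i)
    (trace (M.elem i) fun x => err u uN i x - z i x))
  have s3 := neg_abs_le (bdInner (M.elem i) (normalDeriv (M.elem i) (err u uN i)) (jump M uN i))
  have s4 := neg_abs_le (θ / 2 * bdInner (M.elem i) (jump M uN i)
    (normalDeriv (M.elem i) (z i)))
  have s5 := neg_abs_le (bdInner (M.elem i) (fun x => average M γ i x * jump M uN i x)
    (trace (M.elem i) fun x => err u uN i x - z i x))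
  linarith

theorem sum_l2grad_sq_le_tnorm_sq {v : ι → E d → ℝ} (hγ : ∀ i, 0 ≤ γ i) :
    ∑ i, l2grad (M.elem i) (v i) ^ 2 ≤ tnorm M V γ v ^ 2 := by
  rw [tnorm, Real.sq_sqrt (Finset.sum_nonneg fun i _ => by have := hγ i; positivity)]
  refine Finset.sum_le_sum fun i _ => ?_
  have : 0 ≤ γ i / 2 * bdNorm (M.elem i) (jump M v i) ^ 2 := by have := hγ i; positivity
  have : 0 ≤ l2 (M.elem i) (fun x => Real.sqrt (V x) * v i x) ^ 2 := by positivity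
  linarith

theorem hotUb_eq : hotUb M V γ lam lamN u uN =
    (∑ i, ∫ x in M.elem i, (lam * u x - lamN * uN i x) * err u uN i x) /
      tnorm M V γ (err u uN) := by
  rw [hotUb, brInner, Finset.sum_div]
  refine Finset.sum_congr rfl fun i _ => ?_
  rw [← integral_div]
  simp only [phi, mul_div_assoc]

/-- The a posteriori upper bound. -/
theorem tnorm_err_le (hu : IsEigenpair V lam u) (h : IsDGEigenpair M V θ γ W lamN uN)
    (hVc : ContinuousOn V (cube d)) (hVb : ∃ C : ℝ, ∀ x ∈ cube d, |V x| ≤ C)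
    (hV : ∀ x ∈ cube d, 0 ≤ V x) (hγ : ∀ i, 0 ≤ γ i) (hWfin : ∀ i, FiniteDimensional ℝ (W i))
    (h1 : ∀ i, (fun _ => (1 : ℝ)) ∈ W i)
    (hW : ∀ i, ∀ v ∈ W i, MemH1Normal (M.elem i) v) (hn : ∀ i, MemH1Normal (M.elem i) u) :
    tnorm M V γ (err u uN) ≤
      Real.sqrt (∑ i, (etaR M V W lamN uN i + etaF M W uN i + etaJ M W θ γ u uN i) ^ 2)
      + hotUb M V γ lam lamN u uN := by
  have hN := fun i => hW i _ (h.1 i)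
  have he := memH1Normal_err M hn hN
  -- The discrete test function is the projection of the error itself, not of the normalised error;
  -- dividing by the norm is left to the end.
  choose z hz ho hs hl using fun i =>
    exists_projection (M.polytope i) (fun w hw => (hW i w hw).1) (h1 i) (he i).1
  have hid := tnorm_err_sq M hu h hVc hVb hV hγ hW hn hz
  have hle : ∑ i, localError M V θ γ lamN (err u uN) uN z i ≤
      Real.sqrt (∑ i, (etaR M V W lamN uN i + etaF M W uN i + etaJ M W θ γ u uN i) ^ 2) *
        tnorm M V γ (err u uN) := by
    refine (Finset.sum_le_sum fun i _ => localError_le M hVc hVb hγ hW h1 hn hN i (hz i) (ho i)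
      (hs i) (hl i)).trans ((Real.sum_mul_le_sqrt_mul_sqrt _ _ _).trans ?_)
    refine mul_le_mul_of_nonneg_left ?_ (Real.sqrt_nonneg _)
    exact Real.sqrt_le_iff.2 ⟨Real.sqrt_nonneg _, sum_l2grad_sq_le_tnorm_sq M hγ⟩
  rw [hotUb_eq]
  have ht : 0 ≤ tnorm M V γ (err u uN) := Real.sqrt_nonneg _
  rcases ht.eq_or_lt with h0 | h0
  -- For zero error the term `hot^ub` is `0`, and the remaining bound is nonnegative.
  · rw [← h0, div_zero, add_zero]
    exact Real.sqrt_nonneg _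
  · rw [← mul_le_mul_iff_of_pos_right h0, add_mul, div_mul_cancel₀ _ h0.ne', ← sq, hid]
    linarith

end Estimate

end DGEig

end

/-! ### The main theorem -/

theorem mainTheorem1 {d : ℕ} (hd1 : 1 ≤ d) (hd3 : d ≤ 3) {ι : Type*} [Fintype ι]
    (M : DGEig.Mesh d ι)
    (V : DGEig.E d → ℝ) (hVsmooth : ContDiffOn ℝ ∞ V (DGEig.cube d))
    (hVbdd : ∃ C : ℝ, ∀ x ∈ DGEig.cube d, |V x| ≤ C) (hVnonneg : ∀ x ∈ DGEig.cube d, 0 ≤ V x)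
    (θ : ℝ) (γ : ι → ℝ) (hγ : ∀ i, 0 ≤ γ i)
    (W : ι → Submodule ℝ (DGEig.E d → ℝ)) (hWfin : ∀ i, FiniteDimensional ℝ (W i))
    (hWconst : ∀ i, (fun _ => (1 : ℝ)) ∈ W i)
    (hWreg : ∀ i, ∀ v ∈ W i, DGEig.MemH1Normal (M.elem i) v)
    (lam : ℝ) (u : DGEig.E d → ℝ) (hu : DGEig.IsEigenpair V lam u)
    (huH2 : ∀ i, DGEig.MemH2 (M.elem i) u)
    (lamN : ℝ) (uN : ι → DGEig.E d → ℝ) (huN : DGEig.IsDGEigenpair M V θ γ W lamN uN) :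
    (∀ i, BddAbove (DGEig.setA (M.elem i) (W i)) ∧ BddAbove (DGEig.setB (M.elem i) (W i)) ∧
      BddAbove (DGEig.setD (M.elem i) (W i))) ∧
    DGEig.tnorm M V γ (DGEig.err u uN) ≤
      Real.sqrt (∑ i, (DGEig.etaR M V W lamN uN i + DGEig.etaF M W uN i
        + DGEig.etaJ M W θ γ u uN i) ^ 2)
      + DGEig.hotUb M V γ lam lamN u uN := by
  -- The `H²` regularity enters only here, to provide a square integrable Laplacian and normal
  -- derivative of `u` on each element.
  have hn := fun i => (huH2 i).memH1Normal (M.polytope i)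
  refine ⟨fun i => ?_, DGEig.tnorm_err_le M hu huN hVsmooth.continuousOn hVbdd hVnonneg hγ hWfin
    hWconst hWreg hn⟩
  have := hWfin i
  exact ⟨(M.polytope i).bddAbove_setA, (M.polytope i).bddAbove_setB,
    DGEig.bddAbove_setD (M.polytope i) (hWreg i)⟩
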